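/- Let $\mathcal H$ be an infinite-dimensional real separable Hilbert space and let $y = a + \langle X,\beta\rangle + \epsilon$, where $a\in\mathbb R$, $\beta\in\mathcal H$, and the error $\epsilon$ is independent of $X$ with $\mathbb E\epsilon=0$ and $\mathbb E\epsilon^2<\infty$. Let $(X_i,y_i)$, $i\ge1$, be i.i.d. copies of $(X,y)$. Let $\mathscr K$ be the covariance operator of $X$, with eigenvalues $\lambda_j$ and an orthonormal basis $(\phi_j)_{j\ge1}$ of $\mathcal H$ of corresponding eigenvectors. Assume: (A1) $X$ is a centred Gaussian random element of $\mathcal H$; (A2) $\lambda_1>\lambda_2>\dots>0$, and for constants $\alpha>1$, $0<c<C$, $j_0\ge1$ we have $cj^{-\alpha}\le\lambda_j\le Cj^{-\alpha}$ for all $j\ge j_0$; (A3) for constants $d>0$, $\eta>1/2$, $j_0\ge1$ we have $|\langle\beta,\phi_j\rangle|\le dj^{-\eta}$ for all $j\ge j_0$. Write $f\otimes g$ for the operator $u\mapsto\langle g,u\rangle f$, $\mathscr A^-$ for the Moore–Penrose inverse, $\mathscr I$ for the identity, and, for $W_1,\dots,W_n\in\mathcal H$, $\hat C(W)=n^{-1}\sum_{i=1}^n(y_i-\bar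 y)(W_i-\bar W)$. Let $\hat{\mathscr K}=n^{-1}\sum_{i=1}^nX_i\otimes X_i=\sum_{j=1}^n\hat\lambda_j\hat\phi_j\otimes\hat\phi_j$ with $\hat\lambda_1\ge\hat\lambda_2\ge\dots\ge 0$ and orthonormal random elements $\hat\phi_j$. Fix an integer $r\ge 0$ and put $\mathscr P_1=\sum_{j\le r}\phi_j\otimes\phi_j$, $\mathscr P_2=\mathscr I-\mathscr P_1$, $\hat{\mathscr P}_1=\sum_{j\le r}\hat\phi_j\otimes\hat\phi_j$, $\hat{\mathscr P}_2=\mathscr I-\hat{\mathscr P}_1$. For $k=1,2$ let $\mathscr K_k$ be the covariance operator of $\mathscr P_kX$ and $\hat{\mathscr K}_k=n^{-1}\sum_{i=1}^n\hat{\mathscr P}_kX_i\otimes\hat{\mathscr P}_kX_i$. For $\rho>0$ define the hybrid and Tikhonov estimators and their oracle versions $$\hat\beta_{HR}=\hat{\mathscr K}_1^-\hat C(\hat{\mathscr P}_1X)+(\hat{\mathscr K}_2+\rho\hat{\mathscr P}_2)^-\hat C(\hat{\mathscr P}_2X),\qquad \tilde\beta_{HR}=\mathscr K_1^-\hat C(\mathscr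 P_1X)+(\mathscr K_2+\rho\mathscr P_2)^-\hat C(\mathscr P_2X),$$ $$\hat\beta_{TR}=(\hat{\mathscr K}+\rho\mathscr I)^{-1}\hat C(X),\qquad \tilde\beta_{TR}=(\mathscr K+\rho\mathscr I)^{-1}\hat C(X),$$ and $\mathrm{MSE}(\delta)=\mathbb E\|\delta-\beta\|^2$. Suppose $\alpha<2\eta$ and $\alpha\neq\eta-1/2$; put $m=(2\eta-1)/\alpha$ if $\alpha>\eta-1/2$ and $m=2$ if $\alpha<\eta-1/2$. Let $\rho=\rho_n>0$ be any sequence with $\rho\to0$ and $n\rho^2\to\infty$ as $n\to\infty$. Then for all sufficiently large $n$ the four mean squared errors are finite, and, as $n\to\infty$, $$|\mathrm{MSE}(\hat\beta_{HR})-\mathrm{MSE}(\tilde\beta_{HR})|=O\left(\Big\{\frac1{n\rho^{1+1/\alpha}}+\rho^m\Big\}^{1/2}\Big(\frac1{n\rho^{1+1/\alpha}}\Big)^{1/2}+\frac1{n\rho^{1+1/\alpha}}\right),$$ $$\mathrm{MSE}(\hat\beta_{HR})=O\left(\frac1{n\rho^{1+1/\alpha}}+\rho^m\right),$$ and the same two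 bounds hold with $\hat\beta_{HR},\tilde\beta_{HR}$ replaced by $\hat\beta_{TR},\tilde\beta_{TR}$. -/

import Mathlib

open MeasureTheory ProbabilityTheory Filter Topology InnerProductSpace Finset

noncomputable section

namespace HybridReg

/-! ### Operators on a real Hilbert space -/

section Operators

variable {H : Type*} [NormedAddCommGroup H] [InnerProductSpace ℝ H] [CompleteSpace H]

/-- `B` satisfies the four Penrose equations for the bounded operator `A`. -/
structure IsMoorePenrose (A B : H →L[ℝ] H) : Prop where
  mul_mul_left : A * B * A = A
  mul_mul_right : B * A * B = B
  star_left : star (A * B) = A * B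
  star_right : star (B * A) = B * A

/-- The Penrose equations have at most one bounded solution. -/
theorem IsMoorePenrose.unique {A B B' : H →L[ℝ] H} (h : IsMoorePenrose A B)
    (h' : IsMoorePenrose A B') : B = B' := by
  have e1 : A * B = A * B' := by
    calc A * B = star (A * B) := h.star_left.symm
      _ = star ((A * B') * (A * B)) := by rw [← mul_assoc, h'.mul_mul_left]
      _ = (A * B) * (A * B') := by rw [star_mul, h.star_left, h'.star_left]
      _ = A * B' := by rw [← mul_assoc, h.mul_mul_left]
  have e2 : B * A = B' * A := by
    calc B * A = star (B * A) := h.star_right.symm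
      _ = star ((B * A) * (B' * A)) := by
          rw [mul_assoc, ← mul_assoc A B' A, h'.mul_mul_left]
      _ = (B' * A) * (B * A) := by rw [star_mul, h.star_right, h'.star_right]
      _ = B' * A := by rw [mul_assoc, ← mul_assoc A B A, h.mul_mul_left]
  calc B = B * A * B := h.mul_mul_right.symm
    _ = B' * A * B' := by rw [e2, mul_assoc, e1, ← mul_assoc]
    _ = B' := h'.mul_mul_right

open Classical in
/-- The Moore-Penrose generalised inverse `A⁻` of a bounded operator. It exists as a bounded
operator exactly when the range of `A` is closed, which is the case for the operators to which it
is applied below; otherwise the value `0` is used. -/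
def pinv (A : H →L[ℝ] H) : H →L[ℝ] H :=
  if h : ∃ B, IsMoorePenrose A B then h.choose else 0

theorem IsMoorePenrose.pinv_eq {A B : H →L[ℝ] H} (h : IsMoorePenrose A B) : pinv A = B := by
  have hex : ∃ B, IsMoorePenrose A B := ⟨B, h⟩
  rw [pinv, dif_pos hex]
  exact hex.choose_spec.unique h

/-- `∑_{j < r} f_j ⊗ f_j`; for an orthonormal family, the orthogonal projection onto the span of
its first `r` members. -/
def projFirst (r : ℕ) (f : ℕ → H) : H →L[ℝ] H :=
  ∑ j ∈ range r, rankOne ℝ (f j) (f j)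

end Operators

/-! ### Population quantities and conditions -/

section Population

variable {Ω : Type*} [MeasurableSpace Ω]
  {H : Type*} [NormedAddCommGroup H] [InnerProductSpace ℝ H] [CompleteSpace H]
  [MeasurableSpace H] [BorelSpace H]

/-- The covariance operator `u ↦ E[⟨W - E W, u⟩ (W - E W)]` of a random element `W` of `H`. -/
def covOp (P : Measure Ω) (W : Ω → H) : H →L[ℝ] H :=
  covarianceOperator (P.map fun ω => W ω - ∫ ω', W ω' ∂P)

/-- The mean squared error `E ‖δ - β‖²` of an estimator `δ` of `β`. -/
def MSE (P : Measure Ω) (δ : Ω → H) (β : H) : ℝ := ∫ ω, ‖δ ω - β‖ ^ 2 ∂P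

/-- The response in the functional linear model with intercept `a` and slope `β`. -/
def response (a : ℝ) (β : H) (X : ℕ → Ω → H) (ε : ℕ → Ω → ℝ) (i : ℕ) (ω : Ω) : ℝ :=
  a + inner ℝ (X i ω) β + ε i ω

/-- The covariates `X_i` and errors `ε_i` are those of an i.i.d. sample from the functional linear
model: the pairs `(X_i, ε_i)` are i.i.d., each error is independent of its covariate, has mean
zero and has finite variance. -/
structure IsModelSample (P : Measure Ω) (X : ℕ → Ω → H) (ε : ℕ → Ω → ℝ) : Prop where
  measurable_X : ∀ i, Measurable (X i)
  measurable_ε : ∀ i, Measurable (ε i)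
  iIndep : iIndepFun (fun i ω => (X i ω, ε i ω)) P
  identDistrib : ∀ i, IdentDistrib (fun ω => (X i ω, ε i ω)) (fun ω => (X 0 ω, ε 0 ω)) P P
  indep_noise : IndepFun (X 0) (ε 0) P
  memLp_noise : MemLp (ε 0) 2 P
  mean_noise : ∫ ω, ε 0 ω ∂P = 0

/-- (A1): `W` is a centred Gaussian random element. -/
structure CondA1 (P : Measure Ω) (W : Ω → H) : Prop where
  gaussian : HasGaussianLaw W P
  centered : ∫ ω, W ω ∂P = 0

/-- (A2): the eigenvalues are positive, strictly decreasing and decay like `j ^ (-α)`, `α > 1`.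
The entry with index `j` is the eigenvalue number `j + 1`. -/
structure CondA2 (α : ℝ) (lam : ℕ → ℝ) : Prop where
  one_lt : 1 < α
  strictAnti : StrictAnti lam
  pos : ∀ j, 0 < lam j
  decay : ∃ (c C : ℝ) (j₀ : ℕ), 0 < c ∧ c < C ∧ ∀ j ≥ j₀,
    c * ((j : ℝ) + 1) ^ (-α) ≤ lam j ∧ lam j ≤ C * ((j : ℝ) + 1) ^ (-α)

/-- (A3): the Fourier coefficients of `β` decay at least as fast as `j ^ (-η)`, `η > 1/2`. -/
structure CondA3 (η : ℝ) (β : H) (φ : ℕ → H) : Prop where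
  half_lt : 1 / 2 < η
  decay : ∃ (d : ℝ) (j₀ : ℕ), 0 < d ∧ ∀ j ≥ j₀,
    |inner ℝ β (φ j)| ≤ d * ((j : ℝ) + 1) ^ (-η)

end Population

/-! ### Sample quantities and the estimators, as functions of the data -/

section Sample

variable {H : Type*} [NormedAddCommGroup H] [InnerProductSpace ℝ H] [CompleteSpace H]

/-- The mean of the first `n` observations. -/
def sampleMean {E : Type*} [AddCommGroup E] [Module ℝ E] (n : ℕ) (x : ℕ → E) : E :=
  (n : ℝ)⁻¹ • ∑ i ∈ range n, x i

/-- The empirical covariance operator `n⁻¹ ∑ x_i ⊗ x_i`. -/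
def empCov (n : ℕ) (x : ℕ → H) : H →L[ℝ] H :=
  (n : ℝ)⁻¹ • ∑ i ∈ range n, rankOne ℝ (x i) (x i)

/-- The empirical cross-covariance `n⁻¹ ∑ (y_i - ȳ) (x_i - x̄)`. -/
def empCrossCov (n : ℕ) (y : ℕ → ℝ) (x : ℕ → H) : H :=
  (n : ℝ)⁻¹ • ∑ i ∈ range n, (y i - sampleMean n y) • (x i - sampleMean n x)

/-- `f` is an orthonormal system of eigenvectors of the empirical covariance operator, listed by
decreasing eigenvalues `l`: `n⁻¹ ∑ x_i ⊗ x_i = ∑_{j < n} l_j f_j ⊗ f_j`. The operator has rank at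
most `n`, so that the eigenvalues from index `n` on are `0`. -/
structure IsEmpEigenSystem (n : ℕ) (x : ℕ → H) (l : ℕ → ℝ) (f : ℕ → H) : Prop where
  orthonormal : Orthonormal ℝ f
  antitone : Antitone l
  eq_zero : ∀ j ≥ n, l j = 0
  spectral : empCov n x = ∑ j ∈ range n, l j • rankOne ℝ (f j) (f j)

/-- The hybrid regularisation estimator `K̂₁⁻ Ĉ₁ + (K̂₂ + ρ P̂₂)⁻ Ĉ₂`, where `P̂₁` is the projection
onto the span of the first `r` members of the empirical eigensystem `f`, `P̂₂ = I - P̂₁`, and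
`K̂ₖ`, `Ĉₖ` are the empirical covariance and cross-covariance of the `P̂ₖ x_i`. -/
def hybrid (n r : ℕ) (ρ : ℝ) (f : ℕ → H) (x : ℕ → H) (y : ℕ → ℝ) : H :=
  let P₁ := projFirst r f
  let P₂ := 1 - P₁
  let K₁ := empCov n (fun i => P₁ (x i))
  let K₂ := empCov n (fun i => P₂ (x i))
  let C₁ := empCrossCov n y (fun i => P₁ (x i))
  let C₂ := empCrossCov n y (fun i => P₂ (x i))
  pinv K₁ C₁ + pinv (K₂ + ρ • P₂) C₂

/-- The Tikhonov estimator `(K̂ + ρ I)⁻¹ Ĉ`. -/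
def tikhonov (n : ℕ) (ρ : ℝ) (x : ℕ → H) (y : ℕ → ℝ) : H :=
  Ring.inverse (empCov n x + ρ • (1 : H →L[ℝ] H)) (empCrossCov n y x)

/-- The oracle Tikhonov estimator `(K + ρ I)⁻¹ Ĉ`, for the true covariance operator `K`. -/
def oracleTikhonov (K : H →L[ℝ] H) (n : ℕ) (ρ : ℝ) (x : ℕ → H) (y : ℕ → ℝ) : H :=
  Ring.inverse (K + ρ • (1 : H →L[ℝ] H)) (empCrossCov n y x)

/-- The oracle hybrid estimator `K₁⁻ C̃₁ + (K₂ + ρ P₂)⁻ C̃₂`, for the true projection `P₁`,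
`P₂ = I - P₁`, the true covariance operators `K₁`, `K₂` of `P₁ X`, `P₂ X`, and the empirical
cross-covariances `C̃ₖ` of the `P_k x_i`. -/
def oracleHybrid (P₁ K₁ K₂ : H →L[ℝ] H) (n : ℕ) (ρ : ℝ) (x : ℕ → H) (y : ℕ → ℝ) : H :=
  let P₂ := 1 - P₁
  let C₁ := empCrossCov n y (fun i => P₁ (x i))
  let C₂ := empCrossCov n y (fun i => P₂ (x i))
  pinv K₁ C₁ + pinv (K₂ + ρ • P₂) C₂

end Sample

/-! ### The estimators from the first `n` members of the sample, as random elements -/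

section Estimators

variable {Ω : Type*} [MeasurableSpace Ω]
  {H : Type*} [NormedAddCommGroup H] [InnerProductSpace ℝ H] [CompleteSpace H]

/-- The hybrid estimator with ridge parameter `ρ n` at sample size `n`, where `φHat n` is the
empirical eigensystem. -/
def betaHatHR (r : ℕ) (ρ : ℕ → ℝ) (φHat : ℕ → Ω → ℕ → H) (X : ℕ → Ω → H) (y : ℕ → Ω → ℝ)
    (n : ℕ) (ω : Ω) : H :=
  hybrid n r (ρ n) (φHat n ω) (fun i => X i ω) (fun i => y i ω)

/-- The Tikhonov estimator with ridge parameter `ρ n` at sample size `n`. -/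
def betaHatTR (ρ : ℕ → ℝ) (X : ℕ → Ω → H) (y : ℕ → Ω → ℝ) (n : ℕ) (ω : Ω) : H :=
  tikhonov n (ρ n) (fun i => X i ω) (fun i => y i ω)

variable [MeasurableSpace H] [BorelSpace H]

/-- The oracle hybrid estimator: `Y = P₁ X` and `Z = X - Y`, where `P₁` is the projection onto the
span of the first `r` true eigenvectors `φ`, with the true covariance operators of `Y` and `Z`. -/
def betaTildeHR (P : Measure Ω) (r : ℕ) (ρ : ℕ → ℝ) (φ : ℕ → H) (X : ℕ → Ω → H)
    (y : ℕ → Ω → ℝ) (n : ℕ) (ω : Ω) : H :=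
  oracleHybrid (projFirst r φ) (covOp P fun ω' => projFirst r φ (X 0 ω'))
    (covOp P fun ω' => X 0 ω' - projFirst r φ (X 0 ω')) n (ρ n) (fun i => X i ω) (fun i => y i ω)

/-- The oracle Tikhonov estimator, with the true covariance operator of `X`. -/
def betaTildeTR (P : Measure Ω) (ρ : ℕ → ℝ) (X : ℕ → Ω → H) (y : ℕ → Ω → ℝ)
    (n : ℕ) (ω : Ω) : H :=
  oracleTikhonov (covOp P (X 0)) n (ρ n) (fun i => X i ω) (fun i => y i ω)

end Estimators

/-- The variance rate `1 / (n ρ^(1 + 1/α))`. -/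
def varRate (α : ℝ) (ρ : ℕ → ℝ) (n : ℕ) : ℝ := 1 / ((n : ℝ) * ρ n ^ (1 + 1 / α))

/-- The rate `{1 / (n ρ^(1 + 1/α)) + ρ^m}` of the mean squared error. -/
def mseRate (α m : ℝ) (ρ : ℕ → ℝ) (n : ℕ) : ℝ := varRate α ρ n + ρ n ^ m

end HybridReg

end

noncomputable section

set_option linter.unusedSectionVars false

namespace HybridReg

open scoped ENNReal

/-! ### Sums of powers -/

/-! Write R and R̂ for the inverses of K + ρ and K̂ + ρ (`ridgeInv`). Since λ⁻¹ - (λ + ρ)⁻¹ = ρ λ⁻¹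
(λ + ρ)⁻¹, leaving the first r eigendirections unpenalised turns a Tikhonov solution T into T + ρ G
T, where G inverts the covariance on these directions (`pinv_add_pinv`). The hybrid estimator is R̂
Ĉ + ρ Ĝ R̂ Ĉ, its oracle version is R Ĉ + ρ G R Ĉ, and r = 0 gives the Tikhonov case, so that
`regularised_rates` serves both.

Tikhonov part. The cross-covariance Ĉ is K β plus `crossCovError`; put u = R K β and let w be R
applied to the error. The resolvent identity bounds the distance to the oracle by (1 + ρ⁻¹ ‖K - K̂‖)
(‖R (K - K̂) u‖ + ‖w‖), which is `tikErr`. As u is deterministic, the j-th coordinate of (K - K̂) u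
has mean square of order λ_j / n; the mean square of the j-th coordinate of the error is bounded in
the same way. After R this sums to n⁻¹ ∑ λ_j / (λ_j + ρ)², the variance rate. The first factor has a
bounded fourth moment once n ρ² ≥ 1, because K - K̂ is of order n^(-1/2) in Hilbert-Schmidt norm.
The bias ρ R β is summed coordinatewise, with the cut at the index where λ_j is comparable to ρ
(`exists_sum_bias_le`).

Hybrid correction. If ‖K - K̂‖ is below a threshold δ given by the spectral gap, then ‖Ĝ - G‖ is at
most a multiple of ‖K - K̂‖ (`exists_norm_diagOp_inv_sub_le`). Otherwise Ĝ may be large, but ρ Ĝ R̂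
Ĉ is still controlled by square roots of inverse empirical eigenvalues, and ‖K - K̂‖ / δ > 1 may be
inserted as a small factor. Taking expectations then needs inverse moments of the leading empirical
eigenvalues. `exists_inv_eigenvalue_bound` provides them through a function ℓ of the design alone,
which is therefore independent of the noise; it rests on an integral over directions that replaces a
supremum over the sphere (`invQuadBound`).

Altogether the estimator is within O(`varRate` ^ (1/2)) of its oracle in L², and the oracle within
O(`mseRate` ^ (1/2)) of β; `mse_comparison` turns this into the two bounds. -/

theorem exists_forall_le_mul_of_eventually {f g : ℕ → ℝ} {C : ℝ} {j₀ : ℕ} (hf : ∀ j, 0 ≤ f j)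
    (hg : ∀ j, 0 < g j) (h : ∀ j ≥ j₀, f j ≤ C * g j) : ∃ D, 0 < D ∧ ∀ j, f j ≤ D * g j := by
  refine ⟨|C| + 1 + ∑ j ∈ range j₀, f j / g j, ?_, fun j => ?_⟩
  · have : 0 ≤ ∑ j ∈ range j₀, f j / g j := sum_nonneg fun j _ => div_nonneg (hf j) (hg j).le
    positivity
  · have hS : 0 ≤ ∑ j ∈ range j₀, f j / g j := sum_nonneg fun j _ => div_nonneg (hf j) (hg j).le
    rcases lt_or_ge j j₀ with hj | hj
    · rw [← div_le_iff₀ (hg j)]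
      have := single_le_sum (f := fun j => f j / g j) (fun i _ => div_nonneg (hf i) (hg i).le)
        (mem_range.2 hj)
      have h' := abs_nonneg C
      beta_reduce at this
      linarith
    · refine (h j hj).trans (mul_le_mul_of_nonneg_right ?_ (hg j).le)
      have := le_abs_self C
      linarith

/-- Each summand is at most a multiple of (n + 1) ^ p - n ^ p, so the sum telescopes. The factor min
1 p covers p ≤ 1, where Bernoulli's inequality for exponents below 1 applies, as well as p ≥ 1,
where y ^ p ≤ y on [0, 1]. -/
theorem sum_range_rpow_le {p : ℝ} (hp : 0 < p) (N : ℕ) :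
    ∑ j ∈ range N, ((j : ℝ) + 1) ^ (p - 1) ≤ (min 1 p)⁻¹ * (N : ℝ) ^ p := by
  have hm : 0 < min 1 p := lt_min one_pos hp
  induction N with
  | zero => simp [Real.zero_rpow hp.ne']
  | succ n ih =>
    rw [sum_range_succ]
    have key : min 1 p * ((n : ℝ) + 1) ^ (p - 1) ≤ ((n : ℝ) + 1) ^ p - (n : ℝ) ^ p := by
      have hn : (0 : ℝ) < (n : ℝ) + 1 := by positivity
      have hx : (n : ℝ) = ((n : ℝ) + 1) * (1 + -(1 / ((n : ℝ) + 1))) := by field_simp; ring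
      have h1 : 1 / ((n : ℝ) + 1) ≤ 1 := by
        rw [div_le_one hn]; linarith [(Nat.cast_nonneg n : (0 : ℝ) ≤ n)]
      have h0 : 0 ≤ 1 / ((n : ℝ) + 1) := by positivity
      have hb : (1 + -(1 / ((n : ℝ) + 1))) ^ p ≤ 1 - min 1 p * (1 / ((n : ℝ) + 1)) := by
        rcases le_total p 1 with h | h
        · rw [min_eq_right h]
          have := rpow_one_add_le_one_add_mul_self (s := -(1 / ((n : ℝ) + 1)))
            (by linarith) hp.le h
          linarith
        · rw [min_eq_left h]
          have := Real.rpow_le_rpow_of_exponent_ge' (x := 1 + -(1 / ((n : ℝ) + 1)))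
            (by linarith) (by linarith) zero_le_one h
          rw [Real.rpow_one] at this
          linarith
      have h2 : (n : ℝ) ^ p = ((n : ℝ) + 1) ^ p * (1 + -(1 / ((n : ℝ) + 1))) ^ p := by
        rw [← Real.mul_rpow hn.le (by linarith), ← hx]
      rw [h2, Real.rpow_sub_one hn.ne']
      have h3 := mul_le_mul_of_nonneg_left hb (Real.rpow_nonneg hn.le p)
      have h4 : min 1 p * (((n : ℝ) + 1) ^ p / ((n : ℝ) + 1))
        = ((n : ℝ) + 1) ^ p * (min 1 p * (1 / ((n : ℝ) + 1))) := by ring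
      rw [h4]; linarith
    have h5 : ((n : ℝ) + 1) ^ (p - 1) ≤ (min 1 p)⁻¹ * (((n : ℝ) + 1) ^ p - (n : ℝ) ^ p) := by
      rw [inv_mul_eq_div, le_div_iff₀ hm]; linarith
    push_cast
    linarith

/-- Telescoping against differences of n ^ (-q). The bound for one increment combines log y ≤ y - 1
with 1 + t ≤ exp t. -/
theorem sum_Ico_rpow_le {q : ℝ} (hq : 0 < q) {M N : ℕ} (hM : 1 ≤ M) :
    ∑ j ∈ Ico M N, ((j : ℝ) + 1) ^ (-q - 1) ≤ q⁻¹ * (M : ℝ) ^ (-q) := by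
  rcases le_total N M with h | h
  · rw [Ico_eq_empty_of_le h, sum_empty]; positivity
  suffices H : ∑ j ∈ Ico M N, ((j : ℝ) + 1) ^ (-q - 1) ≤ q⁻¹ * ((M : ℝ) ^ (-q) - (N : ℝ) ^ (-q)) by
    refine H.trans (mul_le_mul_of_nonneg_left ?_ (by positivity))
    have : 0 ≤ (N : ℝ) ^ (-q) := by positivity
    linarith
  induction N, h using Nat.le_induction with
  | base => simp
  | succ n hn ih =>
    rw [sum_Ico_succ_top hn]
    have hn0 : (0 : ℝ) < n := by exact_mod_cast (by omega : 0 < n)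
    have hn1 : (0 : ℝ) < (n : ℝ) + 1 := by positivity
    have hy : 0 < (n : ℝ) / (n + 1) := by positivity
    have key : q * ((n : ℝ) + 1) ^ (-q - 1) ≤ (n : ℝ) ^ (-q) - ((n : ℝ) + 1) ^ (-q) := by
      have h2 : (n : ℝ) ^ (-q) = ((n : ℝ) + 1) ^ (-q) * ((n : ℝ) / (n + 1)) ^ (-q) := by
        rw [← Real.mul_rpow hn1.le hy.le]; congr 1; field_simp
      have hb : 1 + q / ((n : ℝ) + 1) ≤ ((n : ℝ) / (n + 1)) ^ (-q) := by
        rw [Real.rpow_def_of_pos hy]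
        have h3 := Real.log_le_sub_one_of_pos hy
        have h4 := Real.add_one_le_exp (Real.log ((n : ℝ) / (n + 1)) * -q)
        have h5 : (n : ℝ) / (n + 1) - 1 = -(1 / ((n : ℝ) + 1)) := by field_simp; ring
        rw [h5] at h3
        have h6 : q / ((n : ℝ) + 1) = q * (1 / ((n : ℝ) + 1)) := by ring
        nlinarith
      rw [h2, Real.rpow_sub_one hn1.ne']
      have h3 := mul_le_mul_of_nonneg_left hb (Real.rpow_nonneg hn1.le (-q))
      have h4 : q * (((n : ℝ) + 1) ^ (-q) / ((n : ℝ) + 1))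
        = ((n : ℝ) + 1) ^ (-q) * (q / ((n : ℝ) + 1)) := by ring
      rw [h4]; linarith
    have h5 : ((n : ℝ) + 1) ^ (-q - 1) ≤ q⁻¹ * ((n : ℝ) ^ (-q) - ((n : ℝ) + 1) ^ (-q)) := by
      rw [inv_mul_eq_div, le_div_iff₀ hq]; linarith
    push_cast
    linarith

/-- Sums of a function of `j / J` that behaves like a power greater than `-1` below `J` and like a
power less than `-1` above `J` are of order `J`. -/
theorem exists_sum_split_le {s t : ℝ} (hs : -1 < s) (ht : 1 < t) :
    ∃ C, 0 < C ∧ ∀ J : ℝ, 1 ≤ J → ∀ N : ℕ, ∑ j ∈ range N,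
      (if (j : ℝ) + 1 ≤ J then (((j : ℝ) + 1) / J) ^ s else (((j : ℝ) + 1) / J) ^ (-t)) ≤ C * J := by
  set p := s + 1 with hp
  set q := t - 1 with hq
  have hp0 : 0 < p := by linarith
  have hq0 : 0 < q := by linarith
  have hm : 0 < min 1 p := lt_min one_pos hp0
  refine ⟨(min 1 p)⁻¹ + q⁻¹ * (2⁻¹ : ℝ) ^ (-q), by positivity, fun J hJ N => ?_⟩
  have hJ0 : 0 < J := by linarith
  set M := ⌊J⌋₊ with hMdef
  have hM1 : 1 ≤ M := Nat.one_le_floor_iff _ |>.2 hJ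
  have hMJ : (M : ℝ) ≤ J := Nat.floor_le hJ0.le
  have hJM : J < M + 1 := Nat.lt_floor_add_one J
  have hM1' : (1 : ℝ) ≤ M := by exact_mod_cast hM1
  -- Rounding J down loses at most a factor 2, because J ≥ 1.
  have hhalf : 2⁻¹ * J ≤ M := by linarith
  rw [sum_ite, add_mul]
  refine add_le_add ?_ ?_
  · calc ∑ j ∈ range N with ((j : ℕ) : ℝ) + 1 ≤ J, (((j : ℝ) + 1) / J) ^ s
        ≤ ∑ j ∈ range M, (((j : ℝ) + 1) / J) ^ s := by
          refine sum_le_sum_of_subset_of_nonneg (fun j hj => ?_) fun j _ _ => by positivity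
          rw [mem_filter] at hj
          rw [mem_range]
          have : (j : ℝ) < (M : ℝ) := by
            have : j + 1 ≤ M := Nat.le_floor (by push_cast; exact hj.2)
            exact_mod_cast this
          exact_mod_cast this
      _ = (∑ j ∈ range M, ((j : ℝ) + 1) ^ (p - 1)) * J ^ (-s) := by
          rw [sum_mul]
          refine sum_congr rfl fun j _ => ?_
          rw [Real.div_rpow (by positivity) hJ0.le, Real.rpow_neg hJ0.le, hp]
          simp [div_eq_mul_inv]
      _ ≤ ((min 1 p)⁻¹ * (M : ℝ) ^ p) * J ^ (-s) := by
          gcongr; exact sum_range_rpow_le hp0 M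
      _ ≤ ((min 1 p)⁻¹ * J ^ p) * J ^ (-s) := by gcongr
      _ = (min 1 p)⁻¹ * J := by
          rw [mul_assoc, ← Real.rpow_add hJ0, hp]; simp
  · calc ∑ j ∈ range N with ¬ ((j : ℕ) : ℝ) + 1 ≤ J, (((j : ℝ) + 1) / J) ^ (-t)
        ≤ ∑ j ∈ Ico M N, (((j : ℝ) + 1) / J) ^ (-t) := by
          refine sum_le_sum_of_subset_of_nonneg (fun j hj => ?_) fun j _ _ => by positivity
          rw [mem_filter, mem_range] at hj
          rw [mem_Ico]
          refine ⟨?_, hj.1⟩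
          have : (M : ℝ) < (j : ℝ) + 1 := lt_of_le_of_lt hMJ (not_le.1 hj.2)
          have : M < j + 1 := by exact_mod_cast this
          omega
      _ = (∑ j ∈ Ico M N, ((j : ℝ) + 1) ^ (-q - 1)) * J ^ t := by
          rw [sum_mul]
          refine sum_congr rfl fun j _ => ?_
          rw [Real.div_rpow (by positivity) hJ0.le, Real.rpow_neg hJ0.le, hq]
          rw [show -(t - 1) - 1 = -t by ring]
          simp [div_eq_mul_inv]
      _ ≤ (q⁻¹ * (M : ℝ) ^ (-q)) * J ^ t := by
          gcongr; exact sum_Ico_rpow_le hq0 hM1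
      _ ≤ (q⁻¹ * (2⁻¹ * J) ^ (-q)) * J ^ t := by
          have : (M : ℝ) ^ (-q) ≤ (2⁻¹ * J) ^ (-q) :=
            Real.rpow_le_rpow_of_nonpos (by positivity) hhalf (by linarith)
          gcongr
      _ = q⁻¹ * (2⁻¹ : ℝ) ^ (-q) * J := by
          rw [Real.mul_rpow (by norm_num) hJ0.le, mul_assoc, mul_assoc, ← Real.rpow_add hJ0, hq,
            mul_assoc]
          simp

/-- All eigenvalues are positive, so the constants can absorb the finitely many indices below the
threshold. -/
theorem CondA2.exists_bounds {α : ℝ} {lam : ℕ → ℝ} (h : CondA2 α lam) :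
    ∃ c C : ℝ, 0 < c ∧ 0 < C ∧ ∀ j : ℕ,
      c * ((j : ℝ) + 1) ^ (-α) ≤ lam j ∧ lam j ≤ C * ((j : ℝ) + 1) ^ (-α) := by
  obtain ⟨c, C, j₀, hc, hcC, hd⟩ := h.decay
  obtain ⟨C', hC', hu⟩ := exists_forall_le_mul_of_eventually (f := lam)
    (g := fun j : ℕ => ((j : ℝ) + 1) ^ (-α)) (fun j => (h.pos j).le) (fun j => by positivity)
    fun j hj => (hd j hj).2
  obtain ⟨D, hD, hl⟩ := exists_forall_le_mul_of_eventually (g := lam) (C := c⁻¹)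
    (f := fun j : ℕ => ((j : ℝ) + 1) ^ (-α)) (fun j => by positivity) h.pos
    (fun j hj => by rw [inv_mul_eq_div, le_div_iff₀ hc, mul_comm]; exact (hd j hj).1)
  refine ⟨D⁻¹, C', by positivity, hC', fun j => ⟨?_, hu j⟩⟩
  rw [inv_mul_eq_div, div_le_iff₀ hD, mul_comm]
  exact hl j

theorem CondA2.summable {α : ℝ} {lam : ℕ → ℝ} (h : CondA2 α lam) : Summable lam := by
  obtain ⟨c, C, -, -, hb⟩ := h.exists_bounds
  refine Summable.of_nonneg_of_le (fun j => (h.pos j).le) (fun j => (hb j).2) ?_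
  refine Summable.mul_left _ ?_
  have := (summable_nat_add_iff 1).2 (Real.summable_nat_rpow.2 (by linarith [h.one_lt] : -α < -1))
  exact_mod_cast this

/-- The effective dimension bound behind the variance rate. -/
theorem CondA2.exists_sum_variance_le {α : ℝ} {lam : ℕ → ℝ} (h : CondA2 α lam) :
    ∃ C, 0 < C ∧ ∀ ρ : ℝ, 0 < ρ → ρ ≤ 1 → ∀ N : ℕ,
      ∑ j ∈ range N, lam j / (lam j + ρ) ^ 2 ≤ C * (1 / ρ ^ (1 + 1 / α)) := by
  obtain ⟨c, C, hc, hC, hb⟩ := h.exists_bounds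
  have hα := h.one_lt
  have hα0 : 0 < α := by linarith
  obtain ⟨B, hB, hsum⟩ := exists_sum_split_le (s := 0) (t := α) (by norm_num) hα
  refine ⟨max 1 C * B, by positivity, fun ρ hρ hρ1 N => ?_⟩
  -- J is the index at which j ^ (-α) reaches ρ. Terms up to J are at most ρ⁻¹, later ones at most
  -- λ_j / ρ², and the total is of order J / ρ.
  set J := ρ ^ (-(1 / α)) with hJ
  have hJ1 : 1 ≤ J := Real.one_le_rpow_of_pos_of_le_one_of_nonpos hρ hρ1 (by
    have : 0 < 1 / α := by positivity
    linarith)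
  have hJ0 : 0 < J := by positivity
  have hJα : J ^ α = ρ⁻¹ := by
    rw [hJ, ← Real.rpow_mul hρ.le, ← Real.rpow_neg_one]; congr 1; field_simp
  calc ∑ j ∈ range N, lam j / (lam j + ρ) ^ 2
      ≤ ∑ j ∈ range N, max 1 C * ρ⁻¹ * (if (j : ℝ) + 1 ≤ J then (((j : ℝ) + 1) / J) ^ (0 : ℝ)
          else (((j : ℝ) + 1) / J) ^ (-α)) := by
        refine sum_le_sum fun j _ => ?_
        have hl := h.pos j
        split_ifs with hj
        · rw [Real.rpow_zero, mul_one]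
          calc lam j / (lam j + ρ) ^ 2 ≤ 1 * ρ⁻¹ := by
                rw [one_mul, ← one_div, div_le_div_iff₀ (by positivity) hρ]
                nlinarith
            _ ≤ _ := by gcongr; exact le_max_left _ _
        · have e1 : (((j : ℝ) + 1) / J) ^ (-α) = ((j : ℝ) + 1) ^ (-α) * ρ⁻¹ := by
            rw [Real.div_rpow (by positivity) hJ0.le, Real.rpow_neg hJ0.le, hJα]; simp [div_eq_mul_inv]
          rw [e1]
          calc lam j / (lam j + ρ) ^ 2 ≤ lam j / ρ ^ 2 := by gcongr; linarith
            _ ≤ (C * ((j : ℝ) + 1) ^ (-α)) / ρ ^ 2 := by gcongr; exact (hb j).2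
            _ = C * ρ⁻¹ * (((j : ℝ) + 1) ^ (-α) * ρ⁻¹) := by field_simp
            _ ≤ _ := by gcongr; exact le_max_right _ _
    _ ≤ max 1 C * ρ⁻¹ * (B * J) := by
        rw [← mul_sum]; gcongr; exact hsum J hJ1 N
    _ = max 1 C * B * (1 / ρ ^ (1 + 1 / α)) := by
        rw [hJ, Real.rpow_add hρ, Real.rpow_one, Real.rpow_neg hρ.le]; field_simp

/-- The order of the squared bias of Tikhonov regularisation. -/
theorem exists_sum_bias_le {α η m : ℝ} {lam b : ℕ → ℝ} (h : CondA2 α lam) (hη : 1 / 2 < η)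
    (hb : ∃ (d : ℝ) (j₀ : ℕ), 0 < d ∧ ∀ j ≥ j₀, |b j| ≤ d * ((j : ℝ) + 1) ^ (-η))
    (hm : (η - 1 / 2 < α ∧ m = (2 * η - 1) / α) ∨ (α < η - 1 / 2 ∧ m = 2)) :
    ∃ C, 0 < C ∧ ∀ ρ : ℝ, 0 < ρ → ρ ≤ 1 → ∀ N : ℕ,
      ∑ j ∈ range N, (ρ * b j / (lam j + ρ)) ^ 2 ≤ C * ρ ^ m := by
  obtain ⟨c, C, hc, hC, hl⟩ := h.exists_bounds
  obtain ⟨d₀, j₀, -, hd₀⟩ := hb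
  obtain ⟨d, hd, hb⟩ := exists_forall_le_mul_of_eventually (f := fun j => |b j|)
    (g := fun j : ℕ => ((j : ℝ) + 1) ^ (-η)) (fun j => abs_nonneg _) (fun j => by positivity) hd₀
  have hα0 : 0 < α := by linarith [h.one_lt]
  -- the two pointwise bounds
  have b1 : ∀ ρ : ℝ, 0 < ρ → ∀ j : ℕ, (ρ * b j / (lam j + ρ)) ^ 2
      ≤ (d / c) ^ 2 * ρ ^ 2 * ((j : ℝ) + 1) ^ (2 * α - 2 * η) := by
    intro ρ hρ j
    have hlj := h.pos j
    have hj : (0 : ℝ) < (j : ℝ) + 1 := by positivity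
    have e : ((j : ℝ) + 1) ^ (2 * α - 2 * η)
        = (((j : ℝ) + 1) ^ (-η) / ((j : ℝ) + 1) ^ (-α)) ^ 2 := by
      rw [← Real.rpow_sub hj, ← Real.rpow_natCast, ← Real.rpow_mul hj.le]
      congr 1; push_cast; ring
    have key : |ρ * b j / (lam j + ρ)|
        ≤ d / c * ρ * (((j : ℝ) + 1) ^ (-η) / ((j : ℝ) + 1) ^ (-α)) := by
      rw [abs_div, abs_mul, abs_of_pos hρ, abs_of_pos (by linarith : 0 < lam j + ρ)]
      calc ρ * |b j| / (lam j + ρ) ≤ ρ * (d * ((j : ℝ) + 1) ^ (-η))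
            / (c * ((j : ℝ) + 1) ^ (-α)) := by
            gcongr
            · exact hb j
            · linarith [(hl j).1]
        _ = _ := by field_simp
    rw [e, ← sq_abs, ← mul_pow, ← mul_pow]
    gcongr
  have b2 : ∀ ρ : ℝ, 0 < ρ → ∀ j : ℕ, (ρ * b j / (lam j + ρ)) ^ 2
      ≤ d ^ 2 * ((j : ℝ) + 1) ^ (-(2 * η)) := by
    intro ρ hρ j
    have hlj := h.pos j
    have hj : (0 : ℝ) < (j : ℝ) + 1 := by positivity
    have e : ((j : ℝ) + 1) ^ (-(2 * η)) = (((j : ℝ) + 1) ^ (-η)) ^ 2 := by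
      rw [← Real.rpow_natCast, ← Real.rpow_mul hj.le]
      congr 1; push_cast; ring
    rw [e, ← sq_abs, ← mul_pow]
    gcongr
    rw [abs_div, abs_mul, abs_of_pos hρ, abs_of_pos (by linarith : 0 < lam j + ρ)]
    refine le_trans ?_ (hb j)
    rw [div_le_iff₀ (by linarith)]
    nlinarith [abs_nonneg (b j)]
  -- In the first case `b1` is used up to J and `b2` beyond it; the exponent 2α - 2η exceeds -1, so
  -- the sum is of order J ^ (1 - 2η), a power of ρ with exponent (2η - 1) / α. In the second case
  -- `b1` alone is summable and the order saturates at ρ².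
  rcases hm with ⟨hαη, rfl⟩ | ⟨hαη, rfl⟩
  · obtain ⟨B, hB, hsum⟩ := exists_sum_split_le (s := 2 * α - 2 * η) (t := 2 * η)
      (by linarith) (by linarith)
    refine ⟨max ((d / c) ^ 2) (d ^ 2) * B, by positivity, fun ρ hρ hρ1 N => ?_⟩
    set J := ρ ^ (-(1 / α)) with hJ
    have hJ1 : 1 ≤ J := Real.one_le_rpow_of_pos_of_le_one_of_nonpos hρ hρ1 (by
      have : 0 < 1 / α := by positivity
      linarith)
    have hJ0 : 0 < J := by positivity
    have hJα : J ^ (-(2 * α)) = ρ ^ 2 := by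
      rw [hJ, ← Real.rpow_mul hρ.le, ← Real.rpow_natCast]; congr 1; push_cast; field_simp
    have e1 : ∀ (j : ℕ) (u : ℝ), (((j : ℝ) + 1)) ^ u = (((j : ℝ) + 1) / J) ^ u * J ^ u := by
      intro j u
      rw [Real.div_rpow (by positivity) hJ0.le]; field_simp
    calc ∑ j ∈ range N, (ρ * b j / (lam j + ρ)) ^ 2
        ≤ ∑ j ∈ range N, max ((d / c) ^ 2) (d ^ 2) * J ^ (-(2 * η)) *
            (if (j : ℝ) + 1 ≤ J then (((j : ℝ) + 1) / J) ^ (2 * α - 2 * η)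
            else (((j : ℝ) + 1) / J) ^ (-(2 * η))) := by
          refine sum_le_sum fun j _ => ?_
          split_ifs with hj
          · refine (b1 ρ hρ j).trans ?_
            rw [e1, ← hJα]
            calc (d / c) ^ 2 * J ^ (-(2 * α)) *
                  ((((j : ℝ) + 1) / J) ^ (2 * α - 2 * η) * J ^ (2 * α - 2 * η))
                = (d / c) ^ 2 * (J ^ (-(2 * α)) * J ^ (2 * α - 2 * η)) *
                  (((j : ℝ) + 1) / J) ^ (2 * α - 2 * η) := by ring
              _ ≤ _ := by
                  rw [← Real.rpow_add hJ0, show -(2 * α) + (2 * α - 2 * η) = -(2 * η) by ring]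
                  gcongr
                  exact le_max_left _ _
          · refine (b2 ρ hρ j).trans ?_
            rw [e1, mul_comm (_ ^ _) (J ^ _), ← mul_assoc]
            gcongr
            exact le_max_right _ _
      _ ≤ max ((d / c) ^ 2) (d ^ 2) * J ^ (-(2 * η)) * (B * J) := by
          rw [← mul_sum]; gcongr; exact hsum J hJ1 N
      _ = max ((d / c) ^ 2) (d ^ 2) * B * (J ^ (-(2 * η)) * J ^ (1 : ℝ)) := by
          rw [Real.rpow_one]; ring
      _ = _ := by
          rw [← Real.rpow_add hJ0, hJ, ← Real.rpow_mul hρ.le]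
          congr 2
          field_simp
          ring
  · have hs : Summable fun j : ℕ => ((j : ℝ) + 1) ^ (2 * α - 2 * η) := by
      have := (summable_nat_add_iff 1).2
        (Real.summable_nat_rpow.2 (by linarith : 2 * α - 2 * η < -1))
      exact_mod_cast this
    refine ⟨(d / c) ^ 2 * (∑' j : ℕ, ((j : ℝ) + 1) ^ (2 * α - 2 * η)) + 1, ?_,
      fun ρ hρ hρ1 N => ?_⟩
    · have : 0 ≤ ∑' j : ℕ, ((j : ℝ) + 1) ^ (2 * α - 2 * η) := tsum_nonneg fun j => by positivity
      positivity
    · calc ∑ j ∈ range N, (ρ * b j / (lam j + ρ)) ^ 2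
          ≤ ∑ j ∈ range N, (d / c) ^ 2 * ρ ^ 2 * ((j : ℝ) + 1) ^ (2 * α - 2 * η) :=
            sum_le_sum fun j _ => b1 ρ hρ j
        _ ≤ (d / c) ^ 2 * ρ ^ 2 * ∑' j : ℕ, ((j : ℝ) + 1) ^ (2 * α - 2 * η) := by
            rw [← mul_sum]; gcongr
            exact hs.sum_le_tsum _ fun j _ => by positivity
        _ ≤ _ := by
            rw [show ρ ^ (2 : ℝ) = ρ ^ 2 from Real.rpow_natCast ρ 2]
            nlinarith [sq_nonneg ρ]

section RidgeInverse

variable {H : Type*} [NormedAddCommGroup H] [InnerProductSpace ℝ H] [CompleteSpace H]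

/-! ### The inverse of `A + ρ I` -/

/-- `(A + ρ I)⁻¹`. -/
def ridgeInv (A : H →L[ℝ] H) (ρ : ℝ) : H →L[ℝ] H := Ring.inverse (A + ρ • (1 : H →L[ℝ] H))

theorem isUnit_add_smul_one {A : H →L[ℝ] H} (hA : A.IsPositive) {ρ : ℝ} (hρ : 0 < ρ) :
    IsUnit (A + ρ • (1 : H →L[ℝ] H)) := by
  refine ContinuousLinearMap.isUnit_of_forall_le_norm_inner_map _ (c := ⟨ρ, hρ.le⟩) hρ fun x => ?_
  have h := hA.inner_nonneg_left x
  have e : inner ℝ ((A + ρ • (1 : H →L[ℝ] H)) x) x = inner ℝ (A x) x + ρ * ‖x‖ ^ 2 := by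
    simp [inner_add_left, inner_smul_left]
  rw [e, Real.norm_of_nonneg (by positivity)]
  change ‖x‖ ^ 2 * ρ ≤ _
  nlinarith

section Basic

variable {A : H →L[ℝ] H} (hA : A.IsPositive) {ρ : ℝ} (hρ : 0 < ρ)
include hA hρ

theorem ridgeInv_apply_add (x : H) : ridgeInv A ρ (A x + ρ • x) = x := by
  have h := Ring.inverse_mul_cancel _ (isUnit_add_smul_one hA hρ)
  simpa [ridgeInv] using congrArg (fun B : H →L[ℝ] H => B x) h

theorem apply_ridgeInv (x : H) : A (ridgeInv A ρ x) = x - ρ • ridgeInv A ρ x := by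
  have h := Ring.mul_inverse_cancel _ (isUnit_add_smul_one hA hρ)
  rw [eq_sub_iff_add_eq]
  simpa [ridgeInv] using congrArg (fun B : H →L[ℝ] H => B x) h

theorem ridgeInv_apply (x : H) : ridgeInv A ρ (A x) = x - ρ • ridgeInv A ρ x := by
  have h := ridgeInv_apply_add hA hρ x
  rw [map_add, map_smul] at h
  rw [eq_sub_iff_add_eq, h]

theorem ridgeInv_symm (x y : H) : inner ℝ (ridgeInv A ρ x) y = inner ℝ x (ridgeInv A ρ y) := by
  have hx := apply_ridgeInv hA hρ x
  have hy := apply_ridgeInv hA hρ y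
  have h := hA.inner_left_eq_inner_right (ridgeInv A ρ x) (ridgeInv A ρ y)
  rw [hx, hy, inner_sub_left, inner_sub_right, real_inner_smul_left, real_inner_smul_right] at h
  linarith

theorem norm_ridgeInv_apply_le (x : H) : ‖ridgeInv A ρ x‖ ≤ ρ⁻¹ * ‖x‖ := by
  have h := hA.inner_nonneg_left (ridgeInv A ρ x)
  rw [apply_ridgeInv hA hρ x, inner_sub_left, real_inner_smul_left, real_inner_self_eq_norm_sq] at h
  have h2 := real_inner_le_norm x (ridgeInv A ρ x)
  rw [inv_mul_eq_div, le_div_iff₀ hρ]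
  rcases (norm_nonneg (ridgeInv A ρ x)).eq_or_lt with h0 | h0
  · rw [← h0]; simp
  · nlinarith

theorem norm_smul_ridgeInv_apply_le (x : H) : ‖ρ • ridgeInv A ρ x‖ ≤ ‖x‖ := by
  rw [norm_smul, Real.norm_of_nonneg hρ.le]
  calc ρ * ‖ridgeInv A ρ x‖ ≤ ρ * (ρ⁻¹ * ‖x‖) := by
        gcongr; exact norm_ridgeInv_apply_le hA hρ x
    _ = ‖x‖ := by field_simp

theorem ridgeInv_eigenvector {e : H} {l : ℝ} (hl : 0 ≤ l) (he : A e = l • e) :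
    ridgeInv A ρ e = (l + ρ)⁻¹ • e := by
  have h := ridgeInv_apply_add hA hρ e
  rw [he, ← add_smul, map_smul] at h
  have : l + ρ ≠ 0 := by positivity
  rw [← h, smul_smul, inv_mul_cancel₀ this, one_smul, h]

theorem inner_eigenvector_ridgeInv {e : H} {l : ℝ} (hl : 0 ≤ l) (he : A e = l • e) (x : H) :
    inner ℝ e (ridgeInv A ρ x) = (l + ρ)⁻¹ * inner ℝ e x := by
  rw [← ridgeInv_symm hA hρ, ridgeInv_eigenvector hA hρ hl he, real_inner_smul_left]

theorem ridgeInv_commute {B : H →L[ℝ] H} (hB : ∀ x, A (B x) = B (A x)) (x : H) :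
    ridgeInv A ρ (B x) = B (ridgeInv A ρ x) := by
  have h : A (B (ridgeInv A ρ x)) + ρ • B (ridgeInv A ρ x) = B x := by
    rw [hB, ← map_smul, ← map_add, apply_ridgeInv hA hρ, sub_add_cancel]
  rw [← h, ridgeInv_apply_add hA hρ]

/-- The resolvent identity, with the inverse for `A` inside. In the application `A` is the true
covariance, whose inverse is explicit on its eigenvectors, while the outer inverse is random and is
controlled only through its norm. -/
theorem ridgeInv_sub_ridgeInv {B : H →L[ℝ] H} (hB : B.IsPositive) (x : H) :
    ridgeInv B ρ x - ridgeInv A ρ x = ridgeInv B ρ ((A - B) (ridgeInv A ρ x)) := by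
  have h : (A - B) (ridgeInv A ρ x)
      = x - (B (ridgeInv A ρ x) + ρ • ridgeInv A ρ x) := by
    rw [sub_apply, apply_ridgeInv hA hρ]; abel
  rw [h, map_sub, ridgeInv_apply_add hB hρ]

/-- The perturbation bound for Tikhonov regularised solutions. -/
theorem norm_ridgeInv_sub_ridgeInv_le {B : H →L[ℝ] H} (hB : B.IsPositive) {c u w : H}
    (hc : ridgeInv A ρ c = u + w) :
    ‖ridgeInv B ρ c - ridgeInv A ρ c‖
      ≤ (1 + ρ⁻¹ * ‖A - B‖) * (‖ridgeInv A ρ ((A - B) u)‖ + ‖w‖) := by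
  have hbd : ∀ v : H, ‖ridgeInv B ρ ((A - B) v)‖ ≤ ρ⁻¹ * ‖A - B‖ * ‖v‖ := fun v => by
    refine (norm_ridgeInv_apply_le hB hρ _).trans ?_
    rw [mul_assoc]
    gcongr
    exact (A - B).le_opNorm v
  -- A second use of the resolvent identity replaces the random inverse by that of `A` on (A - B) u,
  -- at the price of a factor ρ⁻¹ ‖A - B‖. For w, which is small itself, the crude bound `hbd` is
  -- enough.
  have h1 : ridgeInv B ρ ((A - B) u) = ridgeInv A ρ ((A - B) u)
      + ridgeInv B ρ ((A - B) (ridgeInv A ρ ((A - B) u))) := by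
    rw [← ridgeInv_sub_ridgeInv hA hρ hB]; abel
  rw [ridgeInv_sub_ridgeInv hA hρ hB, hc, map_add, map_add, h1]
  calc _ ≤ ‖ridgeInv A ρ ((A - B) u)‖ + ρ⁻¹ * ‖A - B‖ * ‖ridgeInv A ρ ((A - B) u)‖
        + ρ⁻¹ * ‖A - B‖ * ‖w‖ := by
        refine (norm_add_le _ _).trans (add_le_add ((norm_add_le _ _).trans ?_) (hbd w))
        gcongr
        exact hbd _
    _ ≤ _ := by nlinarith [norm_nonneg w]

end Basic

end RidgeInverse

/-! ### Finite orthonormal expansions -/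

section Truncated

variable {H : Type*} [NormedAddCommGroup H] [InnerProductSpace ℝ H] [CompleteSpace H]

/-- `∑_{j < r} c_j f_j ⊗ f_j`. -/
def diagOp (r : ℕ) (c : ℕ → ℝ) (f : ℕ → H) : H →L[ℝ] H :=
  ∑ j ∈ range r, c j • rankOne ℝ (f j) (f j)

theorem diagOp_apply (r : ℕ) (c : ℕ → ℝ) (f : ℕ → H) (x : H) :
    diagOp r c f x = ∑ j ∈ range r, (c j * inner ℝ (f j) x) • f j := by
  simp [diagOp, smul_smul]

theorem projFirst_eq_diagOp (r : ℕ) (f : ℕ → H) : projFirst r f = diagOp r 1 f := by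
  simp [projFirst, diagOp]

theorem projFirst_apply (r : ℕ) (f : ℕ → H) (x : H) :
    projFirst r f x = ∑ j ∈ range r, inner ℝ (f j) x • f j := by
  simp [projFirst_eq_diagOp, diagOp_apply]

theorem diagOp_symm (r : ℕ) (c : ℕ → ℝ) (f : ℕ → H) (x y : H) :
    inner ℝ (diagOp r c f x) y = inner ℝ x (diagOp r c f y) := by
  simp only [diagOp_apply, sum_inner, inner_sum, real_inner_smul_left, real_inner_smul_right]
  refine sum_congr rfl fun j _ => ?_
  rw [real_inner_comm x (f j)]; ring

theorem star_diagOp (r : ℕ) (c : ℕ → ℝ) (f : ℕ → H) : star (diagOp r c f) = diagOp r c f := by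
  rw [ContinuousLinearMap.star_eq_adjoint]
  exact ((ContinuousLinearMap.eq_adjoint_iff _ _).2 (diagOp_symm r c f)).symm

theorem inner_diagOp {f : ℕ → H} (hf : Orthonormal ℝ f) (r : ℕ) (c : ℕ → ℝ) {k : ℕ} (hk : k < r)
    (x : H) : inner ℝ (f k) (diagOp r c f x) = c k * inner ℝ (f k) x := by
  rw [diagOp_apply, hf.inner_right_sum _ (mem_range.2 hk)]

theorem diagOp_mul {f : ℕ → H} (hf : Orthonormal ℝ f) (r : ℕ) (c d : ℕ → ℝ) :
    diagOp r c f * diagOp r d f = diagOp r (c * d) f := by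
  ext x
  rw [mul_apply_eq_comp, diagOp_apply, diagOp_apply r (c * d)]
  refine sum_congr rfl fun j hj => ?_
  rw [inner_diagOp hf r d (mem_range.1 hj), Pi.mul_apply, mul_assoc]

theorem norm_diagOp_le {f : ℕ → H} (hf : Orthonormal ℝ f) (r : ℕ) (c : ℕ → ℝ) :
    ‖diagOp r c f‖ ≤ ∑ j ∈ range r, |c j| := by
  refine (norm_sum_le _ _).trans (sum_le_sum fun j _ => ?_)
  simp [norm_smul, hf.norm_eq_one]

/-- Thanks to the convention 0⁻¹ = 0 this also covers vanishing coefficients. -/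
theorem isMoorePenrose_diagOp {f : ℕ → H} (hf : Orthonormal ℝ f) (r : ℕ) (c : ℕ → ℝ) :
    IsMoorePenrose (diagOp r c f) (diagOp r c⁻¹ f) := by
  constructor
  · rw [diagOp_mul hf, diagOp_mul hf]
    congr 1; ext j
    by_cases h : c j = 0 <;> simp [h]
  · rw [diagOp_mul hf, diagOp_mul hf]
    congr 1; ext j
    by_cases h : c j = 0 <;> simp [h]
  · rw [diagOp_mul hf, star_diagOp]
  · rw [diagOp_mul hf, star_diagOp]

/-- Because Q commutes with A, the operator is Q (A + ρ): it vanishes on the kernel of Q and is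
inverted on the range of Q by (A + ρ)⁻¹. Both products are the self-adjoint projection Q, from which
the four equations follow. -/
theorem isMoorePenrose_compl {A Q : H →L[ℝ] H} (hA : A.IsPositive) {ρ : ℝ} (hρ : 0 < ρ)
    (hQ : Q * Q = Q) (hQs : star Q = Q) (hAQ : A * Q = Q * A) :
    IsMoorePenrose (Q * A * Q + ρ • Q) (Q * ridgeInv A ρ) := by
  have hc : ridgeInv A ρ * Q = Q * ridgeInv A ρ := by
    ext x
    exact ridgeInv_commute hA hρ (fun y => congrArg (fun B : H →L[ℝ] H => B y) hAQ) x
  have h1 : Q * A * Q + ρ • Q = Q * (A + ρ • (1 : H →L[ℝ] H)) := by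
    rw [mul_assoc, hAQ, ← mul_assoc, hQ, mul_add]; simp
  have h2 : (A + ρ • (1 : H →L[ℝ] H)) * Q = Q * (A + ρ • (1 : H →L[ℝ] H)) := by
    rw [add_mul, hAQ, mul_add]; simp
  have h3 : (A + ρ • (1 : H →L[ℝ] H)) * ridgeInv A ρ = 1 :=
    Ring.mul_inverse_cancel _ (isUnit_add_smul_one hA hρ)
  have h4 : ridgeInv A ρ * (A + ρ • (1 : H →L[ℝ] H)) = 1 :=
    Ring.inverse_mul_cancel _ (isUnit_add_smul_one hA hρ)
  have e1 : (Q * A * Q + ρ • Q) * (Q * ridgeInv A ρ) = Q := by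
    rw [h1, ← hc, mul_assoc, ← mul_assoc _ _ Q, h3, one_mul, hQ]
  have e2 : (Q * ridgeInv A ρ) * (Q * A * Q + ρ • Q) = Q := by
    rw [h1, ← h2, mul_assoc, ← mul_assoc _ _ Q, h4, one_mul, hQ]
  constructor
  · rw [e1, h1, ← mul_assoc, hQ]
  · rw [e2, ← mul_assoc, hQ]
  · rw [e1, hQs]
  · rw [e2, hQs]

/-- Regularisation of the complement of the first `r` eigendirections, written through the Tikhonov
solution. -/
theorem pinv_add_pinv {A : H →L[ℝ] H} (hA : A.IsPositive) {ρ : ℝ} (hρ : 0 < ρ) {r : ℕ}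
    {f : ℕ → H} (hf : Orthonormal ℝ f) {l : ℕ → ℝ} (hl : ∀ j < r, 0 < l j)
    (he : ∀ j < r, A (f j) = l j • f j) (c : H) :
    pinv (projFirst r f * A * projFirst r f) (projFirst r f c)
      + pinv ((1 - projFirst r f) * A * (1 - projFirst r f) + ρ • (1 - projFirst r f))
        ((1 - projFirst r f) c)
      = ridgeInv A ρ c + ρ • diagOp r l⁻¹ f (ridgeInv A ρ c) := by
  set p := projFirst r f with hp
  have hpd : p = diagOp r 1 f := projFirst_eq_diagOp r f
  have hAp : A * p = diagOp r l f := by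
    ext x
    rw [mul_apply_eq_comp, hpd, diagOp_apply, diagOp_apply, map_sum]
    refine sum_congr rfl fun j hj => ?_
    rw [map_smul, he j (mem_range.1 hj), smul_smul]; simp [mul_comm]
  have hpA : p * A = diagOp r l f := by
    ext x
    rw [mul_apply_eq_comp, hpd, diagOp_apply, diagOp_apply]
    refine sum_congr rfl fun j hj => ?_
    rw [← hA.inner_left_eq_inner_right, he j (mem_range.1 hj), real_inner_smul_left]; simp
  have hpp : p * p = p := by rw [hpd, diagOp_mul hf]; simp
  have hps : star p = p := by rw [hpd, star_diagOp]
  have hQ : (1 - p) * (1 - p) = 1 - p := by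
    rw [mul_sub, sub_mul, sub_mul, hpp]; simp
  have hQs : star (1 - p) = 1 - p := by rw [star_sub, hps, star_one]
  have hAQ : A * (1 - p) = (1 - p) * A := by rw [mul_sub, sub_mul, hAp, hpA, mul_one, one_mul]
  have h1 : p * A * p = diagOp r l f := by
    rw [mul_assoc, hAp, hpd, diagOp_mul hf, one_mul]
  rw [h1, (isMoorePenrose_diagOp hf r l).pinv_eq, (isMoorePenrose_compl hA hρ hQ hQs hAQ).pinv_eq]
  have h2 : diagOp r l⁻¹ f (p c) = diagOp r l⁻¹ f c := by
    rw [← mul_apply_eq_comp, hpd, diagOp_mul hf, mul_one]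
  have h3 : ((1 - p) * ridgeInv A ρ) ((1 - p) c) = ridgeInv A ρ c - p (ridgeInv A ρ c) := by
    rw [mul_apply_eq_comp,
      ridgeInv_commute hA hρ (fun y => congrArg (fun B : H →L[ℝ] H => B y) hAQ),
      ← mul_apply_eq_comp, hQ]
    simp
  rw [h2, h3, hpd, diagOp_apply, diagOp_apply, diagOp_apply, add_sub, add_comm, add_sub_assoc,
    ← sum_sub_distrib, smul_sum]
  congr 1
  -- In each direction what remains is the scalar identity l⁻¹ - (l + ρ)⁻¹ = ρ l⁻¹ (l + ρ)⁻¹.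
  refine sum_congr rfl fun j hj => ?_
  have hlj := hl j (mem_range.1 hj)
  rw [inner_eigenvector_ridgeInv hA hρ hlj.le (he j (mem_range.1 hj)), ← sub_smul, smul_smul]
  congr 1
  have : l j + ρ ≠ 0 := by positivity
  simp only [Pi.inv_apply, Pi.one_apply]
  field_simp
  ring

end Truncated

section Empirical

variable {H : Type*} [NormedAddCommGroup H] [InnerProductSpace ℝ H] [CompleteSpace H]

/-! ### Empirical operators -/

theorem empCov_apply (n : ℕ) (x : ℕ → H) (u : H) :
    empCov n x u = (n : ℝ)⁻¹ • ∑ i ∈ range n, inner ℝ (x i) u • x i := by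
  simp [empCov]

theorem inner_empCov (n : ℕ) (x : ℕ → H) (u v : H) :
    inner ℝ (empCov n x u) v = (n : ℝ)⁻¹ * ∑ i ∈ range n, inner ℝ (x i) u * inner ℝ (x i) v := by
  simp [empCov_apply, sum_inner, real_inner_smul_left]

theorem empCov_isPositive (n : ℕ) (x : ℕ → H) : (empCov n x).IsPositive := by
  rw [ContinuousLinearMap.isPositive_iff]
  refine ⟨fun u v => ?_, fun u => ?_⟩
  · change inner ℝ (empCov n x u) v = inner ℝ u (empCov n x v)
    rw [real_inner_comm (empCov n x v) u, inner_empCov, inner_empCov]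
    congr 1
    refine sum_congr rfl fun i _ => mul_comm _ _
  · rw [inner_empCov]
    exact mul_nonneg (by positivity) (sum_nonneg fun i _ => mul_self_nonneg _)

theorem empCov_comp (n : ℕ) (x : ℕ → H) {p : H →L[ℝ] H} (hp : star p = p) :
    empCov n (fun i => p (x i)) = p * empCov n x * p := by
  ext u
  have hs : ∀ v w, inner ℝ (p v) w = inner ℝ v (p w) := fun v w => by
    conv_rhs => rw [← hp, ContinuousLinearMap.star_eq_adjoint]
    rw [ContinuousLinearMap.adjoint_inner_right]
  simp only [mul_apply_eq_comp, empCov_apply, map_smul, map_sum, hs]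

theorem sampleMean_map {E F : Type*} [NormedAddCommGroup E] [NormedSpace ℝ E]
    [NormedAddCommGroup F] [NormedSpace ℝ F] (n : ℕ) (x : ℕ → E) (p : E →L[ℝ] F) :
    sampleMean n (fun i => p (x i)) = p (sampleMean n x) := by
  simp [sampleMean]

theorem empCrossCov_map (n : ℕ) (y : ℕ → ℝ) (x : ℕ → H) (p : H →L[ℝ] H) :
    empCrossCov n y (fun i => p (x i)) = p (empCrossCov n y x) := by
  simp only [empCrossCov, sampleMean_map, map_smul, map_sum, map_sub]

/-- `n⁻¹ ∑ e_i (x_i - x̄)`. -/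
def noiseTerm (n : ℕ) (e : ℕ → ℝ) (x : ℕ → H) : H :=
  (n : ℝ)⁻¹ • ∑ i ∈ range n, e i • (x i - sampleMean n x)

theorem sum_sub_sampleMean {n : ℕ} (hn : n ≠ 0) (x : ℕ → H) :
    ∑ i ∈ range n, (x i - sampleMean n x) = 0 := by
  have : (n : ℝ) ≠ 0 := by exact_mod_cast hn
  rw [sum_sub_distrib, sum_const, card_range, sampleMean, ← Nat.cast_smul_eq_nsmul ℝ, smul_smul,
    mul_inv_cancel₀ this, one_smul, sub_self]

/-- Centring the covariates removes the intercept and the mean response, both constant in i. The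
signal is left with the centred empirical covariance, written as the uncentred one minus a rank-one
term. -/
theorem empCrossCov_response {n : ℕ} (hn : n ≠ 0) (a : ℝ) (β : H) (x : ℕ → H) (e : ℕ → ℝ) :
    empCrossCov n (fun i => a + inner ℝ (x i) β + e i) x
      = empCov n x β - inner ℝ (sampleMean n x) β • sampleMean n x + noiseTerm n e x := by
  have h0 := sum_sub_sampleMean hn x
  have hn' : (n : ℝ) ≠ 0 := by exact_mod_cast hn
  set m := sampleMean n x with hm
  have h1 : ∑ i ∈ range n, inner ℝ (x i) β • m = (n : ℝ) • (inner ℝ m β • m) := by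
    rw [← sum_smul, ← sum_inner, smul_smul]
    congr 1
    rw [hm, sampleMean, real_inner_smul_left]
    field_simp
  have h2 : ∀ c : ℝ, ∑ i ∈ range n, (a + inner ℝ (x i) β + e i - c) • (x i - m)
      = ∑ i ∈ range n, inner ℝ (x i) β • x i - ∑ i ∈ range n, inner ℝ (x i) β • m
        + ∑ i ∈ range n, e i • (x i - m) := by
    intro c
    have : ∀ i, (a + inner ℝ (x i) β + e i - c) • (x i - m)
        = (a - c) • (x i - m) + (inner ℝ (x i) β • x i - inner ℝ (x i) β • m)
          + e i • (x i - m) := fun i => by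
      rw [← smul_sub, ← add_smul, ← add_smul]; congr 1; ring
    simp only [this, sum_add_distrib, sum_sub_distrib, ← smul_sum]
    rw [← sum_sub_distrib, h0, smul_zero, zero_add]
  rw [empCrossCov, h2, h1, empCov_apply, noiseTerm, smul_add, smul_sub, smul_smul,
    inv_mul_cancel₀ hn', one_smul]

theorem inner_sampleMean_sq_le (n : ℕ) (x : ℕ → H) (u : H) :
    inner ℝ (sampleMean n x) u ^ 2 ≤ (n : ℝ)⁻¹ * ∑ i ∈ range n, inner ℝ (x i) u ^ 2 := by
  rcases Nat.eq_zero_or_pos n with rfl | hn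
  · simp [sampleMean]
  have hn' : (0 : ℝ) < n := by exact_mod_cast hn
  rw [sampleMean, real_inner_smul_left, sum_inner, mul_pow]
  have h := sq_sum_le_card_mul_sum_sq (s := range n) (f := fun i => inner ℝ (x i) u)
  rw [card_range] at h
  calc _ ≤ (n : ℝ)⁻¹ ^ 2 * (n * ∑ i ∈ range n, inner ℝ (x i) u ^ 2) := by gcongr
    _ = _ := by field_simp

theorem sum_inner_sub_sampleMean_sq_le (n : ℕ) (x : ℕ → H) (u : H) :
    ∑ i ∈ range n, inner ℝ (x i - sampleMean n x) u ^ 2 ≤ ∑ i ∈ range n, inner ℝ (x i) u ^ 2 := by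
  rcases Nat.eq_zero_or_pos n with rfl | hn
  · simp
  have h : ∑ i ∈ range n, inner ℝ (x i) u = n * inner ℝ (sampleMean n x) u := by
    have : (n : ℝ) ≠ 0 := by exact_mod_cast hn.ne'
    rw [sampleMean, real_inner_smul_left, sum_inner]; field_simp
  have e : ∑ i ∈ range n, inner ℝ (x i - sampleMean n x) u ^ 2
      = ∑ i ∈ range n, inner ℝ (x i) u ^ 2 - n * inner ℝ (sampleMean n x) u ^ 2 := by
    simp only [inner_sub_left, sub_sq, sum_add_distrib, sum_sub_distrib, sum_const, card_range,
      nsmul_eq_mul, ← sum_mul, ← mul_sum, h]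
    ring
  rw [e]
  have : 0 ≤ (n : ℝ) * inner ℝ (sampleMean n x) u ^ 2 := by positivity
  linarith

/-- Cauchy-Schwarz over the sample. When u is a unit empirical eigenvector, the second factor is its
eigenvalue, which compensates half of the inverse eigenvalue appearing later. -/
theorem inner_noiseTerm_sq_le (n : ℕ) (e : ℕ → ℝ) (x : ℕ → H) (u : H) :
    inner ℝ (noiseTerm n e x) u ^ 2
      ≤ ((n : ℝ)⁻¹ * ∑ i ∈ range n, e i ^ 2) * ((n : ℝ)⁻¹ * ∑ i ∈ range n, inner ℝ (x i) u ^ 2) := by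
  rw [noiseTerm, real_inner_smul_left, sum_inner, mul_pow]
  simp only [real_inner_smul_left]
  have h := sum_mul_sq_le_sq_mul_sq (range n) e fun i => inner ℝ (x i - sampleMean n x) u
  calc _ ≤ (n : ℝ)⁻¹ ^ 2 * ((∑ i ∈ range n, e i ^ 2) * ∑ i ∈ range n, inner ℝ (x i) u ^ 2) := by
        gcongr
        refine h.trans ?_
        gcongr ?_ * ?_
        exact sum_inner_sub_sampleMean_sq_le n x u
    _ = _ := by ring

end Empirical

/-! ### Empirical eigensystems -/

section EigenSystem

variable {H : Type*} [NormedAddCommGroup H] [InnerProductSpace ℝ H] [CompleteSpace H]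
  {n : ℕ} {x : ℕ → H} {l : ℕ → ℝ} {f : ℕ → H}

theorem IsEmpEigenSystem.empCov_eq (h : IsEmpEigenSystem n x l f) : empCov n x = diagOp n l f :=
  h.spectral

theorem IsEmpEigenSystem.apply (h : IsEmpEigenSystem n x l f) (j : ℕ) :
    empCov n x (f j) = l j • f j := by
  rw [h.empCov_eq, diagOp_apply]
  rcases lt_or_ge j n with hj | hj
  · rw [sum_eq_single_of_mem j (mem_range.2 hj)]
    · simp [h.orthonormal.norm_eq_one]
    · intro i _ hij
      simp [h.orthonormal.inner_eq_zero hij]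
  · rw [h.eq_zero j hj, zero_smul]
    refine sum_eq_zero fun i hi => ?_
    have : i ≠ j := by have := mem_range.1 hi; omega
    simp [h.orthonormal.inner_eq_zero this]

theorem IsEmpEigenSystem.eq_sum (h : IsEmpEigenSystem n x l f) (j : ℕ) :
    l j = (n : ℝ)⁻¹ * ∑ i ∈ range n, inner ℝ (x i) (f j) ^ 2 := by
  have h1 := inner_empCov n x (f j) (f j)
  rw [h.apply, real_inner_smul_left, real_inner_self_eq_norm_sq, h.orthonormal.norm_eq_one] at h1
  simpa [sq] using h1

theorem IsEmpEigenSystem.nonneg (h : IsEmpEigenSystem n x l f) (j : ℕ) : 0 ≤ l j := by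
  rw [h.eq_sum]
  positivity

theorem hybrid_eq (h : IsEmpEigenSystem n x l f) {r : ℕ} (hl : ∀ j < r, 0 < l j) {ρ : ℝ}
    (hρ : 0 < ρ) (y : ℕ → ℝ) :
    hybrid n r ρ f x y = tikhonov n ρ x y + ρ • diagOp r l⁻¹ f (tikhonov n ρ x y) := by
  have hs : star (projFirst r f) = projFirst r f := by rw [projFirst_eq_diagOp, star_diagOp]
  have hs' : star (1 - projFirst r f) = 1 - projFirst r f := by rw [star_sub, hs, star_one]
  have := pinv_add_pinv (empCov_isPositive n x) hρ h.orthonormal hl (fun j _ => h.apply j)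
    (empCrossCov n y x)
  rw [hybrid]
  simp only [empCov_comp n x hs, empCov_comp n x hs', empCrossCov_map]
  exact this

/-- The lower half of the min-max principle for the empirical eigenvalues. -/
theorem IsEmpEigenSystem.le_eigenvalue (h : IsEmpEigenSystem n x l f) {k : ℕ} {φ : ℕ → H}
    (hφ : Orthonormal ℝ φ) {κ : ℝ}
    (hκ : ∀ c : Fin (k + 1) → ℝ, ∑ i, c i ^ 2 = 1 →
      κ ≤ inner ℝ (empCov n x (∑ i, c i • φ i)) (∑ i, c i • φ i)) :
    κ ≤ l k := by
  -- There are k linear conditions on k + 1 coefficients, so some nonzero combination of φ₀, …, φ_k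
  -- is orthogonal to f₀, …, f_{k-1}. On such unit vectors the empirical form is at most l_k.
  obtain ⟨c, hc0, hc⟩ : ∃ c : Fin (k + 1) → ℝ, c ≠ 0 ∧
      ∀ j < k, inner ℝ (f j) (∑ i, c i • φ i) = 0 := by
    let M : (Fin (k + 1) → ℝ) →ₗ[ℝ] (Fin k → ℝ) :=
      LinearMap.pi fun j => (innerₛₗ ℝ (f j)) ∘ₗ (Fintype.linearCombination ℝ fun i : Fin (k + 1) => φ i)
    have hker : LinearMap.ker M ≠ ⊥ := LinearMap.ker_ne_bot_of_finrank_lt (by simp)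
    obtain ⟨c, hc, hc0⟩ := Submodule.exists_mem_ne_zero_of_ne_bot hker
    refine ⟨c, hc0, fun j hj => ?_⟩
    have := congrFun (LinearMap.mem_ker.1 hc) ⟨j, hj⟩
    simpa [M, Fintype.linearCombination_apply] using this
  have hpos : 0 < ∑ i, c i ^ 2 := by
    obtain ⟨i, hi⟩ := Function.ne_iff.1 hc0
    exact sum_pos' (fun i _ => sq_nonneg _) ⟨i, mem_univ _, by have : c i ≠ 0 := hi; positivity⟩
  set s := √(∑ i, c i ^ 2) with hs
  have hs0 : 0 < s := Real.sqrt_pos.2 hpos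
  have hs2 : s ^ 2 = ∑ i, c i ^ 2 := Real.sq_sqrt hpos.le
  set d : Fin (k + 1) → ℝ := fun i => s⁻¹ * c i with hd
  have hd1 : ∑ i, d i ^ 2 = 1 := by
    simp only [hd, mul_pow, ← mul_sum, ← hs2]; field_simp
  set v := ∑ i, d i • φ i with hv
  have hvc : v = s⁻¹ • ∑ i, c i • φ i := by simp [hv, hd, smul_sum, smul_smul]
  have hfv : ∀ j < k, inner ℝ (f j) v = 0 := fun j hj => by
    rw [hvc, real_inner_smul_right, hc j hj, mul_zero]
  have hvn : ‖v‖ ^ 2 = 1 := by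
    rw [← real_inner_self_eq_norm_sq, hv]
    have hφ' : Orthonormal ℝ fun i : Fin (k + 1) => φ i := hφ.comp _ Fin.val_injective
    rw [hφ'.inner_sum]
    simpa [sq] using hd1
  refine (hκ d hd1).trans ?_
  rw [← hv, h.empCov_eq, diagOp_apply, sum_inner]
  have hb := h.orthonormal.sum_inner_products_le (x := v) (s := range n)
  rw [hvn] at hb
  calc ∑ j ∈ range n, inner ℝ ((l j * inner ℝ (f j) v) • f j) v
      = ∑ j ∈ range n, l j * inner ℝ (f j) v ^ 2 := by
        refine sum_congr rfl fun j _ => ?_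
        rw [real_inner_smul_left]; ring
    _ ≤ ∑ j ∈ range n, l k * inner ℝ (f j) v ^ 2 := by
        refine sum_le_sum fun j _ => ?_
        rcases lt_or_ge j k with hj | hj
        · simp [hfv j hj]
        · exact mul_le_mul_of_nonneg_right (h.antitone hj) (sq_nonneg _)
    _ ≤ l k * 1 := by
        rw [← mul_sum]
        refine mul_le_mul_of_nonneg_left ?_ (h.nonneg k)
        simpa using hb
    _ = l k := mul_one _

/-- Since ⟨f_j, x̄⟩² ≤ l_j, one of the two factors l_j⁻¹ in the squared coefficient cancels, and
only √ℓ is left. -/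
theorem IsEmpEigenSystem.norm_diagOp_inv_sampleMean_le (h : IsEmpEigenSystem n x l f) {r : ℕ}
    {ℓ : ℝ} (hℓ : ∀ j < r, (l j)⁻¹ ≤ ℓ) :
    ‖diagOp r l⁻¹ f (sampleMean n x)‖ ≤ r * √ℓ := by
  rw [diagOp_apply]
  refine (norm_sum_le _ _).trans ?_
  calc _ ≤ ∑ j ∈ range r, √ℓ := sum_le_sum fun j hj => ?_
    _ = r * √ℓ := by simp
  have hj' := mem_range.1 hj
  rw [norm_smul, h.orthonormal.norm_eq_one, mul_one, Real.norm_eq_abs]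
  refine Real.abs_le_sqrt ?_
  have h1 := inner_sampleMean_sq_le n x (f j)
  rw [← h.eq_sum, real_inner_comm] at h1
  rw [mul_pow, Pi.inv_apply]
  have h2 : 0 ≤ (l j)⁻¹ := inv_nonneg.2 (h.nonneg j)
  calc (l j)⁻¹ ^ 2 * inner ℝ (f j) (sampleMean n x) ^ 2 ≤ (l j)⁻¹ ^ 2 * l j := by gcongr
    _ ≤ (l j)⁻¹ := by
        rcases eq_or_ne (l j) 0 with h0 | h0
        · simp [h0]
        · field_simp; rfl
    _ ≤ ℓ := hℓ j hj'

theorem IsEmpEigenSystem.norm_diagOp_inv_noiseTerm_le (h : IsEmpEigenSystem n x l f) {r : ℕ}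
    {ℓ : ℝ} (hℓ : ∀ j < r, (l j)⁻¹ ≤ ℓ) (e : ℕ → ℝ) :
    ‖diagOp r l⁻¹ f (noiseTerm n e x)‖ ≤ r * √(ℓ * ((n : ℝ)⁻¹ * ∑ i ∈ range n, e i ^ 2)) := by
  rw [diagOp_apply]
  refine (norm_sum_le _ _).trans ?_
  set E := (n : ℝ)⁻¹ * ∑ i ∈ range n, e i ^ 2 with hE
  have hE0 : 0 ≤ E := by positivity
  calc _ ≤ ∑ j ∈ range r, √(ℓ * E) := sum_le_sum fun j hj => ?_
    _ = _ := by simp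
  have hj' := mem_range.1 hj
  rw [norm_smul, h.orthonormal.norm_eq_one, mul_one, Real.norm_eq_abs]
  refine Real.abs_le_sqrt ?_
  have h1 := inner_noiseTerm_sq_le n e x (f j)
  rw [← h.eq_sum, real_inner_comm, ← hE] at h1
  rw [mul_pow, Pi.inv_apply]
  have h2 : 0 ≤ (l j)⁻¹ := inv_nonneg.2 (h.nonneg j)
  calc (l j)⁻¹ ^ 2 * inner ℝ (f j) (noiseTerm n e x) ^ 2 ≤ (l j)⁻¹ ^ 2 * (E * l j) := by gcongr
    _ ≤ (l j)⁻¹ * E := by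
        rcases eq_or_ne (l j) 0 with h0 | h0
        · simp [h0]
        · apply le_of_eq; field_simp
    _ ≤ ℓ * E := by gcongr; exact hℓ j hj'

/-- Here the inverse eigenvalues cancel completely against those produced by `empCov`, so no lower
bound on them is needed. -/
theorem IsEmpEigenSystem.norm_diagOp_inv_empCov_le (h : IsEmpEigenSystem n x l f) (r : ℕ) (u : H) :
    ‖diagOp r l⁻¹ f (empCov n x u)‖ ≤ r * ‖u‖ := by
  rw [diagOp_apply]
  refine (norm_sum_le _ _).trans ?_
  calc _ ≤ ∑ j ∈ range r, ‖u‖ := sum_le_sum fun j hj => ?_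
    _ = r * ‖u‖ := by simp
  rw [norm_smul, h.orthonormal.norm_eq_one, mul_one, Real.norm_eq_abs,
    ← (empCov_isPositive n x).inner_left_eq_inner_right, h.apply, real_inner_smul_left,
    Pi.inv_apply]
  have h3 := abs_real_inner_le_norm (f j) u
  rw [h.orthonormal.norm_eq_one, one_mul] at h3
  rcases eq_or_ne (l j) 0 with h0 | h0
  · simp [h0]
  · rwa [inv_mul_cancel_left₀ h0]

end EigenSystem

/-! ### Perturbation of the leading eigenprojection -/

section Perturbation

variable {H : Type*} [NormedAddCommGroup H] [InnerProductSpace ℝ H] [CompleteSpace H]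

theorem norm_sub_projFirst_sq {f : ℕ → H} (hf : Orthonormal ℝ f) (r : ℕ) (u : H) :
    ‖u - projFirst r f u‖ ^ 2 = ‖u‖ ^ 2 - ∑ j ∈ range r, inner ℝ (f j) u ^ 2 := by
  have h1 : inner ℝ u (projFirst r f u) = ∑ j ∈ range r, inner ℝ (f j) u ^ 2 := by
    rw [projFirst_apply, inner_sum]
    refine sum_congr rfl fun j _ => ?_
    rw [real_inner_smul_right, real_inner_comm]; ring
  have h2 : ‖projFirst r f u‖ ^ 2 = ∑ j ∈ range r, inner ℝ (f j) u ^ 2 := by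
    rw [projFirst_apply, ← real_inner_self_eq_norm_sq, hf.inner_sum]
    simp [sq]
  rw [norm_sub_sq_real, h1, h2]; ring

/-- The part of an approximate leading eigenvector outside the leading eigenspace is small. -/
theorem norm_sub_projFirst_le {A : H →L[ℝ] H} {φ : HilbertBasis ℕ ℝ H}
    {lam : ℕ → ℝ} (hlam : StrictAnti lam) (heig : ∀ j, A (φ j) = lam j • φ j)
    (hA : A.IsPositive) {B : H →L[ℝ] H} {e : H} {μ : ℝ} (he : B e = μ • e) (hen : ‖e‖ = 1)
    {r : ℕ} {γ : ℝ} (hγ : 0 < γ) (hμ : lam r + γ ≤ μ) :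
    ‖e - projFirst r φ e‖ ≤ γ⁻¹ * ‖A - B‖ := by
  -- As B e = μ e, this vector equals (A - μ) e. Its coordinates beyond r are those of e multiplied
  -- by factors of modulus at least γ, and comparing norms gives the bound.
  set v := (A - B) e with hv
  have hvk : ∀ k, inner ℝ (φ k) v = (lam k - μ) * inner ℝ (φ k) e := fun k => by
    rw [hv, sub_apply, inner_sub_right, he, ← hA.inner_left_eq_inner_right,
      heig, real_inner_smul_left, real_inner_smul_right]; ring
  have hP := fun u : H => φ.hasSum_inner_mul_inner u u
  have hv2 : HasSum (fun k => inner ℝ (φ k) v ^ 2) (‖v‖ ^ 2) := by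
    have := hP v
    rw [real_inner_self_eq_norm_sq] at this
    refine this.congr_fun ?_ |> fun h => h
    intro k; rw [real_inner_comm v (φ k)]; ring
  have he2 : HasSum (fun k => inner ℝ (φ k) e ^ 2) (‖e‖ ^ 2) := by
    have := hP e
    rw [real_inner_self_eq_norm_sq] at this
    refine this.congr_fun ?_ |> fun h => h
    intro k; rw [real_inner_comm e (φ k)]; ring
  have key : γ ^ 2 * ‖e - projFirst r φ e‖ ^ 2 ≤ ‖v‖ ^ 2 := by
    rw [norm_sub_projFirst_sq φ.orthonormal]
    have t1 := (hasSum_nat_add_iff' r).2 he2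
    have t2 := (hasSum_nat_add_iff' r).2 hv2
    have t3 := hasSum_le (fun k => ?_) (t1.mul_left (γ ^ 2)) t2
    · refine t3.trans ?_
      have : 0 ≤ ∑ i ∈ range r, inner ℝ (φ i) v ^ 2 := sum_nonneg fun i _ => sq_nonneg _
      linarith
    · rw [hvk, mul_pow]
      refine mul_le_mul_of_nonneg_right ?_ (sq_nonneg _)
      have : lam (k + r) ≤ lam r := hlam.antitone (by omega)
      nlinarith
  have hvn : ‖v‖ ≤ ‖A - B‖ := by
    have := (A - B).le_opNorm e
    rwa [hen, mul_one] at this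
  rw [inv_mul_eq_div, le_div_iff₀ hγ, mul_comm]
  refine le_trans ?_ hvn
  refine abs_le_of_sq_le_sq' (by rwa [mul_pow]) (norm_nonneg _) |>.2

/-- Let p, q be the true and empirical leading projections, G, Ĝ the partial inverses and B the
empirical covariance. From A G = p and Ĝ B = q follows Ĝ - G = Ĝ (A - B) G + Ĝ (1 - p) - (1 - q) G.
The first term is visibly of order ‖A - B‖, and the others measure the angle between the leading
eigenspaces. Of the empirical spectrum only a lower bound for the leading eigenvalues is used. -/
theorem exists_norm_diagOp_inv_sub_le {A : H →L[ℝ] H} (hA : A.IsPositive) (φ : HilbertBasis ℕ ℝ H)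
    {lam : ℕ → ℝ} (hlam : StrictAnti lam) (hpos : ∀ j, 0 < lam j)
    (heig : ∀ j, A (φ j) = lam j • φ j) (r : ℕ) :
    ∃ δ C : ℝ, 0 < δ ∧ 0 < C ∧ ∀ (n : ℕ) (x : ℕ → H) (l : ℕ → ℝ) (f : ℕ → H),
      IsEmpEigenSystem n x l f → ‖A - empCov n x‖ ≤ δ →
      ‖diagOp r l⁻¹ f - diagOp r lam⁻¹ φ‖ ≤ C * ‖A - empCov n x‖ := by
  rcases r with _ | k
  · refine ⟨1, 1, one_pos, one_pos, fun n x l f _ _ => ?_⟩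
    simp [diagOp]
  -- Half the spectral gap: an operator error of at most γ leaves the leading empirical eigenvalues
  -- at least γ above lam (k + 1).
  set γ := (lam k - lam (k + 1)) / 2 with hγ
  have hγ0 : 0 < γ := by have := hlam (Nat.lt_succ_self k); simp only [hγ]; linarith
  set κ := (lam (k + 1) + γ)⁻¹ with hκ
  have hκ0 : 0 < κ := by have := hpos (k + 1); positivity
  have hr0 : (0 : ℝ) ≤ (k : ℝ) + 1 := by positivity
  set S := ((k : ℝ) + 1) * κ with hS
  refine ⟨γ, S * S + S * γ⁻¹ + S * (((k : ℝ) + 1) * γ⁻¹), hγ0, by positivity,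
    fun n x l f h hδ => ?_⟩
  set B := empCov n x with hB
  set D := ‖A - B‖ with hD
  have hD0 : 0 ≤ D := norm_nonneg _
  -- lower bounds for the eigenvalues
  have hlk : lam (k + 1) + γ ≤ l k := by
    refine h.le_eigenvalue φ.orthonormal fun c hc => ?_
    set v := ∑ i : Fin (k + 1), c i • φ i with hv
    have hφ' : Orthonormal ℝ fun i : Fin (k + 1) => φ i :=
      φ.orthonormal.comp _ Fin.val_injective
    have hvn : ‖v‖ ^ 2 = 1 := by
      rw [← real_inner_self_eq_norm_sq, hv, hφ'.inner_sum]
      simpa [sq] using hc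
    have hvn1 : ‖v‖ = 1 := by
      have := norm_nonneg v
      nlinarith
    have hAv : lam k ≤ inner ℝ (A v) v := by
      have : A v = ∑ i : Fin (k + 1), (c i * lam i) • φ i := by
        simp [hv, map_sum, heig, smul_smul]
      rw [this, hv, hφ'.inner_sum]
      calc lam k = ∑ i, lam k * c i ^ 2 := by rw [← mul_sum, hc, mul_one]
        _ ≤ _ := sum_le_sum fun i _ => by
            have : lam k ≤ lam i := hlam.antitone (by omega)
            simp only [conj_trivial]
            nlinarith [sq_nonneg (c i)]
    have hdiff : inner ℝ ((A - B) v) v ≤ D := by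
      refine (real_inner_le_norm _ _).trans ?_
      rw [hvn1, mul_one]
      have := (A - B).le_opNorm v
      rwa [hvn1, mul_one] at this
    rw [sub_apply, inner_sub_left] at hdiff
    have : γ = (lam k - lam (k + 1)) / 2 := hγ
    linarith
  have hlj : ∀ j < k + 1, lam (k + 1) + γ ≤ l j := fun j hj =>
    hlk.trans (h.antitone (by omega))
  have hlj0 : ∀ j < k + 1, 0 < l j := fun j hj => by
    have := hlj j hj; have := hpos (k + 1); linarith
  have hlinv : ∀ j < k + 1, |(l⁻¹ : ℕ → ℝ) j| ≤ κ := fun j hj => by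
    rw [Pi.inv_apply, abs_of_pos (inv_pos.2 (hlj0 j hj))]
    have := hpos (k + 1)
    exact inv_anti₀ (by positivity) (hlj j hj)
  have hlaminv : ∀ j < k + 1, |(lam⁻¹ : ℕ → ℝ) j| ≤ κ := fun j hj => by
    rw [Pi.inv_apply, abs_of_pos (inv_pos.2 (hpos j))]
    have := hpos (k + 1)
    refine inv_anti₀ (by positivity) ?_
    have : lam k ≤ lam j := hlam.antitone (by omega)
    have : γ = (lam k - lam (k + 1)) / 2 := hγ
    linarith
  -- the two off-diagonal blocks
  set p := projFirst (k + 1) φ with hp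
  set q := projFirst (k + 1) f with hq
  have off1 : ∀ j < k + 1, ‖f j - p (f j)‖ ≤ γ⁻¹ * D := fun j hj =>
    norm_sub_projFirst_le hlam heig hA (h.apply j) (h.orthonormal.norm_eq_one j) hγ0 (hlj j hj)
  have off2 : ∀ i < k + 1, ‖φ i - q (φ i)‖ ≤ ((k : ℝ) + 1) * (γ⁻¹ * D) := by
    intro i hi
    -- Both sides equal k + 1 - ∑ ⟨f_j, φ_i⟩². The bound for the empirical eigenvectors thus carries
    -- over to the true ones, with no information on the rest of the empirical spectrum.
    have e : ∑ i ∈ range (k + 1), ‖φ i - q (φ i)‖ ^ 2 = ∑ j ∈ range (k + 1), ‖f j - p (f j)‖ ^ 2 := by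
      simp only [hp, hq, norm_sub_projFirst_sq h.orthonormal, norm_sub_projFirst_sq φ.orthonormal,
        φ.orthonormal.norm_eq_one, h.orthonormal.norm_eq_one, sum_sub_distrib]
      congr 1
      rw [sum_comm]
      refine sum_congr rfl fun j _ => sum_congr rfl fun i _ => ?_
      rw [real_inner_comm]
    have h1 : ‖φ i - q (φ i)‖ ^ 2 ≤ ((k : ℝ) + 1) * (γ⁻¹ * D) ^ 2 := by
      calc _ ≤ ∑ i ∈ range (k + 1), ‖φ i - q (φ i)‖ ^ 2 :=
            single_le_sum (f := fun i => ‖φ i - q (φ i)‖ ^ 2) (fun _ _ => sq_nonneg _)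
              (mem_range.2 hi)
        _ ≤ ∑ j ∈ range (k + 1), (γ⁻¹ * D) ^ 2 := by
            rw [e]
            refine sum_le_sum fun j hj => ?_
            have := off1 j (mem_range.1 hj)
            gcongr
        _ = _ := by simp
    refine abs_le_of_sq_le_sq' (h1.trans ?_) (by positivity) |>.2
    rw [mul_pow ((k : ℝ) + 1)]
    refine mul_le_mul_of_nonneg_right ?_ (sq_nonneg _)
    nlinarith [(Nat.cast_nonneg k : (0 : ℝ) ≤ k)]
  set G := diagOp (k + 1) lam⁻¹ φ with hG
  set Gh := diagOp (k + 1) l⁻¹ f with hGh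
  have hGn : ‖G‖ ≤ S := by
    refine (norm_diagOp_le φ.orthonormal _ _).trans ?_
    calc _ ≤ ∑ j ∈ range (k + 1), κ := sum_le_sum fun j hj => hlaminv j (mem_range.1 hj)
      _ = S := by simp [hS]
  have hGhn : ‖Gh‖ ≤ S := by
    refine (norm_diagOp_le h.orthonormal _ _).trans ?_
    calc _ ≤ ∑ j ∈ range (k + 1), κ := sum_le_sum fun j hj => hlinv j (mem_range.1 hj)
      _ = S := by simp [hS]
  have hAG : A * G = p := by
    ext u
    rw [mul_apply_eq_comp, hG, hp, diagOp_apply, projFirst_apply, map_sum]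
    refine sum_congr rfl fun j _ => ?_
    have := (hpos j).ne'
    rw [map_smul, heig, smul_smul, Pi.inv_apply]
    congr 1; field_simp
  have hGB : Gh * B = q := by
    ext u
    rw [mul_apply_eq_comp, hGh, hq, diagOp_apply, projFirst_apply]
    refine sum_congr rfl fun j hj => ?_
    have := (hlj0 j (mem_range.1 hj)).ne'
    rw [← (empCov_isPositive n x).inner_left_eq_inner_right, h.apply, real_inner_smul_left,
      Pi.inv_apply]
    congr 1; field_simp
  have hid : Gh - G = Gh * (A - B) * G + (Gh * (1 - p) - (1 - q) * G) := by
    have e1 : Gh * (A - B) * G = Gh * p - q * G := by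
      rw [mul_sub, sub_mul, mul_assoc, hAG, hGB]
    rw [e1, mul_sub, sub_mul, mul_one, one_mul]; abel
  have n1 : ‖Gh * (A - B) * G‖ ≤ S * S * D := by
    calc _ ≤ ‖Gh‖ * D * ‖G‖ := (norm_mul_le _ _).trans (by gcongr; exact norm_mul_le _ _)
      _ ≤ S * D * S := by gcongr
      _ = _ := by ring
  have n2 : ‖Gh * (1 - p)‖ ≤ S * γ⁻¹ * D := by
    refine ContinuousLinearMap.opNorm_le_bound _ (by positivity) fun u => ?_
    rw [mul_apply_eq_comp, hGh, diagOp_apply]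
    refine (norm_sum_le _ _).trans ?_
    calc _ ≤ ∑ j ∈ range (k + 1), κ * (γ⁻¹ * D) * ‖u‖ := sum_le_sum fun j hj => ?_
      _ = _ := by simp [hS]; ring
    have hj' := mem_range.1 hj
    rw [norm_smul, h.orthonormal.norm_eq_one, mul_one, norm_mul, Real.norm_eq_abs,
      Real.norm_eq_abs, mul_assoc]
    refine mul_le_mul (hlinv j hj') ?_ (abs_nonneg _) hκ0.le
    have e1 : inner ℝ (f j) ((1 - p) u) = inner ℝ (f j - p (f j)) u := by
      rw [sub_apply, one_apply_eq_self, inner_sub_right, inner_sub_left, hp, projFirst_eq_diagOp,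
        diagOp_symm]
    rw [e1]
    exact (abs_real_inner_le_norm _ _).trans (by gcongr; exact off1 j hj')
  have n3 : ‖(1 - q) * G‖ ≤ S * (((k : ℝ) + 1) * γ⁻¹) * D := by
    refine ContinuousLinearMap.opNorm_le_bound _ (by positivity) fun u => ?_
    rw [mul_apply_eq_comp, hG, diagOp_apply, map_sum]
    refine (norm_sum_le _ _).trans ?_
    calc _ ≤ ∑ j ∈ range (k + 1), κ * ‖u‖ * (((k : ℝ) + 1) * (γ⁻¹ * D)) :=
          sum_le_sum fun j hj => ?_
      _ = _ := by simp [hS]; ring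
    have hj' := mem_range.1 hj
    rw [map_smul, norm_smul, norm_mul, Real.norm_eq_abs, Real.norm_eq_abs]
    have h3 := abs_real_inner_le_norm (φ j) u
    rw [φ.orthonormal.norm_eq_one, one_mul] at h3
    refine mul_le_mul (mul_le_mul (hlaminv j hj') h3 (abs_nonneg _) hκ0.le) ?_ (norm_nonneg _)
      (by positivity)
    simpa using off2 j hj'
  rw [hid]
  calc _ ≤ S * S * D + (S * γ⁻¹ * D + S * (((k : ℝ) + 1) * γ⁻¹) * D) :=
        (norm_add_le _ _).trans (add_le_add n1 ((norm_sub_le _ _).trans (add_le_add n2 n3)))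
    _ = _ := by ring

end Perturbation

section Moments

variable {Ω : Type*} [MeasurableSpace Ω] {P : Measure Ω}

/-! ### Second moments of products and of series -/

/-- Cauchy-Schwarz, with the bounds given as squares so that no roots appear. -/
theorem lintegral_mul_le_of_sq_le {f g : Ω → ℝ≥0∞} (hf : AEMeasurable f P) (hg : AEMeasurable g P)
    {A B : ℝ≥0∞} (hA : ∫⁻ ω, f ω ^ 2 ∂P ≤ A ^ 2) (hB : ∫⁻ ω, g ω ^ 2 ∂P ≤ B ^ 2) :
    ∫⁻ ω, f ω * g ω ∂P ≤ A * B := by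
  have h := ENNReal.lintegral_mul_le_Lp_mul_Lq P Real.HolderConjugate.two_two hf hg
  simp only [Pi.mul_apply, ENNReal.rpow_two] at h
  refine h.trans (mul_le_mul' ?_ ?_)
  · refine (ENNReal.rpow_le_rpow hA (by norm_num)).trans (le_of_eq ?_)
    rw [← ENNReal.rpow_natCast, ← ENNReal.rpow_mul]; norm_num
  · refine (ENNReal.rpow_le_rpow hB (by norm_num)).trans (le_of_eq ?_)
    rw [← ENNReal.rpow_natCast, ← ENNReal.rpow_mul]; norm_num

/-- Minkowski's inequality in L² for a series, by expanding the square and applying Cauchy-Schwarz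
to each product. Applied to squared coordinates, it converts fourth moments of coordinates into
fourth moments of norms. -/
theorem lintegral_tsum_sq_le {ι : Type*} [Countable ι] {f : ι → Ω → ℝ≥0∞}
    (hf : ∀ i, AEMeasurable (f i) P) {a : ι → ℝ≥0∞} (ha : ∀ i, ∫⁻ ω, f i ω ^ 2 ∂P ≤ a i ^ 2) :
    ∫⁻ ω, (∑' i, f i ω) ^ 2 ∂P ≤ (∑' i, a i) ^ 2 := by
  have e : ∀ ω, (∑' i, f i ω) ^ 2 = ∑' i, ∑' j, f i ω * f j ω := fun ω => by
    rw [sq, ← ENNReal.tsum_mul_right]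
    exact tsum_congr fun i => ENNReal.tsum_mul_left.symm
  simp only [e]
  have hm : ∀ i j, AEMeasurable (fun ω => f i ω * f j ω) P := fun i j => (hf i).mul (hf j)
  rw [lintegral_tsum fun i => AEMeasurable.tsum fun j => hm i j, sq, ← ENNReal.tsum_mul_right]
  refine ENNReal.tsum_le_tsum fun i => ?_
  rw [lintegral_tsum fun j => hm i j, ← ENNReal.tsum_mul_left]
  exact ENNReal.tsum_le_tsum fun j => lintegral_mul_le_of_sq_le (hf i) (hf j) (ha i) (ha j)

theorem sq_integral_sq_le [IsProbabilityMeasure P] {Z : Ω → ℝ} (hZ : MemLp Z 4 P) :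
    (∫ ω, Z ω ^ 2 ∂P) ^ 2 ≤ ∫ ω, Z ω ^ 4 ∂P := by
  have h4 : MemLp (fun ω => Z ω ^ 2) 2 P := by
    have := hZ.norm_rpow_div 2
    simp only [ENNReal.toReal_ofNat, Real.rpow_two, Real.norm_eq_abs, sq_abs] at this
    convert! this using 1
    rw [show (4 : ℝ≥0∞) = 2 * 2 by norm_num, ENNReal.mul_div_cancel_right] <;> norm_num
  have h := variance_nonneg (fun ω => Z ω ^ 2) P
  rw [variance_eq_sub h4] at h
  have e : ∫ ω, ((fun ω => Z ω ^ 2) ^ 2) ω ∂P = ∫ ω, Z ω ^ 4 ∂P := by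
    refine integral_congr_ae (ae_of_all _ fun ω => ?_)
    simp only [Pi.pow_apply]; ring
  rw [e] at h
  linarith

/-! ### Sums of independent centred random variables -/

theorem integrable_pow_of_memLp_four {Z : Ω → ℝ} [IsFiniteMeasure P] {k : ℕ} (hZ : MemLp Z 4 P)
    (hk : k ≤ 4) : Integrable (fun ω => Z ω ^ k) P := by
  have h : MemLp Z k P := hZ.mono_exponent (by exact_mod_cast hk)
  have h1 := h.integrable_norm_pow'
  refine h1.mono' (hZ.1.pow k) (ae_of_all _ fun ω => ?_)
  rw [norm_pow]

theorem integral_add_sq_of_indepFun [IsProbabilityMeasure P] {S Z : Ω → ℝ} (hS : MemLp S 4 P)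
    (hZ : MemLp Z 4 P) (h : IndepFun S Z P) (hZ0 : ∫ ω, Z ω ∂P = 0) :
    ∫ ω, (S ω + Z ω) ^ 2 ∂P = ∫ ω, S ω ^ 2 ∂P + ∫ ω, Z ω ^ 2 ∂P := by
  have i1 := integrable_pow_of_memLp_four hS (k := 1) (by norm_num)
  have j1 := integrable_pow_of_memLp_four hZ (k := 1) (by norm_num)
  simp only [pow_one] at i1 j1
  have hm : ∫ ω, S ω * Z ω ∂P = 0 := by
    rw [h.integral_fun_mul_eq_mul_integral hS.1 hZ.1, hZ0, mul_zero]
  have im : Integrable (fun ω => S ω * Z ω) P := h.integrable_mul i1 j1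
  have i2 := integrable_pow_of_memLp_four hS (k := 2) (by norm_num)
  have j2 := integrable_pow_of_memLp_four hZ (k := 2) (by norm_num)
  have e : (fun ω => (S ω + Z ω) ^ 2) = fun ω => S ω ^ 2 + (2 * (S ω * Z ω) + Z ω ^ 2) := by
    ext ω; ring
  rw [e, integral_add i2 ((im.const_mul 2).fun_add j2), integral_add (im.const_mul 2) j2,
    integral_const_mul, hm]
  ring

theorem integral_add_pow_four_of_indepFun [IsProbabilityMeasure P] {S Z : Ω → ℝ}
    (hS : MemLp S 4 P) (hZ : MemLp Z 4 P) (h : IndepFun S Z P) (hS0 : ∫ ω, S ω ∂P = 0)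
    (hZ0 : ∫ ω, Z ω ∂P = 0) :
    ∫ ω, (S ω + Z ω) ^ 4 ∂P = ∫ ω, S ω ^ 4 ∂P
      + 6 * ((∫ ω, S ω ^ 2 ∂P) * ∫ ω, Z ω ^ 2 ∂P) + ∫ ω, Z ω ^ 4 ∂P := by
  have i : ∀ k ≤ 4, Integrable (fun ω => S ω ^ k) P := fun k hk =>
    integrable_pow_of_memLp_four hS hk
  have j : ∀ k ≤ 4, Integrable (fun ω => Z ω ^ k) P := fun k hk =>
    integrable_pow_of_memLp_four hZ hk
  have hind : ∀ k l : ℕ, IndepFun (fun ω => S ω ^ k) (fun ω => Z ω ^ l) P := fun k l =>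
    h.comp (φ := fun x : ℝ => x ^ k) (ψ := fun x : ℝ => x ^ l) (by fun_prop) (by fun_prop)
  have m : ∀ k ≤ 4, ∀ l ≤ 4, Integrable (fun ω => S ω ^ k * Z ω ^ l) P := fun k hk l hl =>
    (hind k l).integrable_mul (i k hk) (j l hl)
  have v : ∀ k ≤ 4, ∀ l ≤ 4, ∫ ω, S ω ^ k * Z ω ^ l ∂P
      = (∫ ω, S ω ^ k ∂P) * ∫ ω, Z ω ^ l ∂P := fun k hk l hl =>
    (hind k l).integral_fun_mul_eq_mul_integral (i k hk).1 (j l hl).1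
  have e : (fun ω => (S ω + Z ω) ^ 4) = fun ω => S ω ^ 4 + (4 * (S ω ^ 3 * Z ω ^ 1)
      + (6 * (S ω ^ 2 * Z ω ^ 2) + (4 * (S ω ^ 1 * Z ω ^ 3) + Z ω ^ 4))) := by
    ext ω; ring
  have k1 := (m 3 (by norm_num) 1 (by norm_num)).const_mul 4
  have k2 := (m 2 (by norm_num) 2 (by norm_num)).const_mul 6
  have k3 := (m 1 (by norm_num) 3 (by norm_num)).const_mul 4
  have k4 := j 4 (by norm_num)
  rw [e, integral_add (i 4 le_rfl) (k1.fun_add (k2.fun_add (k3.fun_add k4))),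
    integral_add k1 (k2.fun_add (k3.fun_add k4)), integral_add k2 (k3.fun_add k4), integral_add k3 k4,
    integral_const_mul, integral_const_mul, integral_const_mul, v 3 (by norm_num) 1 (by norm_num),
    v 2 (by norm_num) 2 (by norm_num), v 1 (by norm_num) 3 (by norm_num)]
  simp only [pow_one, hS0, hZ0]
  ring

/-- The cross terms with an odd power vanish, so one more summand adds 6 E S² E Z² + E Z⁴ ≤ (6 n +
1) M, less than the increment of 3 n² M. The second moment is therefore carried along in the
induction. -/
theorem integral_sum_pow_four_le [IsProbabilityMeasure P] {Z : ℕ → Ω → ℝ}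
    (hm : ∀ i, Measurable (Z i)) (hZ : ∀ i, MemLp (Z i) 4 P) (hind : iIndepFun Z P)
    (h0 : ∀ i, ∫ ω, Z i ω ∂P = 0) {M : ℝ} (hM : ∀ i, ∫ ω, Z i ω ^ 4 ∂P ≤ M) (n : ℕ) :
    ∫ ω, (∑ i ∈ range n, Z i ω) ^ 4 ∂P ≤ 3 * (n : ℝ) ^ 2 * M := by
  have hM0 : 0 ≤ M := (integral_nonneg fun ω => by positivity).trans (hM 0)
  have h2 : ∀ i, ∫ ω, Z i ω ^ 2 ∂P ≤ √M := fun i =>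
    Real.le_sqrt_of_sq_le ((sq_integral_sq_le (hZ i)).trans (hM i))
  have hS : ∀ n, MemLp (fun ω => ∑ i ∈ range n, Z i ω) 4 P := fun n =>
    memLp_finsetSum _ fun i _ => hZ i
  have hS0 : ∀ n, ∫ ω, ∑ i ∈ range n, Z i ω ∂P = 0 := fun n => by
    rw [integral_finsetSum _ fun i _ => (hZ i).integrable (by norm_num)]
    simp [h0]
  have hi : ∀ n, IndepFun (fun ω => ∑ i ∈ range n, Z i ω) (Z n) P := fun n => by
    have := hind.indepFun_sum_range_succ hm n
    convert! this using 1
    ext ω; simp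
  suffices H : ∫ ω, (∑ i ∈ range n, Z i ω) ^ 2 ∂P ≤ n * √M ∧
      ∫ ω, (∑ i ∈ range n, Z i ω) ^ 4 ∂P ≤ 3 * (n : ℝ) ^ 2 * M from H.2
  induction n with
  | zero => simp
  | succ n ih =>
    simp only [sum_range_succ]
    rw [integral_add_sq_of_indepFun (hS n) (hZ n) (hi n) (h0 n),
      integral_add_pow_four_of_indepFun (hS n) (hZ n) (hi n) (hS0 n) (h0 n)]
    push_cast
    refine ⟨by linarith [ih.1, h2 n], ?_⟩
    have h3 : (∫ ω, (∑ i ∈ range n, Z i ω) ^ 2 ∂P) * ∫ ω, Z n ω ^ 2 ∂P ≤ n * M := by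
      calc _ ≤ (n * √M) * √M := by
            refine mul_le_mul ih.1 (h2 n) (integral_nonneg fun ω => sq_nonneg _) (by positivity)
        _ = n * M := by rw [mul_assoc, Real.mul_self_sqrt hM0]
    nlinarith [ih.2, hM n]

/-! ### Even moments of centred Gaussian variables -/

/-- The moment of order `2 p` of the standard normal distribution. -/
def gaussMoment (p : ℕ) : ℝ := ∫ x, x ^ (2 * p) ∂(gaussianReal 0 1)

theorem gaussMoment_nonneg (p : ℕ) : 0 ≤ gaussMoment p :=
  integral_nonneg fun x => by rw [pow_mul]; positivity

/-- Z is distributed as √v times a standard normal variable, where v is its variance; the degenerate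
case v = 0 is included. -/
theorem _root_.ProbabilityTheory.HasGaussianLaw.integral_pow_even [IsProbabilityMeasure P] {Z : Ω → ℝ}
    (hZ : HasGaussianLaw Z P) (h0 : ∫ ω, Z ω ∂P = 0) (p : ℕ) :
    ∫ ω, Z ω ^ (2 * p) ∂P = gaussMoment p * (∫ ω, Z ω ^ 2 ∂P) ^ p := by
  have hv : Var[Z; P] = ∫ ω, Z ω ^ 2 ∂P := variance_of_integral_eq_zero hZ.aemeasurable h0
  set v := ∫ ω, Z ω ^ 2 ∂P with hvd
  have hv0 : 0 ≤ v := integral_nonneg fun ω => sq_nonneg _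
  have hmap : P.map Z = (gaussianReal 0 1).map (√v * ·) := by
    rw [hZ.map_eq_gaussianReal, h0, hv, gaussianReal_map_const_mul, mul_zero, mul_one]
    congr 1
    ext
    simp [Real.sq_sqrt hv0, hv0]
  have e : ∫ ω, Z ω ^ (2 * p) ∂P = ∫ x, x ^ (2 * p) ∂(P.map Z) := by
    rw [integral_map hZ.aemeasurable (by fun_prop)]
  rw [e, hmap, integral_map (by fun_prop) (by fun_prop)]
  simp only [mul_pow, integral_const_mul]
  rw [pow_mul, Real.sq_sqrt hv0, gaussMoment, mul_comm]

end Moments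

/-! ### Norms through an orthonormal basis -/

section Parseval

variable {H : Type*} [NormedAddCommGroup H] [InnerProductSpace ℝ H] [CompleteSpace H]

theorem tsum_enorm_inner_sq (φ : HilbertBasis ℕ ℝ H) (v : H) :
    ∑' j, ‖inner ℝ (φ j) v‖ₑ ^ 2 = ‖v‖ₑ ^ 2 := by
  have h := φ.hasSum_inner_mul_inner v v
  rw [real_inner_self_eq_norm_sq] at h
  have h' : HasSum (fun j => ‖inner ℝ (φ j) v‖ ^ 2) (‖v‖ ^ 2) := by
    convert! h using 2 with j
    rw [real_inner_comm v (φ j), Real.norm_eq_abs, sq_abs, sq]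
  have e : ∀ r : ℝ, 0 ≤ r → ENNReal.ofReal (r ^ 2) = ENNReal.ofReal r ^ 2 := fun r hr =>
    ENNReal.ofReal_pow hr 2
  rw [← ofReal_norm, ← e _ (norm_nonneg _), ← h'.tsum_eq,
    ENNReal.ofReal_tsum_of_nonneg (fun j => by positivity) h'.summable]
  refine tsum_congr fun j => ?_
  rw [e _ (norm_nonneg _), ofReal_norm]

/-- The operator norm is dominated by the Hilbert-Schmidt norm, which may be infinite. Row k of the
matrix has square sum ‖B* φ_k‖², and Cauchy-Schwarz is applied row by row. -/
theorem enorm_opNorm_sq_le (φ : HilbertBasis ℕ ℝ H) (B : H →L[ℝ] H) :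
    ‖B‖ₑ ^ 2 ≤ ∑' q : ℕ × ℕ, ‖inner ℝ (φ q.2) (B (φ q.1))‖ₑ ^ 2 := by
  rw [ENNReal.tsum_prod', ENNReal.tsum_comm]
  set S := ∑' (k : ℕ) (j : ℕ), ‖inner ℝ (φ k) (B (φ j))‖ₑ ^ 2 with hS
  have h1 : ∀ k, ∑' j, ‖inner ℝ (φ k) (B (φ j))‖ₑ ^ 2
      = ‖ContinuousLinearMap.adjoint B (φ k)‖ₑ ^ 2 := fun k => by
    rw [← tsum_enorm_inner_sq φ]
    refine tsum_congr fun j => ?_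
    rw [ContinuousLinearMap.adjoint_inner_right, real_inner_comm]
  have h2 : ∀ v : H, ‖B v‖ₑ ^ 2 ≤ S * ‖v‖ₑ ^ 2 := fun v => by
    rw [← tsum_enorm_inner_sq φ, hS, ← ENNReal.tsum_mul_right]
    refine ENNReal.tsum_le_tsum fun k => ?_
    rw [h1, ← ContinuousLinearMap.adjoint_inner_left, ← mul_pow]
    gcongr
    rw [← ofReal_norm, ← ofReal_norm, ← ofReal_norm,
      ← ENNReal.ofReal_mul (norm_nonneg _)]
    exact ENNReal.ofReal_le_ofReal (norm_inner_le_norm _ _)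
  rcases eq_or_ne S ⊤ with hT | hT
  · rw [hT]; exact le_top
  have h3 : ∀ v : H, ‖B v‖ ≤ √S.toReal * ‖v‖ := fun v => by
    refine abs_le_of_sq_le_sq' ?_ (by positivity) |>.2
    rw [mul_pow, Real.sq_sqrt ENNReal.toReal_nonneg]
    have := ENNReal.toReal_mono (ENNReal.mul_ne_top hT (by simp)) (h2 v)
    simpa using this
  have h4 := B.opNorm_le_bound (by positivity) h3
  have h5 : ‖B‖ ^ 2 ≤ S.toReal := by
    rw [← Real.sq_sqrt (ENNReal.toReal_nonneg (a := S))]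
    gcongr
  rw [← ofReal_norm, ← ENNReal.ofReal_pow (norm_nonneg _)]
  exact ENNReal.ofReal_le_of_le_toReal h5

variable {Ω : Type*} [MeasurableSpace Ω] {P : Measure Ω}

/-- Fourth moments of the norm from fourth moments of the coordinates. -/
theorem lintegral_enorm_pow_four_le [MeasurableSpace H] [BorelSpace H] [SecondCountableTopology H]
    (φ : HilbertBasis ℕ ℝ H) {V : Ω → H}
    (hV : AEMeasurable V P) {a : ℕ → ℝ≥0∞}
    (ha : ∀ j, ∫⁻ ω, ‖inner ℝ (φ j) (V ω)‖ₑ ^ 4 ∂P ≤ a j ^ 2) :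
    ∫⁻ ω, ‖V ω‖ₑ ^ 4 ∂P ≤ (∑' j, a j) ^ 2 := by
  have e : ∀ ω, ‖V ω‖ₑ ^ 4 = (∑' j, ‖inner ℝ (φ j) (V ω)‖ₑ ^ 2) ^ 2 := fun ω => by
    rw [tsum_enorm_inner_sq, ← pow_mul]
  simp only [e]
  refine lintegral_tsum_sq_le (fun j => ?_) fun j => ?_
  · have : AEMeasurable (fun ω => inner ℝ (φ j) (V ω)) P := hV.const_inner
    exact this.enorm.pow_const 2
  · simpa only [← pow_mul] using ha j

end Parseval

/-! ### Independence of the two components of an i.i.d. sequence of pairs -/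

section Components

variable {Ω : Type*} [MeasurableSpace Ω] {P : Measure Ω} [IsProbabilityMeasure P]
  {E F : Type*} [MeasurableSpace E] [MeasurableSpace F]

/-- The joint law of the pairs is a product of products; regrouping the factors exhibits it as the
product of the law of all X_i and the law of all Y_i. -/
theorem indepFun_components_of_fintype {ι : Type*} [Fintype ι] {X : ι → Ω → E} {Y : ι → Ω → F}
    (hX : ∀ i, Measurable (X i)) (hY : ∀ i, Measurable (Y i))
    (h : iIndepFun (fun i ω => (X i ω, Y i ω)) P) (hXY : ∀ i, IndepFun (X i) (Y i) P) :
    IndepFun (fun ω i => X i ω) (fun ω i => Y i ω) P := by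
  have hXm : Measurable fun ω i => X i ω := measurable_pi_lambda _ hX
  have hYm : Measurable fun ω i => Y i ω := measurable_pi_lambda _ hY
  have hp : ∀ i, IsProbabilityMeasure (P.map (X i)) := fun i =>
    Measure.isProbabilityMeasure_map (hX i).aemeasurable
  have hq : ∀ i, IsProbabilityMeasure (P.map (Y i)) := fun i =>
    Measure.isProbabilityMeasure_map (hY i).aemeasurable
  have h1 : P.map (fun ω i => (X i ω, Y i ω))
      = Measure.pi fun i => (P.map (X i)).prod (P.map (Y i)) := by
    rw [h.map_fun_eq_pi_map fun i => ((hX i).prodMk (hY i)).aemeasurable]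
    congr 1
    ext1 i
    exact (indepFun_iff_map_prod_eq_prod_map_map (hX i).aemeasurable (hY i).aemeasurable).1 (hXY i)
  have h2 := (measurePreserving_arrowProdEquivProdArrow E F ι (fun i => P.map (X i))
    fun i => P.map (Y i)).map_eq
  have h3 : P.map (fun ω => ((fun i => X i ω), fun i => Y i ω))
      = (Measure.pi fun i => P.map (X i)).prod (Measure.pi fun i => P.map (Y i)) := by
    rw [← h2, ← h1, Measure.map_map (MeasurableEquiv.measurable _)
      (measurable_pi_lambda _ fun i => (hX i).prodMk (hY i))]
    rfl
  rw [indepFun_iff_map_prod_eq_prod_map_map hXm.aemeasurable hYm.aemeasurable, h3]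
  have h4 : P.map (fun ω i => X i ω) = Measure.pi fun i => P.map (X i) := by
    rw [← Measure.fst_map_prodMk (μ := P) (X := fun ω i => X i ω) hYm, h3, Measure.fst_prod]
  have h5 : P.map (fun ω i => Y i ω) = Measure.pi fun i => P.map (Y i) := by
    rw [← Measure.snd_map_prodMk (μ := P) (Y := fun ω i => Y i ω) hXm, h3, Measure.snd_prod]
  rw [h4, h5]

/-- Independence of two processes is decided on finite index sets. Two sets I, J are replaced by
their union, so that the finite case applies to pairs with a common index set. -/
theorem indepFun_components {X : ℕ → Ω → E} {Y : ℕ → Ω → F}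
    (hX : ∀ i, Measurable (X i)) (hY : ∀ i, Measurable (Y i))
    (h : iIndepFun (fun i ω => (X i ω, Y i ω)) P) (hXY : ∀ i, IndepFun (X i) (Y i) P) :
    IndepFun (fun ω i => X i ω) (fun ω i => Y i ω) P := by
  refine IndepFun.process_indepFun_process hX hY fun I J => ?_
  have h1 : IndepFun (fun ω (i : ↥(I ∪ J)) => X i ω) (fun ω (i : ↥(I ∪ J)) => Y i ω) P :=
    indepFun_components_of_fintype (fun i => hX i) (fun i => hY i)
      (h.precomp Subtype.val_injective) fun i => hXY i
  exact h1.comp (φ := fun x (i : I) => x ⟨i, mem_union_left _ i.2⟩)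
    (ψ := fun y (j : J) => y ⟨j, mem_union_right _ j.2⟩)
    (measurable_pi_lambda _ fun i => measurable_pi_apply _)
    (measurable_pi_lambda _ fun i => measurable_pi_apply _)

end Components

/-! ### Weighted sums of independent centred noise -/

section Noise

variable {Ω : Type*} [MeasurableSpace Ω] {P : Measure Ω} [IsProbabilityMeasure P]
  {H : Type*} [NormedAddCommGroup H] [InnerProductSpace ℝ H] [CompleteSpace H]
  [MeasurableSpace H] [BorelSpace H] [SecondCountableTopology H]
  {E : Type*} [MeasurableSpace E]

/-- The conditional variance of a noise term, integrated: the coefficients `V_i = v_i(W)` are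
functions of a random element `W` that is independent of the noise. -/
theorem lintegral_enorm_sum_noise_sq {ε : ℕ → Ω → ℝ} (hind : iIndepFun ε P)
    (hε2 : ∀ i, MemLp (ε i) 2 P) (hε0 : ∀ i, ∫ ω, ε i ω ∂P = 0)
    {s : ℝ} (hs : ∀ i, ∫ ω, ε i ω ^ 2 ∂P = s) {W : Ω → E}
    (hWε : IndepFun W (fun ω i => ε i ω) P) {v : ℕ → E → H} (hv : ∀ i, Measurable (v i)) (n : ℕ)
    (hvL : ∀ i < n, MemLp (fun ω => v i (W ω)) 2 P) :
    ∫⁻ ω, ‖∑ i ∈ range n, ε i ω • v i (W ω)‖ₑ ^ 2 ∂P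
      = ENNReal.ofReal s * ∑ i ∈ range n, ∫⁻ ω, ‖v i (W ω)‖ₑ ^ 2 ∂P := by
  have hpair : ∀ i j, IndepFun (fun ω => inner ℝ (v i (W ω)) (v j (W ω)))
      (fun ω => ε i ω * ε j ω) P := fun i j =>
    hWε.comp (φ := fun w => inner ℝ (v i w) (v j w)) (ψ := fun e : ℕ → ℝ => e i * e j)
      ((hv i).inner (hv j)) (by fun_prop)
  have hεi : ∀ i j, Integrable (fun ω => ε i ω * ε j ω) P := fun i j =>
    (hε2 i).integrable_mul (hε2 j)
  have hvi : ∀ i < n, ∀ j < n, Integrable (fun ω => inner ℝ (v i (W ω)) (v j (W ω))) P :=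
    fun i hi j hj => by
      refine ((hvL i hi).norm.integrable_mul (hvL j hj).norm).mono'
        ((hvL i hi).1.inner (hvL j hj).1) (ae_of_all _ fun ω => ?_)
      exact norm_inner_le_norm _ _
  -- Only diagonal terms survive: products of errors are independent of the coefficients, and
  -- distinct errors are independent and centred.
  have hεε : ∀ i j, ∫ ω, ε i ω * ε j ω ∂P = if i = j then s else 0 := fun i j => by
    split_ifs with h
    · subst h; simpa [sq] using hs i
    · rw [(hind.indepFun h).integral_fun_mul_eq_mul_integral (hε2 i).1 (hε2 j).1, hε0, zero_mul]
  have e : ∀ ω, ‖∑ i ∈ range n, ε i ω • v i (W ω)‖ ^ 2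
      = ∑ i ∈ range n, ∑ j ∈ range n, inner ℝ (v i (W ω)) (v j (W ω)) * (ε i ω * ε j ω) := by
    intro ω
    rw [← real_inner_self_eq_norm_sq, sum_inner]
    refine sum_congr rfl fun i _ => ?_
    rw [inner_sum]
    refine sum_congr rfl fun j _ => ?_
    rw [real_inner_smul_left, real_inner_smul_right]; ring
  have hint : ∀ i ∈ range n, ∀ j ∈ range n,
      Integrable (fun ω => inner ℝ (v i (W ω)) (v j (W ω)) * (ε i ω * ε j ω)) P :=
    fun i hi j hj => (hpair i j).integrable_mul (hvi i (mem_range.1 hi) j (mem_range.1 hj)) (hεi i j)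
  have hI : Integrable (fun ω => ‖∑ i ∈ range n, ε i ω • v i (W ω)‖ ^ 2) P := by
    simp only [e]
    exact integrable_finsetSum _ fun i hi => integrable_finsetSum _ fun j hj => hint i hi j hj
  have hval : ∫ ω, ‖∑ i ∈ range n, ε i ω • v i (W ω)‖ ^ 2 ∂P
      = s * ∑ i ∈ range n, ∫ ω, ‖v i (W ω)‖ ^ 2 ∂P := by
    simp only [e]
    rw [integral_finsetSum _ fun i hi => integrable_finsetSum _ fun j hj => hint i hi j hj, mul_sum]
    refine sum_congr rfl fun i hi => ?_
    rw [integral_finsetSum _ fun j hj => hint i hi j hj]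
    have : ∀ j ∈ range n, ∫ ω, inner ℝ (v i (W ω)) (v j (W ω)) * (ε i ω * ε j ω) ∂P
        = if i = j then s * ∫ ω, ‖v i (W ω)‖ ^ 2 ∂P else 0 := fun j hj => by
      rw [(hpair i j).integral_fun_mul_eq_mul_integral
        (hvi i (mem_range.1 hi) j (mem_range.1 hj)).1 (hεi i j).1, hεε]
      split_ifs with h
      · subst h
        simp only [real_inner_self_eq_norm_sq, mul_comm]
      · rw [mul_zero]
    rw [sum_congr rfl this, sum_ite_eq, if_pos hi]
  have conv : ∀ f : Ω → H, Integrable (fun ω => ‖f ω‖ ^ 2) P →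
      ∫⁻ ω, ‖f ω‖ₑ ^ 2 ∂P = ENNReal.ofReal (∫ ω, ‖f ω‖ ^ 2 ∂P) := fun f hf => by
    rw [ofReal_integral_eq_lintegral_ofReal hf (ae_of_all _ fun ω => by positivity)]
    refine lintegral_congr fun ω => ?_
    rw [ENNReal.ofReal_pow (norm_nonneg _), ofReal_norm]
  have hs0 : 0 ≤ s := by rw [← hs 0]; exact integral_nonneg fun ω => sq_nonneg _
  rw [conv _ hI, hval, ENNReal.ofReal_mul hs0, ENNReal.ofReal_sum_of_nonneg
    fun i _ => integral_nonneg fun ω => by positivity]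
  congr 1
  refine sum_congr rfl fun i hi => (conv _ ?_).symm
  exact (hvL i (mem_range.1 hi)).integrable_norm_pow (by norm_num)

end Noise

/-! ### Moments of Gaussian samples -/

section Real

variable {Ω : Type*} [MeasurableSpace Ω] {P : Measure Ω} [IsProbabilityMeasure P]

theorem lintegral_enorm_pow_even {Z : Ω → ℝ} {p : ℕ}
    (hZ : Integrable (fun ω => Z ω ^ (2 * p)) P) :
    ∫⁻ ω, ‖Z ω‖ₑ ^ (2 * p) ∂P = ENNReal.ofReal (∫ ω, Z ω ^ (2 * p) ∂P) := by
  rw [ofReal_integral_eq_lintegral_ofReal hZ (ae_of_all _ fun ω => by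
    simp only [Pi.zero_apply, pow_mul]; positivity)]
  refine lintegral_congr fun ω => ?_
  rw [← ofReal_norm, ← ENNReal.ofReal_pow (norm_nonneg _), pow_mul, pow_mul,
    Real.norm_eq_abs, sq_abs]

/-- A constant for the fourth and eighth moments of Gaussian variables. -/
def gaussConst : ℝ := gaussMoment 2 + gaussMoment 4 + 1

theorem one_le_gaussConst : 1 ≤ gaussConst := by
  have := gaussMoment_nonneg 2
  have := gaussMoment_nonneg 4
  unfold gaussConst; linarith

theorem _root_.ProbabilityTheory.HasGaussianLaw.integrable_pow {Z : Ω → ℝ} (hZ : HasGaussianLaw Z P) (p : ℕ) :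
    Integrable (fun ω => Z ω ^ p) P := by
  have h : MemLp Z p P := hZ.memLp (by simp)
  refine h.integrable_norm_pow'.mono' (h.1.pow p) (ae_of_all _ fun ω => ?_)
  rw [norm_pow]

theorem _root_.ProbabilityTheory.HasGaussianLaw.lintegral_pow_eight_le {Z : Ω → ℝ} (hZ : HasGaussianLaw Z P)
    (h0 : ∫ ω, Z ω ∂P = 0) {v : ℝ} (hv : ∫ ω, Z ω ^ 2 ∂P = v) :
    ∫⁻ ω, (‖Z ω‖ₑ ^ 4) ^ 2 ∂P ≤ ENNReal.ofReal (gaussConst * v ^ 2) ^ 2 := by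
  have hv0 : 0 ≤ v := by rw [← hv]; exact integral_nonneg fun ω => sq_nonneg _
  have h1 := one_le_gaussConst
  have e := lintegral_enorm_pow_even (p := 4) (hZ.integrable_pow _)
  simp only [← pow_mul]
  rw [show 4 * 2 = 2 * 4 by norm_num, e, hZ.integral_pow_even h0, hv,
    ← ENNReal.ofReal_pow (by positivity)]
  refine ENNReal.ofReal_le_ofReal ?_
  have h2 : gaussMoment 4 ≤ gaussConst := by
    have := gaussMoment_nonneg 2
    unfold gaussConst; linarith
  calc gaussMoment 4 * v ^ 4 ≤ gaussConst ^ 2 * v ^ 4 := by gcongr; nlinarith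
    _ = _ := by ring

theorem _root_.ProbabilityTheory.HasGaussianLaw.lintegral_pow_four_le {Z : Ω → ℝ} (hZ : HasGaussianLaw Z P)
    (h0 : ∫ ω, Z ω ∂P = 0) {v : ℝ} (hv : ∫ ω, Z ω ^ 2 ∂P = v) :
    ∫⁻ ω, (‖Z ω‖ₑ ^ 2) ^ 2 ∂P ≤ ENNReal.ofReal (gaussConst * v) ^ 2 := by
  have hv0 : 0 ≤ v := by rw [← hv]; exact integral_nonneg fun ω => sq_nonneg _
  have h1 := one_le_gaussConst
  have e := lintegral_enorm_pow_even (p := 2) (hZ.integrable_pow _)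
  simp only [← pow_mul]
  rw [e, hZ.integral_pow_even h0, hv, ← ENNReal.ofReal_pow (by positivity)]
  refine ENNReal.ofReal_le_ofReal ?_
  have h2 : gaussMoment 2 ≤ gaussConst := by
    have := gaussMoment_nonneg 4
    unfold gaussConst; linarith
  calc gaussMoment 2 * v ^ 2 ≤ gaussConst ^ 2 * v ^ 2 := by gcongr; nlinarith
    _ = _ := by ring

end Real

/-! ### Fourth moments of the entries of the empirical covariance -/

section Sample

variable {Ω : Type*} [MeasurableSpace Ω]
  {H : Type*} [NormedAddCommGroup H] [InnerProductSpace ℝ H] [CompleteSpace H]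
  [MeasurableSpace H] [BorelSpace H]

/-- An i.i.d. sequence of centred Gaussian random elements with covariance operator `K`. -/
structure IsGaussianSample (P : Measure Ω) (K : H →L[ℝ] H) (X : ℕ → Ω → H) : Prop where
  measurable : ∀ i, Measurable (X i)
  indep : iIndepFun X P
  ident : ∀ i, IdentDistrib (X i) (X 0) P P
  gaussian : ∀ i, HasGaussianLaw (X i) P
  centered : ∀ i, ∫ ω, X i ω ∂P = 0
  cov : ∀ i u v, ∫ ω, inner ℝ (X i ω) u * inner ℝ (X i ω) v ∂P = inner ℝ (K u) v
  pos : K.IsPositive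

variable {P : Measure Ω} [IsProbabilityMeasure P] [SecondCountableTopology H] {K : H →L[ℝ] H}
  {X : ℕ → Ω → H}

namespace IsGaussianSample

variable (h : IsGaussianSample P K X)
include h

theorem inner_gaussian (i : ℕ) (u : H) : HasGaussianLaw (fun ω => inner ℝ (X i ω) u) P := by
  have := (h.gaussian i).map_fun (innerSL ℝ u)
  refine this.congr (ae_of_all _ fun ω => ?_)
  simp [real_inner_comm]

theorem inner_centered (i : ℕ) (u : H) : ∫ ω, inner ℝ (X i ω) u ∂P = 0 := by
  have e : ∀ ω, inner ℝ (X i ω) u = inner ℝ u (X i ω) := fun ω => real_inner_comm _ _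
  simp only [e]
  rw [integral_inner (h.gaussian i).integrable, h.centered, inner_zero_right]

theorem inner_variance (i : ℕ) (u : H) : ∫ ω, inner ℝ (X i ω) u ^ 2 ∂P = inner ℝ (K u) u := by
  simp only [sq, h.cov]

theorem inner_nonneg (u : H) : 0 ≤ inner ℝ (K u) u := h.pos.inner_nonneg_left u

theorem inner_sq_le (u v : H) : inner ℝ (K u) v ^ 2 ≤ inner ℝ (K u) u * inner ℝ (K v) v := by
  have key : ∀ t : ℝ, 0 ≤ inner ℝ (K v) v * (t * t) + 2 * inner ℝ (K u) v * t + inner ℝ (K u) u := by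
    intro t
    have := h.inner_nonneg (u + t • v)
    have hs : inner ℝ (K v) u = inner ℝ (K u) v := by
      rw [h.pos.inner_left_eq_inner_right, real_inner_comm]
    simp only [map_add, map_smul, inner_add_left, inner_add_right, real_inner_smul_left,
      real_inner_smul_right, hs] at this
    linarith
  have := discrim_le_zero key
  rw [discrim] at this
  nlinarith

theorem inner_sampleMean_gaussian (n : ℕ) (u : H) :
    HasGaussianLaw (fun ω => inner ℝ (sampleMean n fun i => X i ω) u) P := by
  have hi : iIndepFun (fun (i : Fin n) => X i) P := h.indep.precomp Fin.val_injective
  have h1 := (iIndepFun.hasGaussianLaw_fun_sum (X := fun i : Fin n => X i)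
    (fun i => h.gaussian i) hi).map_fun ((n : ℝ)⁻¹ • innerSL ℝ u)
  refine h1.congr (ae_of_all _ fun ω => ?_)
  simp only [smul_apply, innerSL_apply_apply, sampleMean, real_inner_smul_left,
    smul_eq_mul]
  rw [real_inner_comm, Fin.sum_univ_eq_sum_range (fun i => X i ω)]

theorem memLp_inner (i : ℕ) (u : H) (p : ℝ≥0∞) (hp : p ≠ ⊤) :
    MemLp (fun ω => inner ℝ (X i ω) u) p P := (h.inner_gaussian i u).memLp hp

theorem inner_sampleMean_centered (n : ℕ) (u : H) :
    ∫ ω, inner ℝ (sampleMean n fun i => X i ω) u ∂P = 0 := by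
  simp only [sampleMean, real_inner_smul_left, sum_inner]
  rw [integral_const_mul, integral_finsetSum _ fun i _ =>
    (h.memLp_inner i u 1 (by simp)).integrable le_rfl]
  simp [h.inner_centered]

theorem indep_inner (u : H) : iIndepFun (fun i ω => inner ℝ (X i ω) u) P :=
  h.indep.comp (fun _ x => inner ℝ x u) fun _ => by fun_prop

theorem inner_sampleMean_variance {n : ℕ} (hn : n ≠ 0) (u : H) :
    ∫ ω, inner ℝ (sampleMean n fun i => X i ω) u ^ 2 ∂P = inner ℝ (K u) u / n := by
  have hn' : (n : ℝ) ≠ 0 := by exact_mod_cast hn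
  have hsum : ∀ m : ℕ, ∫ ω, (∑ i ∈ range m, inner ℝ (X i ω) u) ^ 2 ∂P = m * inner ℝ (K u) u := by
    intro m
    induction m with
    | zero => simp
    | succ m ih =>
      simp only [sum_range_succ]
      have hm : ∀ i, Measurable fun ω => inner ℝ (X i ω) u := fun i =>
        (h.measurable i).inner_const
      have hind : IndepFun (fun ω => ∑ i ∈ range m, inner ℝ (X i ω) u)
          (fun ω => inner ℝ (X m ω) u) P := by
        have := (h.indep_inner u).indepFun_sum_range_succ hm m
        convert! this using 1
        ext ω; simp
      rw [integral_add_sq_of_indepFun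
        (memLp_finsetSum _ fun i _ => h.memLp_inner i u 4 (by simp)) (h.memLp_inner m u 4 (by simp))
        hind (h.inner_centered m u), ih, h.inner_variance]
      push_cast; ring
  simp only [sampleMean, real_inner_smul_left, sum_inner, mul_pow]
  rw [integral_const_mul, hsum]
  field_simp

/-- Fourth moments of the entries of the empirical covariance operator. -/
theorem lintegral_inner_empCov_sub_le {n : ℕ} (hn : n ≠ 0) (u v : H) :
    ∫⁻ ω, (‖inner ℝ ((K - empCov n fun i => X i ω) u) v‖ₑ ^ 2) ^ 2 ∂P
      ≤ ENNReal.ofReal (7 * gaussConst * (inner ℝ (K u) u * inner ℝ (K v) v) / n) ^ 2 := by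
  set κ := gaussConst with hκ
  have hκ1 : 1 ≤ κ := one_le_gaussConst
  set a := inner ℝ (K u) u with ha
  set b := inner ℝ (K v) v with hb
  have ha0 : 0 ≤ a := h.inner_nonneg u
  have hb0 : 0 ≤ b := h.inner_nonneg v
  have hn' : (0 : ℝ) < n := by exact_mod_cast Nat.pos_of_ne_zero hn
  set Z : ℕ → Ω → ℝ := fun i ω => inner ℝ (X i ω) u * inner ℝ (X i ω) v - inner ℝ (K u) v with hZ
  have hZm : ∀ i, Measurable (Z i) := fun i =>
    (((h.measurable i).inner_const).mul ((h.measurable i).inner_const)).sub_const _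
  have hprod : ∀ i, ∫⁻ ω, ‖inner ℝ (X i ω) u * inner ℝ (X i ω) v‖ₑ ^ 4 ∂P
      ≤ ENNReal.ofReal (κ ^ 2 * (a * b) ^ 2) := fun i => by
    have h1 := lintegral_mul_le_of_sq_le (P := P)
      (f := fun ω => ‖inner ℝ (X i ω) u‖ₑ ^ 4) (g := fun ω => ‖inner ℝ (X i ω) v‖ₑ ^ 4)
      ((h.measurable i).inner_const.enorm.pow_const 4).aemeasurable
      ((h.measurable i).inner_const.enorm.pow_const 4).aemeasurable
      ((h.inner_gaussian i u).lintegral_pow_eight_le (h.inner_centered i u) (h.inner_variance i u))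
      ((h.inner_gaussian i v).lintegral_pow_eight_le (h.inner_centered i v) (h.inner_variance i v))
    rw [← ENNReal.ofReal_mul (by positivity)] at h1
    simp only [enorm_mul, mul_pow]
    refine h1.trans (le_of_eq ?_)
    congr 1; ring
  have hprodL : ∀ i, MemLp (fun ω => inner ℝ (X i ω) u * inner ℝ (X i ω) v) 4 P := fun i => by
    refine ⟨(((h.measurable i).inner_const).mul ((h.measurable i).inner_const)).aestronglyMeasurable,
      ?_⟩
    rw [eLpNorm_lt_top_iff_lintegral_rpow_enorm_lt_top (by norm_num) (by norm_num)]
    refine lt_of_le_of_lt ?_ (ENNReal.ofReal_lt_top (r := κ ^ 2 * (a * b) ^ 2))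
    refine le_trans (le_of_eq ?_) (hprod i)
    refine lintegral_congr fun ω => ?_
    rw [← ENNReal.rpow_natCast]; norm_num
  have hZL : ∀ i, MemLp (Z i) 4 P := fun i => (hprodL i).sub (memLp_const _)
  have hZ0 : ∀ i, ∫ ω, Z i ω ∂P = 0 := fun i => by
    simp only [hZ]
    rw [integral_sub ((hprodL i).integrable (by norm_num)) (integrable_const _), h.cov]
    simp
  -- By (w - c)⁴ ≤ 8 w⁴ + 8 c⁴, where the mean of w⁴ and the constant c⁴ are both at most κ² (a b)².
  have hZ4 : ∀ i, ∫ ω, Z i ω ^ 4 ∂P ≤ 16 * κ ^ 2 * (a * b) ^ 2 := fun i => by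
    have hI : Integrable (fun ω => (inner ℝ (X i ω) u * inner ℝ (X i ω) v) ^ 4) P :=
      integrable_pow_of_memLp_four (hprodL i) le_rfl
    have h4 : ∫ ω, (inner ℝ (X i ω) u * inner ℝ (X i ω) v) ^ 4 ∂P ≤ κ ^ 2 * (a * b) ^ 2 := by
      have e := lintegral_enorm_pow_even (p := 2) hI
      have h2 := hprod i
      change ∫⁻ ω, ‖inner ℝ (X i ω) u * inner ℝ (X i ω) v‖ₑ ^ (2 * 2) ∂P ≤ _ at h2
      rw [e] at h2
      exact (ENNReal.ofReal_le_ofReal_iff (by positivity)).1 h2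
    have hc : inner ℝ (K u) v ^ 4 ≤ (a * b) ^ 2 := by
      have := h.inner_sq_le u v
      calc inner ℝ (K u) v ^ 4 = (inner ℝ (K u) v ^ 2) ^ 2 := by ring
        _ ≤ _ := by gcongr
    calc ∫ ω, Z i ω ^ 4 ∂P
        ≤ ∫ ω, (8 * (inner ℝ (X i ω) u * inner ℝ (X i ω) v) ^ 4 + 8 * inner ℝ (K u) v ^ 4) ∂P := by
          refine integral_mono (integrable_pow_of_memLp_four (hZL i) le_rfl)
            ((hI.const_mul 8).add (integrable_const _)) fun ω => ?_
          simp only [hZ]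
          generalize inner ℝ (X i ω) u * inner ℝ (X i ω) v = w
          generalize inner ℝ (K u) v = c
          nlinarith [sq_nonneg (w + c), sq_nonneg (w - c), sq_nonneg (w ^ 2 - c ^ 2),
            sq_nonneg ((w + c) * (w - c)), mul_nonneg (sq_nonneg (w + c)) (sq_nonneg (w + c)),
            mul_nonneg (sq_nonneg (w + c)) (sq_nonneg (w - c))]
      _ = 8 * ∫ ω, (inner ℝ (X i ω) u * inner ℝ (X i ω) v) ^ 4 ∂P + 8 * inner ℝ (K u) v ^ 4 := by
          rw [integral_add (hI.const_mul 8) (integrable_const _), integral_const_mul]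
          simp
      _ ≤ 8 * (κ ^ 2 * (a * b) ^ 2) + 8 * (1 * (a * b) ^ 2) := by gcongr; linarith
      _ ≤ _ := by nlinarith [sq_nonneg (a * b), mul_nonneg (sq_nonneg (a * b)) (sub_nonneg.2 hκ1)]
  have hind : iIndepFun Z P :=
    h.indep.comp (fun _ x => inner ℝ x u * inner ℝ x v - inner ℝ (K u) v) fun _ => by fun_prop
  have hfin := integral_sum_pow_four_le hZm hZL hind hZ0 hZ4 n
  have e : ∀ ω, inner ℝ ((K - empCov n fun i => X i ω) u) v
      = -((n : ℝ)⁻¹ * ∑ i ∈ range n, Z i ω) := fun ω => by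
    simp only [hZ, sum_sub_distrib, sum_const, card_range, nsmul_eq_mul]
    rw [sub_apply, inner_sub_left, inner_empCov]
    field_simp
    ring
  simp only [e, ← pow_mul, enorm_neg]
  have hI : Integrable (fun ω => ((n : ℝ)⁻¹ * ∑ i ∈ range n, Z i ω) ^ (2 * 2)) P := by
    have : MemLp (fun ω => (n : ℝ)⁻¹ * ∑ i ∈ range n, Z i ω) 4 P :=
      (memLp_finsetSum _ fun i _ => hZL i).const_mul _
    exact integrable_pow_of_memLp_four this le_rfl
  rw [lintegral_enorm_pow_even hI, ← ENNReal.ofReal_pow (by positivity)]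
  refine ENNReal.ofReal_le_ofReal ?_
  simp only [mul_pow, integral_const_mul]
  calc _ ≤ (n : ℝ)⁻¹ ^ (2 * 2) * (3 * (n : ℝ) ^ 2 * (16 * κ ^ 2 * (a * b) ^ 2)) := by gcongr
    _ = 48 * (κ * (a * b) / n) ^ 2 := by
        rw [show 2 * 2 = 4 by norm_num, inv_pow, div_pow]; field_simp; ring
    -- 48 = 3 · 16 is rounded up to 7², so that the bound is a perfect square.
    _ ≤ 49 * (κ * (a * b) / n) ^ 2 := by gcongr; norm_num
    _ = _ := by ring

end IsGaussianSample

end Sample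

/-! ### Continuity of the empirical quantities in the data -/

section Continuity

variable {H : Type*} [NormedAddCommGroup H] [InnerProductSpace ℝ H] [CompleteSpace H]

theorem continuous_empCov (n : ℕ) : Continuous fun x : ℕ → H => empCov n x := by
  unfold empCov
  suffices hc : Continuous fun x : ℕ → H => ∑ i ∈ range n, rankOne ℝ (x i) (x i) from
    hc.const_smul (n : ℝ)⁻¹
  refine continuous_finsetSum _ fun i _ => ?_
  exact ((rankOne ℝ : H →L[ℝ] H →L⋆[ℝ] H →L[ℝ] H).continuous.comp (continuous_apply i)).clm_apply
    (continuous_apply i)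

theorem continuous_sampleMean {E : Type*} [NormedAddCommGroup E] [NormedSpace ℝ E] (n : ℕ) :
    Continuous fun x : ℕ → E => sampleMean n x := by
  unfold sampleMean; fun_prop

theorem sum_norm_sub_sampleMean_sq_le (n : ℕ) (z : ℕ → H) :
    ∑ i ∈ range n, ‖z i - sampleMean n z‖ ^ 2 ≤ ∑ i ∈ range n, ‖z i‖ ^ 2 := by
  rcases Nat.eq_zero_or_pos n with rfl | hn
  · simp
  have hn' : (n : ℝ) ≠ 0 := by exact_mod_cast hn.ne'
  set m := sampleMean n z with hm
  have hs : ∑ i ∈ range n, inner ℝ (z i) m = n * ‖m‖ ^ 2 := by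
    rw [← sum_inner, ← real_inner_self_eq_norm_sq, ← real_inner_smul_left]
    congr 1
    rw [hm, sampleMean, smul_smul, mul_inv_cancel₀ hn', one_smul]
  simp only [norm_sub_sq_real, sum_add_distrib, sum_sub_distrib, ← mul_sum, hs, sum_const,
    card_range, nsmul_eq_mul]
  have : 0 ≤ (n : ℝ) * ‖m‖ ^ 2 := by positivity
  linarith

end Continuity

/-- `∑ λ_j / (λ_j + ρ)²`. -/
def varSum (lam : ℕ → ℝ) (ρ : ℝ) : ℝ := ∑' j, lam j / (lam j + ρ) ^ 2

theorem summable_varSum {lam : ℕ → ℝ} (h0 : ∀ j, 0 ≤ lam j) (hs : Summable lam) {ρ : ℝ}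
    (hρ : 0 < ρ) : Summable fun j => lam j / (lam j + ρ) ^ 2 := by
  refine Summable.of_nonneg_of_le (fun j => div_nonneg (h0 j) (sq_nonneg _)) (fun j => ?_)
    (hs.div_const (ρ ^ 2))
  have := h0 j
  gcongr
  linarith

theorem varSum_nonneg {lam : ℕ → ℝ} (h0 : ∀ j, 0 ≤ lam j) (ρ : ℝ) : 0 ≤ varSum lam ρ :=
  tsum_nonneg fun j => div_nonneg (h0 j) (sq_nonneg _)

/-! ### Moments of the regularised design terms -/

section Sample

variable {Ω : Type*} [MeasurableSpace Ω]
  {H : Type*} [NormedAddCommGroup H] [InnerProductSpace ℝ H] [CompleteSpace H]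
  [MeasurableSpace H] [BorelSpace H] [SecondCountableTopology H]
  {P : Measure Ω} [IsProbabilityMeasure P] {K : H →L[ℝ] H}
  {X : ℕ → Ω → H}

/-- The fourth moment of `(K + ρ)⁻¹ V` when the coordinates of `V` have the size of those of `X`. -/
theorem lintegral_ridgeInv_le (hK : K.IsPositive) {φ : HilbertBasis ℕ ℝ H} {lam : ℕ → ℝ}
    (h0 : ∀ j, 0 ≤ lam j) (heig : ∀ j, K (φ j) = lam j • φ j) (hs : Summable lam) {ρ : ℝ}
    (hρ : 0 < ρ) {V : Ω → H} (hV : AEMeasurable V P) {c : ℝ} (hc : 0 ≤ c)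
    (h : ∀ j, ∫⁻ ω, (‖inner ℝ (V ω) (φ j)‖ₑ ^ 2) ^ 2 ∂P ≤ ENNReal.ofReal (c * lam j) ^ 2) :
    ∫⁻ ω, (‖ridgeInv K ρ (V ω)‖ₑ ^ 2) ^ 2 ∂P ≤ ENNReal.ofReal (c * varSum lam ρ) ^ 2 := by
  have hsum := summable_varSum h0 hs hρ
  have e : ENNReal.ofReal (c * varSum lam ρ)
      = ∑' j, ENNReal.ofReal (c * (lam j / (lam j + ρ) ^ 2)) := by
    rw [varSum, ← tsum_mul_left, ENNReal.ofReal_tsum_of_nonneg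
      (fun j => mul_nonneg hc (div_nonneg (h0 j) (sq_nonneg _))) (hsum.mul_left c)]
  rw [e]
  simp only [← pow_mul]
  refine lintegral_enorm_pow_four_le φ (V := fun ω => ridgeInv K ρ (V ω))
    ((ridgeInv K ρ).measurable.comp_aemeasurable hV) fun j => ?_
  have hj := h0 j
  have e2 : ∀ ω, ‖inner ℝ (φ j) (ridgeInv K ρ (V ω))‖ₑ ^ 4
      = ENNReal.ofReal ((lam j + ρ)⁻¹ ^ 4) * (‖inner ℝ (V ω) (φ j)‖ₑ ^ 2) ^ 2 := fun ω => by
    rw [inner_eigenvector_ridgeInv hK hρ hj (heig j), enorm_mul, mul_pow, real_inner_comm,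
      ENNReal.ofReal_pow (by positivity), Real.enorm_of_nonneg (by positivity), ← pow_mul]
  simp only [e2]
  rw [lintegral_const_mul' _ _ ENNReal.ofReal_ne_top]
  refine (mul_le_mul_right (h j) _).trans (le_of_eq ?_)
  rw [← ENNReal.ofReal_pow (by positivity), ← ENNReal.ofReal_mul (by positivity),
    ← ENNReal.ofReal_pow (by positivity)]
  congr 1
  field_simp

namespace IsGaussianSample

variable (h : IsGaussianSample P K X) {φ : HilbertBasis ℕ ℝ H} {lam : ℕ → ℝ}
  (h0 : ∀ j, 0 ≤ lam j) (heig : ∀ j, K (φ j) = lam j • φ j) (hs : Summable lam)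
include h

theorem measurable_data : Measurable fun ω i => X i ω := measurable_pi_lambda _ h.measurable

include heig

theorem inner_eig (j : ℕ) : inner ℝ (K (φ j)) (φ j) = lam j := by
  rw [heig, real_inner_smul_left, real_inner_self_eq_norm_sq, φ.orthonormal.norm_eq_one]; simp

include h0 hs

/-- The fourth moment of the operator norm of `K - K̂`. -/
theorem lintegral_opNorm_le {n : ℕ} (hn : n ≠ 0) :
    ∫⁻ ω, (‖K - empCov n fun i => X i ω‖ₑ ^ 2) ^ 2 ∂P
      ≤ ENNReal.ofReal (7 * gaussConst * (∑' j, lam j) ^ 2 / n) ^ 2 := by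
  have hκ := one_le_gaussConst
  have hn' : (0 : ℝ) < n := by exact_mod_cast Nat.pos_of_ne_zero hn
  have hm : ∀ q : ℕ × ℕ, AEMeasurable (fun ω =>
      ‖inner ℝ (φ q.2) ((K - empCov n fun i => X i ω) (φ q.1))‖ₑ ^ 2) P := fun q => by
    have : Continuous fun x : ℕ → H => inner ℝ (φ q.2) ((K - empCov n x) (φ q.1)) := by
      have := continuous_empCov (H := H) n
      fun_prop
    exact (this.measurable.comp (h.measurable_data)).enorm.pow_const 2 |>.aemeasurable
  calc _ ≤ ∫⁻ ω, (∑' q : ℕ × ℕ,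
        ‖inner ℝ (φ q.2) ((K - empCov n fun i => X i ω) (φ q.1))‖ₑ ^ 2) ^ 2 ∂P := by
        refine lintegral_mono fun ω => ?_
        gcongr
        exact enorm_opNorm_sq_le φ _
    _ ≤ (∑' q : ℕ × ℕ, ENNReal.ofReal (7 * gaussConst * (lam q.1 * lam q.2) / n)) ^ 2 := by
        refine lintegral_tsum_sq_le hm fun q => ?_
        have := h.lintegral_inner_empCov_sub_le hn (φ q.1) (φ q.2)
        rw [h.inner_eig heig, h.inner_eig heig] at this
        simpa only [real_inner_comm] using this
    _ = _ := by
        congr 1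
        have e : ∀ q : ℕ × ℕ, ENNReal.ofReal (7 * gaussConst * (lam q.1 * lam q.2) / n)
            = ENNReal.ofReal (7 * gaussConst / n) *
              (ENNReal.ofReal (lam q.1) * ENNReal.ofReal (lam q.2)) := fun q => by
          rw [← ENNReal.ofReal_mul (h0 _), ← ENNReal.ofReal_mul (by positivity)]
          congr 1; ring
        simp only [e]
        rw [ENNReal.tsum_mul_left, ENNReal.tsum_prod']
        simp only [ENNReal.tsum_mul_left, ENNReal.tsum_mul_right]
        rw [← ENNReal.ofReal_tsum_of_nonneg h0 hs, ← ENNReal.ofReal_mul (tsum_nonneg h0),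
          ← ENNReal.ofReal_mul (by positivity)]
        congr 1; ring

/-- A constant for the moments of `1 + ‖K - K̂‖ / ρ`. -/
theorem lintegral_weight_le {n : ℕ} (hn : n ≠ 0) {ρ : ℝ} (hρ : 0 < ρ) (hnρ : 1 ≤ n * ρ ^ 2) :
    ∫⁻ ω, (ENNReal.ofReal (1 + ρ⁻¹ * ‖K - empCov n fun i => X i ω‖) ^ 2) ^ 2 ∂P
      ≤ ENNReal.ofReal (3 * (1 + 7 * gaussConst * (∑' j, lam j) ^ 2)) ^ 2 := by
  have hκ := one_le_gaussConst
  have hn' : (0 : ℝ) < n := by exact_mod_cast Nat.pos_of_ne_zero hn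
  set t := 7 * gaussConst * (∑' j, lam j) ^ 2 with ht
  have ht0 : 0 ≤ t := by positivity
  -- (1 + w)⁴ ≤ 8 + 8 w⁴ with w = ‖K - K̂‖ / ρ. The fourth moment of ‖K - K̂‖ is of order n⁻², so
  -- that of w is of order (n ρ²)⁻², which is where n ρ² ≥ 1 enters.
  have hp : ∀ ω, (ENNReal.ofReal (1 + ρ⁻¹ * ‖K - empCov n fun i => X i ω‖) ^ 2) ^ 2
      ≤ 8 + ENNReal.ofReal (8 * ρ⁻¹ ^ 4) * (‖K - empCov n fun i => X i ω‖ₑ ^ 2) ^ 2 := fun ω => by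
    set d := ‖K - empCov n fun i => X i ω‖ with hd
    have hd0 : 0 ≤ d := norm_nonneg _
    rw [← pow_mul, ← pow_mul, ← ofReal_norm, ← hd, ← ENNReal.ofReal_pow (by positivity),
      ← ENNReal.ofReal_pow hd0, ← ENNReal.ofReal_mul (by positivity),
      show (8 : ℝ≥0∞) = ENNReal.ofReal 8 by simp, ← ENNReal.ofReal_add (by norm_num) (by positivity)]
    refine ENNReal.ofReal_le_ofReal ?_
    have e : 8 * ρ⁻¹ ^ 4 * d ^ (2 * 2) = 8 * (ρ⁻¹ * d) ^ 4 := by ring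
    rw [e]
    generalize ρ⁻¹ * d = w
    have h1 : (1 + w) ^ 2 ≤ 2 * (1 + w ^ 2) := by nlinarith [sq_nonneg (w - 1)]
    rw [pow_mul]
    nlinarith [sq_nonneg (w ^ 2 - 1), pow_le_pow_left₀ (sq_nonneg _) h1 2]
  calc _ ≤ ∫⁻ ω, (8 + ENNReal.ofReal (8 * ρ⁻¹ ^ 4)
          * (‖K - empCov n fun i => X i ω‖ₑ ^ 2) ^ 2) ∂P := lintegral_mono hp
    _ = 8 + ENNReal.ofReal (8 * ρ⁻¹ ^ 4)
          * ∫⁻ ω, (‖K - empCov n fun i => X i ω‖ₑ ^ 2) ^ 2 ∂P := by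
        rw [lintegral_add_left measurable_const, lintegral_const_mul' _ _ ENNReal.ofReal_ne_top]
        simp
    _ ≤ 8 + ENNReal.ofReal (8 * ρ⁻¹ ^ 4) * ENNReal.ofReal (t / n) ^ 2 := by
        gcongr
        exact h.lintegral_opNorm_le h0 heig hs hn
    _ = ENNReal.ofReal (8 + 8 * (t / (n * ρ ^ 2)) ^ 2) := by
        rw [ENNReal.ofReal_add (by norm_num) (by positivity), ← ENNReal.ofReal_pow (by positivity),
          ← ENNReal.ofReal_mul (by positivity)]
        congr 1
        · simp
        · congr 1; field_simp
    _ ≤ _ := by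
        rw [← ENNReal.ofReal_pow (by positivity)]
        refine ENNReal.ofReal_le_ofReal ?_
        have h1 : t / (n * ρ ^ 2) ≤ t := div_le_self ht0 hnρ
        have h2 : 0 ≤ t / (n * ρ ^ 2) := by positivity
        nlinarith

/-- Keeping the factor λ_j in the size of the j-th coordinate of (K - K̂) u, instead of passing to
the operator norm, is what produces the sum ∑ λ_j / (λ_j + ρ)². This is possible because u is not
random. -/
theorem lintegral_ridgeInv_sub_apply_le {n : ℕ} (hn : n ≠ 0) {ρ : ℝ} (hρ : 0 < ρ) (u : H) :
    ∫⁻ ω, (‖ridgeInv K ρ ((K - empCov n fun i => X i ω) u)‖ₑ ^ 2) ^ 2 ∂P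
      ≤ ENNReal.ofReal (7 * gaussConst * inner ℝ (K u) u / n * varSum lam ρ) ^ 2 := by
  have hκ := one_le_gaussConst
  have hu := h.inner_nonneg u
  have hc : Continuous fun x : ℕ → H => (K - empCov n x) u := by
    have := continuous_empCov (H := H) n
    fun_prop
  refine lintegral_ridgeInv_le h.pos h0 heig hs hρ
    (hc.measurable.comp (h.measurable_data)).aemeasurable (by positivity) fun j => ?_
  refine (h.lintegral_inner_empCov_sub_le hn u (φ j)).trans (le_of_eq ?_)
  rw [h.inner_eig heig]
  congr 2; ring

/-- The sample mean enters twice, so the squared norm is even of order n⁻²; one factor n⁻¹ is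
discarded. -/
theorem lintegral_ridgeInv_mean_le {n : ℕ} (hn : n ≠ 0) {ρ : ℝ} (hρ : 0 < ρ) (u : H) :
    ∫⁻ ω, (‖ridgeInv K ρ (inner ℝ (sampleMean n fun i => X i ω) u •
        sampleMean n fun i => X i ω)‖ₑ ^ 2) ^ 2 ∂P
      ≤ ENNReal.ofReal (gaussConst * inner ℝ (K u) u / n * varSum lam ρ) ^ 2 := by
  have hκ := one_le_gaussConst
  have hu := h.inner_nonneg u
  have hn' : (1 : ℝ) ≤ n := by exact_mod_cast Nat.one_le_iff_ne_zero.2 hn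
  have hsm := continuous_sampleMean (E := H) n
  have hc : Continuous fun x : ℕ → H => inner ℝ (sampleMean n x) u • sampleMean n x := by
    fun_prop
  have hmi : ∀ v, AEMeasurable (fun ω => ‖inner ℝ (sampleMean n fun i => X i ω) v‖ₑ ^ 4) P :=
    fun v => ((hsm.measurable.comp (h.measurable_data)).inner_const.enorm.pow_const
      4).aemeasurable
  refine lintegral_ridgeInv_le h.pos h0 heig hs hρ
    (hc.measurable.comp (h.measurable_data)).aemeasurable (by positivity) fun j => ?_
  have h1 := lintegral_mul_le_of_sq_le (P := P) (hmi u) (hmi (φ j))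
    ((h.inner_sampleMean_gaussian n u).lintegral_pow_eight_le (h.inner_sampleMean_centered n u)
      (h.inner_sampleMean_variance hn u))
    ((h.inner_sampleMean_gaussian n (φ j)).lintegral_pow_eight_le
      (h.inner_sampleMean_centered n (φ j)) (h.inner_sampleMean_variance hn (φ j)))
  have hj := h0 j
  rw [h.inner_eig heig, ← ENNReal.ofReal_mul (by positivity)] at h1
  simp only [Function.comp_apply, real_inner_smul_left, enorm_mul, mul_pow, ← pow_mul]
  refine h1.trans ?_
  rw [← ENNReal.ofReal_pow (by positivity)]
  refine ENNReal.ofReal_le_ofReal ?_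
  calc _ = (gaussConst * inner ℝ (K u) u * lam j) ^ 2 / (n : ℝ) ^ 4 := by
        have : (n : ℝ) ≠ 0 := by positivity
        field_simp
    _ ≤ (gaussConst * inner ℝ (K u) u * lam j) ^ 2 / (n : ℝ) ^ 2 := by
        gcongr
        · norm_num
    _ = _ := by ring

theorem lintegral_ridgeInv_obs_le {ρ : ℝ} (hρ : 0 < ρ) (i : ℕ) :
    ∫⁻ ω, (‖ridgeInv K ρ (X i ω)‖ₑ ^ 2) ^ 2 ∂P
      ≤ ENNReal.ofReal (gaussConst * varSum lam ρ) ^ 2 := by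
  have hκ := one_le_gaussConst
  refine lintegral_ridgeInv_le h.pos h0 heig hs hρ (h.measurable i).aemeasurable (by positivity)
    fun j => ?_
  have := (h.inner_gaussian i (φ j)).lintegral_pow_four_le (h.inner_centered i (φ j))
    (h.inner_variance i (φ j))
  rwa [h.inner_eig heig] at this

end IsGaussianSample

end Sample

/-! ### The error of the Tikhonov estimator -/

section Definitions

variable {H : Type*} [NormedAddCommGroup H] [InnerProductSpace ℝ H] [CompleteSpace H]

/-- The deviation of the empirical cross-covariance from `K β`. -/
def crossCovError (K : H →L[ℝ] H) (n : ℕ) (β : H) (x : ℕ → H) (e : ℕ → ℝ) : H :=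
  -(K - empCov n x) β - inner ℝ (sampleMean n x) β • sampleMean n x + noiseTerm n e x

theorem empCrossCov_response_eq {n : ℕ} (hn : n ≠ 0) (K : H →L[ℝ] H) (a : ℝ) (β : H) (x : ℕ → H)
    (e : ℕ → ℝ) :
    empCrossCov n (fun i => a + inner ℝ (x i) β + e i) x = K β + crossCovError K n β x e := by
  rw [empCrossCov_response hn, crossCovError, sub_apply]
  abel

/-- The factor by which replacing `K` with the empirical covariance amplifies errors. -/
def amplification (K : H →L[ℝ] H) (ρ : ℝ) (n : ℕ) (x : ℕ → H) : ℝ := 1 + ρ⁻¹ * ‖K - empCov n x‖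

theorem continuous_amplification (K : H →L[ℝ] H) (ρ : ℝ) (n : ℕ) :
    Continuous (amplification K ρ n) := by
  have := continuous_empCov (H := H) n
  unfold amplification
  fun_prop

theorem one_le_amplification (K : H →L[ℝ] H) {ρ : ℝ} (hρ : 0 < ρ) (n : ℕ) (x : ℕ → H) :
    1 ≤ amplification K ρ n x := by
  unfold amplification
  have : 0 ≤ ρ⁻¹ * ‖K - empCov n x‖ := by positivity
  linarith

/-- A bound for the distance of the Tikhonov estimator to its oracle version, and of the latter to
its bias term. -/
def tikErr (K : H →L[ℝ] H) (ρ : ℝ) (n : ℕ) (β : H) (x : ℕ → H) (e : ℕ → ℝ) : ℝ :=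
  amplification K ρ n x * (‖ridgeInv K ρ ((K - empCov n x) (ridgeInv K ρ (K β)))‖
    + ‖ridgeInv K ρ (crossCovError K n β x e)‖)

theorem tikErr_nonneg (K : H →L[ℝ] H) {ρ : ℝ} (hρ : 0 < ρ) (n : ℕ) (β : H) (x : ℕ → H)
    (e : ℕ → ℝ) : 0 ≤ tikErr K ρ n β x e :=
  mul_nonneg (zero_le_one.trans (one_le_amplification K hρ n x)) (by positivity)

theorem norm_ridgeInv_crossCovError_le (K : H →L[ℝ] H) {ρ : ℝ} (hρ : 0 < ρ) (n : ℕ) (β : H)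
    (x : ℕ → H) (e : ℕ → ℝ) : ‖ridgeInv K ρ (crossCovError K n β x e)‖ ≤ tikErr K ρ n β x e := by
  have h1 := one_le_amplification K hρ n x
  unfold tikErr
  generalize amplification K ρ n x = g at *
  nlinarith [norm_nonneg (ridgeInv K ρ ((K - empCov n x) (ridgeInv K ρ (K β)))),
    norm_nonneg (ridgeInv K ρ (crossCovError K n β x e))]

end Definitions

/-- The noise of the regression model: square integrable, centred, i.i.d., with variance `s` and
independent of the design. -/
structure IsModelNoise {Ω : Type*} [MeasurableSpace Ω] {H : Type*} [MeasurableSpace H]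
    (P : Measure Ω) (X : ℕ → Ω → H) (ε : ℕ → Ω → ℝ) (s : ℝ) : Prop where
  measurable : ∀ i, Measurable (ε i)
  indep : iIndepFun ε P
  memLp : ∀ i, MemLp (ε i) 2 P
  centered : ∀ i, ∫ ω, ε i ω ∂P = 0
  variance : ∀ i, ∫ ω, ε i ω ^ 2 ∂P = s
  indep_design : IndepFun (fun ω i => X i ω) (fun ω i => ε i ω) P

section Sample

variable {Ω : Type*} [MeasurableSpace Ω]
  {H : Type*} [NormedAddCommGroup H] [InnerProductSpace ℝ H] [CompleteSpace H]
  [MeasurableSpace H] [BorelSpace H] [SecondCountableTopology H]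
  {P : Measure Ω} [IsProbabilityMeasure P] {K : H →L[ℝ] H}
  {X : ℕ → Ω → H} {ε : ℕ → Ω → ℝ} {s : ℝ}

theorem IsModelNoise.nonneg (hε : IsModelNoise P X ε s) : 0 ≤ s := by
  rw [← hε.variance 0]
  exact integral_nonneg fun ω => sq_nonneg _

namespace IsGaussianSample

variable (h : IsGaussianSample P K X) {φ : HilbertBasis ℕ ℝ H} {lam : ℕ → ℝ}
  (h0 : ∀ j, 0 ≤ lam j) (heig : ∀ j, K (φ j) = lam j • φ j) (hs : Summable lam)
include h h0 heig hs

/-- Cauchy-Schwarz separates the amplification factor, whose fourth moment is bounded, from `V`. -/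
theorem lintegral_amplification_mul_le {n : ℕ} (hn : n ≠ 0) {ρ : ℝ} (hρ : 0 < ρ)
    (hnρ : 1 ≤ n * ρ ^ 2) {V : (ℕ → H) → H} (hV : Measurable V) {B : ℝ}
    (hB : ∫⁻ ω, (‖V fun i => X i ω‖ₑ ^ 2) ^ 2 ∂P ≤ ENNReal.ofReal B ^ 2) :
    ∫⁻ ω, ENNReal.ofReal (amplification K ρ n fun i => X i ω) ^ 2 * ‖V fun i => X i ω‖ₑ ^ 2 ∂P
      ≤ ENNReal.ofReal (3 * (1 + 7 * gaussConst * (∑' j, lam j) ^ 2) * B) := by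
  have hκ := one_le_gaussConst
  rw [ENNReal.ofReal_mul (by positivity)]
  refine lintegral_mul_le_of_sq_le ?_ ?_ (h.lintegral_weight_le h0 heig hs hn hρ hnρ) hB
  · exact (((continuous_amplification K ρ n).measurable.comp h.measurable_data).ennreal_ofReal.pow_const
      2).aemeasurable
  · exact ((hV.comp h.measurable_data).enorm.pow_const 2).aemeasurable

/-- The errors have second moments only, so Cauchy-Schwarz against the amplification factor is not
available. That factor depends on the design alone and is absorbed into the coefficients v_i of the
errors. Orthogonality of the errors then leaves n terms of order n⁻², and centring the observations
only decreases the sum of squares. -/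
theorem lintegral_noise_le (hε : IsModelNoise P X ε s) {n : ℕ} (hn : n ≠ 0) {ρ : ℝ} (hρ : 0 < ρ)
    (hnρ : 1 ≤ n * ρ ^ 2) :
    ∫⁻ ω, ENNReal.ofReal (amplification K ρ n fun i => X i ω) ^ 2 *
        ‖ridgeInv K ρ (noiseTerm n (fun i => ε i ω) fun i => X i ω)‖ₑ ^ 2 ∂P
      ≤ ENNReal.ofReal (s * (3 * (1 + 7 * gaussConst * (∑' j, lam j) ^ 2) *
          (gaussConst * varSum lam ρ)) / n) := by
  have hκ := one_le_gaussConst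
  have hn' : (0 : ℝ) < n := by exact_mod_cast Nat.pos_of_ne_zero hn
  set A := 3 * (1 + 7 * gaussConst * (∑' j, lam j) ^ 2) * (gaussConst * varSum lam ρ) with hA
  have hA0 : 0 ≤ A := by
    have := varSum_nonneg h0 ρ
    positivity
  set v : ℕ → (ℕ → H) → H := fun i x =>
    (amplification K ρ n x * (n : ℝ)⁻¹) • ridgeInv K ρ (x i - sampleMean n x) with hv
  have hamp := continuous_amplification K ρ n
  have hsm := continuous_sampleMean (E := H) n
  have hvm : ∀ i, Measurable (v i) := fun i => by
    refine Continuous.measurable ?_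
    rw [hv]
    fun_prop
  have hpt : ∀ x : ℕ → H, ∑ i ∈ range n, ‖v i x‖ₑ ^ 2
      ≤ ENNReal.ofReal ((n : ℝ)⁻¹ ^ 2) * ∑ i ∈ range n,
        ENNReal.ofReal (amplification K ρ n x) ^ 2 * ‖ridgeInv K ρ (x i)‖ₑ ^ 2 := fun x => by
    have hg : 0 ≤ amplification K ρ n x := zero_le_one.trans (one_le_amplification K hρ n x)
    have h1 := sum_norm_sub_sampleMean_sq_le n fun i => ridgeInv K ρ (x i)
    simp only [← ofReal_norm, ← ENNReal.ofReal_pow hg, ← ENNReal.ofReal_pow (norm_nonneg _),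
      ← ENNReal.ofReal_mul (sq_nonneg (amplification K ρ n x))]
    rw [← ENNReal.ofReal_sum_of_nonneg fun i _ => by positivity,
      ← ENNReal.ofReal_sum_of_nonneg fun i _ => by positivity,
      ← ENNReal.ofReal_mul (by positivity)]
    refine ENNReal.ofReal_le_ofReal ?_
    simp only [hv, norm_smul, map_sub, mul_pow, norm_mul, Real.norm_eq_abs, sq_abs]
    rw [← mul_sum, ← mul_sum, ← sampleMean_map]
    calc _ ≤ amplification K ρ n x ^ 2 * (n : ℝ)⁻¹ ^ 2 * ∑ i ∈ range n, ‖ridgeInv K ρ (x i)‖ ^ 2 := by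
          gcongr
      _ = _ := by ring
  have hle : ∑ i ∈ range n, ∫⁻ ω, ‖v i fun k => X k ω‖ₑ ^ 2 ∂P ≤ ENNReal.ofReal (A / n) := by
    have hm : ∀ i, Measurable fun ω => ‖v i fun k => X k ω‖ₑ ^ 2 := fun i =>
      ((hvm i).comp h.measurable_data).enorm.pow_const 2
    rw [← lintegral_finsetSum' _ fun i _ => (hm i).aemeasurable]
    refine (lintegral_mono fun ω => hpt fun k => X k ω).trans ?_
    rw [lintegral_const_mul' _ _ ENNReal.ofReal_ne_top, lintegral_finsetSum']
    · refine (mul_le_mul_right (Finset.sum_le_sum fun i _ =>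
        h.lintegral_amplification_mul_le h0 heig hs hn hρ hnρ
          (V := fun x => ridgeInv K ρ (x i)) (by fun_prop)
          (h.lintegral_ridgeInv_obs_le h0 heig hs hρ i)) _).trans (le_of_eq ?_)
      rw [sum_const, card_range, nsmul_eq_mul, ← ENNReal.ofReal_natCast,
        ← ENNReal.ofReal_mul (by positivity), ← ENNReal.ofReal_mul (by positivity)]
      congr 1
      rw [← hA]; field_simp
    · intro i _
      exact ((hamp.measurable.comp h.measurable_data).ennreal_ofReal.pow_const 2 |>.mul
        (((ridgeInv K ρ).measurable.comp (h.measurable i)).enorm.pow_const 2)).aemeasurable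
  have hvL : ∀ i < n, MemLp (fun ω => v i fun k => X k ω) 2 P := fun i hi => by
    refine ⟨((hvm i).comp h.measurable_data).aestronglyMeasurable, ?_⟩
    rw [eLpNorm_lt_top_iff_lintegral_rpow_enorm_lt_top (by simp) (by simp)]
    simp only [ENNReal.toReal_ofNat, ENNReal.rpow_two]
    refine lt_of_le_of_lt ?_ (ENNReal.ofReal_lt_top (r := A / n))
    exact (Finset.single_le_sum (f := fun i => ∫⁻ ω, ‖v i fun k => X k ω‖ₑ ^ 2 ∂P)
      (fun _ _ => zero_le) (mem_range.2 hi)).trans hle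
  have key := lintegral_enorm_sum_noise_sq hε.indep hε.memLp hε.centered hε.variance
    hε.indep_design hvm n hvL
  have e : ∀ ω, ENNReal.ofReal (amplification K ρ n fun i => X i ω) ^ 2 *
        ‖ridgeInv K ρ (noiseTerm n (fun i => ε i ω) fun i => X i ω)‖ₑ ^ 2
      = ‖∑ i ∈ range n, ε i ω • v i (fun k => X k ω)‖ₑ ^ 2 := fun ω => by
    have hg : 0 ≤ amplification K ρ n fun i => X i ω :=
      zero_le_one.trans (one_le_amplification K hρ n _)
    rw [← mul_pow, ← Real.enorm_of_nonneg hg, ← enorm_smul]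
    congr 2
    rw [noiseTerm, map_smul, map_sum, smul_sum, smul_sum]
    refine sum_congr rfl fun i _ => ?_
    rw [hv, map_smul, smul_smul, smul_smul, smul_smul]
    congr 1; ring
  simp only [e]
  rw [key]
  refine (mul_le_mul_right hle _).trans (le_of_eq ?_)
  rw [← ENNReal.ofReal_mul hε.nonneg]
  congr 1; ring

/-- The mean square of the error bound is of the order of `n⁻¹ ∑ λ_j / (λ_j + ρ)²`. -/
theorem exists_lintegral_tikErr_sq_le (hε : IsModelNoise P X ε s) (β : H) :
    ∃ C > 0, ∀ (n : ℕ) (ρ : ℝ), n ≠ 0 → 0 < ρ → 1 ≤ n * ρ ^ 2 →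
      ∫⁻ ω, ENNReal.ofReal (tikErr K ρ n β (fun i => X i ω) fun i => ε i ω) ^ 2 ∂P
        ≤ ENNReal.ofReal (C * (varSum lam ρ / n)) := by
  have hκ := one_le_gaussConst
  have hs0 := hε.nonneg
  set D := 3 * (1 + 7 * gaussConst * (∑' j, lam j) ^ 2) with hD
  have hD0 : 0 < D := by positivity
  set q := ‖K‖ * (2 * ‖β‖) ^ 2 with hq
  have hβ := h.inner_nonneg β
  set p := inner ℝ (K β) β with hp
  refine ⟨4 * (D * (7 * gaussConst * q) + D * (7 * gaussConst * p) + D * (gaussConst * p)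
    + s * (D * gaussConst)) + 1, by positivity, fun n ρ hn hρ hnρ => ?_⟩
  have hn' : (0 : ℝ) < n := by exact_mod_cast Nat.pos_of_ne_zero hn
  have hS := varSum_nonneg h0 ρ
  set S := varSum lam ρ with hSdef
  set u := ridgeInv K ρ (K β) with hu
  -- Since u = β - ρ R β, its norm is bounded uniformly in ρ, and ⟨K u, u⟩ can enter the constant.
  have hun : ‖u‖ ≤ 2 * ‖β‖ := by
    have e : u = β - ρ • ridgeInv K ρ β := by
      have h1 := ridgeInv_apply_add h.pos hρ β
      rw [hu, eq_sub_iff_add_eq, ← map_smul, ← map_add, h1]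
    rw [e]
    have h2 := norm_smul_ridgeInv_apply_le h.pos hρ β
    have h3 := norm_sub_le β (ρ • ridgeInv K ρ β)
    linarith
  have hKu : inner ℝ (K u) u ≤ q := by
    refine (real_inner_le_norm _ _).trans ?_
    calc ‖K u‖ * ‖u‖ ≤ ‖K‖ * ‖u‖ * ‖u‖ := by gcongr; exact K.le_opNorm u
      _ = ‖K‖ * ‖u‖ ^ 2 := by ring
      _ ≤ _ := by rw [hq]; gcongr
  have hemp := continuous_empCov (H := H) n
  have hsm := continuous_sampleMean (E := H) n
  have m1 : Continuous fun x : ℕ → H => ridgeInv K ρ ((K - empCov n x) u) := by fun_prop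
  have m2 : Continuous fun x : ℕ → H => ridgeInv K ρ ((K - empCov n x) β) := by fun_prop
  have m3 : Continuous fun x : ℕ → H =>
      ridgeInv K ρ (inner ℝ (sampleMean n x) β • sampleMean n x) := by fun_prop
  have i1 := h.lintegral_amplification_mul_le h0 heig hs hn hρ hnρ m1.measurable
    (h.lintegral_ridgeInv_sub_apply_le h0 heig hs hn hρ u)
  have i2 := h.lintegral_amplification_mul_le h0 heig hs hn hρ hnρ m2.measurable
    (h.lintegral_ridgeInv_sub_apply_le h0 heig hs hn hρ β)
  have i3 := h.lintegral_amplification_mul_le h0 heig hs hn hρ hnρ m3.measurable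
    (h.lintegral_ridgeInv_mean_le h0 heig hs hn hρ β)
  have i4 := h.lintegral_noise_le h0 heig hs hε hn hρ hnρ
  rw [← hD, ← hSdef] at i1 i2 i3 i4
  have hpt : ∀ (x : ℕ → H) (e : ℕ → ℝ), ENNReal.ofReal (tikErr K ρ n β x e) ^ 2
      ≤ ENNReal.ofReal 4 * (ENNReal.ofReal (amplification K ρ n x) ^ 2 *
          ‖ridgeInv K ρ ((K - empCov n x) u)‖ₑ ^ 2
        + ENNReal.ofReal (amplification K ρ n x) ^ 2 * ‖ridgeInv K ρ ((K - empCov n x) β)‖ₑ ^ 2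
        + ENNReal.ofReal (amplification K ρ n x) ^ 2 *
          ‖ridgeInv K ρ (inner ℝ (sampleMean n x) β • sampleMean n x)‖ₑ ^ 2
        + ENNReal.ofReal (amplification K ρ n x) ^ 2 * ‖ridgeInv K ρ (noiseTerm n e x)‖ₑ ^ 2) := by
    intro x e
    have hg : 0 ≤ amplification K ρ n x := zero_le_one.trans (one_le_amplification K hρ n x)
    have hw : ‖ridgeInv K ρ (crossCovError K n β x e)‖ ≤ ‖ridgeInv K ρ ((K - empCov n x) β)‖
        + ‖ridgeInv K ρ (inner ℝ (sampleMean n x) β • sampleMean n x)‖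
        + ‖ridgeInv K ρ (noiseTerm n e x)‖ := by
      rw [crossCovError, map_add, map_sub, map_neg]
      refine (norm_add_le _ _).trans (add_le_add_left ((norm_sub_le _ _).trans ?_) _)
      rw [norm_neg]
    simp only [← ofReal_norm, ← ENNReal.ofReal_pow hg, ← ENNReal.ofReal_pow (norm_nonneg _),
      ← ENNReal.ofReal_mul (sq_nonneg (amplification K ρ n x)),
      ← ENNReal.ofReal_pow (tikErr_nonneg K hρ n β x e)]
    rw [← ENNReal.ofReal_add (by positivity) (by positivity),
      ← ENNReal.ofReal_add (by positivity) (by positivity),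
      ← ENNReal.ofReal_add (by positivity) (by positivity), ← ENNReal.ofReal_mul (by norm_num)]
    refine ENNReal.ofReal_le_ofReal ?_
    rw [tikErr, ← hu]
    generalize amplification K ρ n x = g at *
    have n1 := norm_nonneg (ridgeInv K ρ ((K - empCov n x) u))
    have n2 := norm_nonneg (ridgeInv K ρ ((K - empCov n x) β))
    have n3 := norm_nonneg (ridgeInv K ρ (inner ℝ (sampleMean n x) β • sampleMean n x))
    have n4 := norm_nonneg (ridgeInv K ρ (noiseTerm n e x))
    have n5 := norm_nonneg (ridgeInv K ρ (crossCovError K n β x e))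
    generalize ‖ridgeInv K ρ ((K - empCov n x) u)‖ = a1 at *
    generalize ‖ridgeInv K ρ ((K - empCov n x) β)‖ = a2 at *
    generalize ‖ridgeInv K ρ (inner ℝ (sampleMean n x) β • sampleMean n x)‖ = a3 at *
    generalize ‖ridgeInv K ρ (noiseTerm n e x)‖ = a4 at *
    generalize ‖ridgeInv K ρ (crossCovError K n β x e)‖ = a5 at *
    calc (g * (a1 + a5)) ^ 2 ≤ (g * (a1 + (a2 + a3 + a4))) ^ 2 := by gcongr
      _ = g ^ 2 * (a1 + (a2 + a3 + a4)) ^ 2 := by ring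
      _ ≤ g ^ 2 * (4 * (a1 ^ 2 + a2 ^ 2 + a3 ^ 2 + a4 ^ 2)) := by
          gcongr
          nlinarith [sq_nonneg (a1 - a2), sq_nonneg (a1 - a3), sq_nonneg (a1 - a4),
            sq_nonneg (a2 - a3), sq_nonneg (a2 - a4), sq_nonneg (a3 - a4)]
      _ = _ := by ring
  refine (lintegral_mono fun ω => hpt _ _).trans ?_
  have hamp : Measurable fun ω => ENNReal.ofReal (amplification K ρ n fun i => X i ω) ^ 2 :=
    ((continuous_amplification K ρ n).measurable.comp h.measurable_data).ennreal_ofReal.pow_const 2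
  have hM : ∀ {V : (ℕ → H) → H}, Continuous V → Measurable fun ω =>
      ENNReal.ofReal (amplification K ρ n fun i => X i ω) ^ 2 * ‖V fun i => X i ω‖ₑ ^ 2 :=
    fun hV => hamp.mul ((hV.measurable.comp h.measurable_data).enorm.pow_const 2)
  have M1 := hM m1
  have M2 := hM m2
  have M3 := hM m3
  rw [lintegral_const_mul' _ _ ENNReal.ofReal_ne_top, lintegral_add_left ((M1.fun_add M2).fun_add M3),
    lintegral_add_left (M1.fun_add M2), lintegral_add_left M1]
  refine (mul_le_mul_right (add_le_add (add_le_add (add_le_add i1 i2) i3) i4) _).trans ?_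
  have hu0 := h.inner_nonneg u
  rw [← ENNReal.ofReal_add (by positivity) (by positivity),
    ← ENNReal.ofReal_add (by positivity) (by positivity),
    ← ENNReal.ofReal_add (by positivity) (by positivity), ← ENNReal.ofReal_mul (by norm_num)]
  refine ENNReal.ofReal_le_ofReal ?_
  calc _ ≤ 4 * (D * (7 * gaussConst * q / n * S) + D * (7 * gaussConst * p / n * S)
        + D * (gaussConst * p / n * S) + s * (D * (gaussConst * S)) / n) := by gcongr
    _ = (4 * (D * (7 * gaussConst * q) + D * (7 * gaussConst * p) + D * (gaussConst * p)
      + s * (D * gaussConst))) * (S / n) := by ring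
    _ ≤ _ := by gcongr; linarith

end IsGaussianSample

end Sample

/-! ### Inverse moments of the leading empirical eigenvalues -/

section Gaussian

variable {Ω : Type*} [MeasurableSpace Ω] {P : Measure Ω} [IsProbabilityMeasure P]

/-- The normal density is at most (2 π a)^(-1/2), and the integral of exp(-2 x²) is (π / 2)^(1/2).
-/
theorem _root_.ProbabilityTheory.HasGaussianLaw.lintegral_exp_neg_sq_le {Z : Ω → ℝ}
    (hZ : HasGaussianLaw Z P) (h0 : ∫ ω, Z ω ∂P = 0) {a : ℝ} (ha : 0 < a)
    (hv : ∫ ω, Z ω ^ 2 ∂P = a) :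
    ∫⁻ ω, ENNReal.ofReal (Real.exp (-2 * Z ω ^ 2)) ∂P ≤ ENNReal.ofReal (√a)⁻¹ := by
  have hvar : Var[Z; P] = a := by rw [variance_of_integral_eq_zero hZ.aemeasurable h0, hv]
  have ha' : a.toNNReal ≠ 0 := by simpa using ha
  have hm : Measurable fun x : ℝ => ENNReal.ofReal (Real.exp (-2 * x ^ 2)) := by fun_prop
  calc _ = ∫⁻ x, ENNReal.ofReal (Real.exp (-2 * x ^ 2)) ∂(P.map Z) :=
        (lintegral_map' hm.aemeasurable hZ.aemeasurable).symm
    _ = ∫⁻ x, gaussianPDF 0 a.toNNReal x * ENNReal.ofReal (Real.exp (-2 * x ^ 2)) := by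
        rw [hZ.map_eq_gaussianReal, h0, hvar, gaussianReal_of_var_ne_zero _ ha',
          lintegral_withDensity_eq_lintegral_mul _ (measurable_gaussianPDF _ _) hm]
        rfl
    _ ≤ ∫⁻ x, ENNReal.ofReal ((√(2 * Real.pi * a))⁻¹) *
          ENNReal.ofReal (Real.exp (-2 * x ^ 2)) := by
        refine lintegral_mono fun x => mul_le_mul_left (ENNReal.ofReal_le_ofReal ?_) _
        rw [gaussianPDFReal_def, Real.coe_toNNReal _ ha.le]
        refine mul_le_of_le_one_right (by positivity) (Real.exp_le_one_iff.2 ?_)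
        exact div_nonpos_of_nonpos_of_nonneg (neg_nonpos.2 (sq_nonneg _)) (by positivity)
    _ = ENNReal.ofReal ((√(2 * Real.pi * a))⁻¹ * √(Real.pi / 2)) := by
        rw [lintegral_const_mul' _ _ ENNReal.ofReal_ne_top,
          ← ofReal_integral_eq_lintegral_ofReal (integrable_exp_neg_mul_sq (by norm_num))
            (ae_of_all _ fun x => (Real.exp_pos _).le), integral_gaussian,
          ← ENNReal.ofReal_mul (by positivity)]
    _ ≤ _ := by
        refine ENNReal.ofReal_le_ofReal ?_
        have hpi := Real.pi_pos
        rw [mul_comm, ← div_eq_mul_inv, ← Real.sqrt_div (by positivity), ← Real.sqrt_inv]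
        refine Real.sqrt_le_sqrt ?_
        field_simp
        norm_num

end Gaussian

/-! ### Averaging over blocks of observations -/

section Deterministic

/-- By convexity of y ↦ y⁻², the inverse square of the mean block sum is at most the mean of the
R_b. Averaging, rather than taking the worst block, keeps the expectation of the resulting bound
independent of the number of blocks. -/
theorem inv_mean_le_of_blocks {m B n : ℕ} (hm : 0 < m) (hB : 0 < B) (h1 : B * m ≤ n)
    (h2 : n ≤ 2 * (B * m)) {a : ℕ → ℝ} (ha : ∀ i, 0 ≤ a i) {R : ℕ → ℝ}
    (hq : ∀ b < B, 0 < ∑ i ∈ range m, a (b * m + i))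
    (hR : ∀ b < B, (∑ i ∈ range m, a (b * m + i))⁻¹ ^ 2 ≤ R b) :
    (√((2 * m) ^ 2 * ((B : ℝ)⁻¹ * ∑ b ∈ range B, R b)))⁻¹ ≤ (n : ℝ)⁻¹ * ∑ i ∈ range n, a i := by
  have hB' : (0 : ℝ) < B := by exact_mod_cast hB
  have hm' : (0 : ℝ) < m := by exact_mod_cast hm
  have h2' : (n : ℝ) ≤ 2 * (B * m) := by exact_mod_cast h2
  have hn' : (0 : ℝ) < n := by
    have : (B * m : ℝ) ≤ n := by exact_mod_cast h1
    have : (0 : ℝ) < B * m := by positivity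
    linarith
  set q : ℕ → ℝ := fun b => ∑ i ∈ range m, a (b * m + i) with hqd
  have hsplit : ∀ B : ℕ, ∑ i ∈ range (B * m), a i = ∑ b ∈ range B, q b := by
    intro B
    induction B with
    | zero => simp
    | succ B ih => rw [Nat.succ_mul, sum_range_add, ih, sum_range_succ]
  have hsum : ∑ b ∈ range B, q b ≤ ∑ i ∈ range n, a i := by
    rw [← hsplit]
    exact sum_le_sum_of_subset_of_nonneg (range_subset_range.2 h1) fun i _ _ => ha i
  have hJ := Real.zpow_arith_mean_le_arith_mean_zpow (range B) (fun _ => (B : ℝ)⁻¹) q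
    (fun _ _ => by positivity) (by simp [hB'.ne']) (fun b hb => hq b (mem_range.1 hb)) (-2)
  rw [← mul_sum, ← mul_sum] at hJ
  set t := (B : ℝ)⁻¹ * ∑ b ∈ range B, q b with ht
  have ht0 : 0 < t := mul_pos (by positivity)
    (sum_pos (fun b hb => hq b (mem_range.1 hb)) ⟨0, mem_range.2 hB⟩)
  have hz : ∀ y : ℝ, y ^ (-2 : ℤ) = y⁻¹ ^ 2 := fun y => by
    rw [zpow_neg, inv_pow]; norm_cast
  simp only [hz] at hJ
  have hT : t⁻¹ ^ 2 ≤ (B : ℝ)⁻¹ * ∑ b ∈ range B, R b := hJ.trans <| by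
    gcongr with b hb
    exact hR b (mem_range.1 hb)
  have hl : (n : ℝ)⁻¹ * (B * t) ≤ (n : ℝ)⁻¹ * ∑ i ∈ range n, a i := by
    gcongr
    rwa [ht, ← mul_assoc, mul_inv_cancel₀ hB'.ne', one_mul]
  refine le_trans ?_ hl
  have hpos : 0 < t / (2 * m) := by positivity
  calc _ ≤ (√((2 * m) ^ 2 * t⁻¹ ^ 2))⁻¹ := by gcongr
    _ = t / (2 * m) := by
        rw [← mul_pow, Real.sqrt_sq (by positivity), mul_inv, inv_inv]; ring
    _ ≤ _ := by
        rw [div_le_iff₀ (by positivity), inv_mul_eq_div, div_mul_eq_mul_div, le_div_iff₀ hn']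
        nlinarith

end Deterministic

/-! ### Inverse quadratic forms, uniformly over unit vectors -/

section Weight

variable {H : Type*} [NormedAddCommGroup H] [InnerProductSpace ℝ H]
  {E : Type*} [NormedAddCommGroup E] [InnerProductSpace ℝ E] [FiniteDimensional ℝ E]
  [MeasurableSpace E] [BorelSpace E]

/-- The integrand of `invQuadBound`. -/
@[irreducible]
def quadWeight (L : E →L[ℝ] H) (τ : ℝ) (x : H) (v : E) : ℝ≥0∞ :=
  ENNReal.ofReal (Real.exp (2 * τ ^ 2 * ‖x‖ ^ 2 - inner ℝ x (L v) ^ 2))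

/-- A bound for the squared inverse of the quadratic form `v ↦ ∑_{i < m} ⟨x_i, L v⟩²` on unit
vectors, in the form of an integral whose expectation can be computed. -/
@[irreducible]
def invQuadBound (L : E →L[ℝ] H) (τ : ℝ) (m : ℕ) (x : ℕ → H) : ℝ≥0∞ :=
  ENNReal.ofReal (Real.exp 2) * (volume (Metric.ball (0 : E) τ))⁻¹ *
    ∫⁻ v : E, ENNReal.ofReal ((1 + ‖v‖) ^ 4) * ∏ i ∈ range m, quadWeight L τ (x i) v

/-- The form is at most 1 at s u, and for v within τ of s u one has ⟨x_i, L v⟩² ≤ 2 s² ⟨x_i, L u⟩² +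
2 τ² ‖x_i‖². The weight compensates the last summand, so the product of the weights is at least
exp(-2) on this ball, while τ ≤ 1 gives s ≤ 1 + ‖v‖. Integrating over the ball alone yields the
bound, whose right-hand side does not depend on u. -/
theorem ofReal_pow_four_le_invQuadBound {L : E →L[ℝ] H} (hL : ∀ v, ‖L v‖ ≤ ‖v‖) {τ : ℝ}
    (hτ : 0 < τ) (hτ1 : τ ≤ 1) {m : ℕ} {x : ℕ → H} {u : E} (hu : ‖u‖ = 1) {s : ℝ} (hs : 0 < s)
    (hq : s ^ 2 * ∑ i ∈ range m, inner ℝ (x i) (L u) ^ 2 ≤ 1) :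
    ENNReal.ofReal (s ^ 4) ≤ invQuadBound L τ m x := by
  have hvol0 : volume (Metric.ball (0 : E) τ) ≠ 0 := (Metric.measure_ball_pos _ _ hτ).ne'
  have hvolt : volume (Metric.ball (0 : E) τ) ≠ ⊤ := measure_ball_lt_top.ne
  have hpt : ∀ v ∈ Metric.ball (s • u) τ, ENNReal.ofReal (s ^ 4 * Real.exp (-2))
      ≤ ENNReal.ofReal ((1 + ‖v‖) ^ 4) * ∏ i ∈ range m, quadWeight L τ (x i) v := by
    intro v hv
    set z := v - s • u with hz
    have hzτ : ‖z‖ ≤ τ := by rw [hz, ← dist_eq_norm]; exact (Metric.mem_ball.1 hv).le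
    have hvz : v = s • u + z := by rw [hz]; abel
    have hnorm : s ≤ 1 + ‖v‖ := by
      have h1 : s = ‖s • u‖ := by rw [norm_smul, hu, Real.norm_of_nonneg hs.le, mul_one]
      have h2 : s • u = v - z := by rw [hz]; abel
      have h3 := norm_sub_le v z
      rw [← h2, ← h1] at h3
      linarith
    simp only [quadWeight]
    rw [← ENNReal.ofReal_prod_of_nonneg fun i _ => (Real.exp_pos _).le, ← Real.exp_sum,
      ← ENNReal.ofReal_mul (by positivity)]
    refine ENNReal.ofReal_le_ofReal ?_
    have hi : ∀ i, -2 * (s ^ 2 * inner ℝ (x i) (L u) ^ 2)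
        ≤ 2 * τ ^ 2 * ‖x i‖ ^ 2 - inner ℝ (x i) (L v) ^ 2 := fun i => by
      have h1 : |inner ℝ (x i) (L z)| ≤ ‖x i‖ * τ :=
        (abs_real_inner_le_norm _ _).trans (by gcongr; exact (hL z).trans hzτ)
      have h2 : inner ℝ (x i) (L z) ^ 2 ≤ (‖x i‖ * τ) ^ 2 := sq_le_sq' (abs_le.1 h1).1 (abs_le.1 h1).2
      rw [hvz, map_add, map_smul, inner_add_right, real_inner_smul_right]
      nlinarith [sq_nonneg (s * inner ℝ (x i) (L u) - inner ℝ (x i) (L z))]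
    gcongr
    calc (-2 : ℝ) ≤ -2 * (s ^ 2 * ∑ i ∈ range m, inner ℝ (x i) (L u) ^ 2) := by linarith
      _ = ∑ i ∈ range m, -2 * (s ^ 2 * inner ℝ (x i) (L u) ^ 2) := by rw [mul_sum, mul_sum]
      _ ≤ _ := sum_le_sum fun i _ => hi i
  have hint : ENNReal.ofReal (s ^ 4 * Real.exp (-2)) * volume (Metric.ball (0 : E) τ)
      ≤ ∫⁻ v : E, ENNReal.ofReal ((1 + ‖v‖) ^ 4) * ∏ i ∈ range m, quadWeight L τ (x i) v := by
    rw [← Measure.addHaar_ball_center volume (s • u), ← setLIntegral_const]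
    exact (setLIntegral_mono' measurableSet_ball hpt).trans (setLIntegral_le_lintegral _ _)
  calc ENNReal.ofReal (s ^ 4)
      = ENNReal.ofReal (Real.exp 2) * (volume (Metric.ball (0 : E) τ))⁻¹ *
        (ENNReal.ofReal (s ^ 4 * Real.exp (-2)) * volume (Metric.ball (0 : E) τ)) := by
        rw [mul_mul_mul_comm, ← ENNReal.ofReal_mul (by positivity),
          ENNReal.inv_mul_cancel hvol0 hvolt, mul_one]
        congr 1
        rw [mul_left_comm, ← Real.exp_add]
        simp
    _ ≤ _ := by unfold invQuadBound; gcongr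

/-- The defining property of `invQuadBound`. -/
theorem inv_sq_le_invQuadBound {L : E →L[ℝ] H} (hL : ∀ v, ‖L v‖ ≤ ‖v‖) {τ : ℝ}
    (hτ : 0 < τ) (hτ1 : τ ≤ 1) {m : ℕ} {x : ℕ → H} (hfin : invQuadBound L τ m x ≠ ⊤) {u : E}
    (hu : ‖u‖ = 1) :
    0 < ∑ i ∈ range m, inner ℝ (x i) (L u) ^ 2 ∧
      (∑ i ∈ range m, inner ℝ (x i) (L u) ^ 2)⁻¹ ^ 2 ≤ (invQuadBound L τ m x).toReal := by
  set q := ∑ i ∈ range m, inner ℝ (x i) (L u) ^ 2 with hq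
  have hq0 : 0 ≤ q := sum_nonneg fun i _ => sq_nonneg _
  have key : ∀ s : ℝ, 0 < s → s ^ 2 * q ≤ 1 → s ^ 4 ≤ (invQuadBound L τ m x).toReal :=
    fun s hs hsq => (ENNReal.ofReal_le_iff_le_toReal hfin).1
      (ofReal_pow_four_le_invQuadBound hL hτ hτ1 hu hs hsq)
  -- If q vanished, every s would be admissible and the bound infinite. Otherwise s = q^(-1/2) is
  -- the largest admissible choice.
  have hpos : 0 < q := by
    refine lt_of_le_of_ne hq0 fun h0 => ?_
    set T := (invQuadBound L τ m x).toReal with hT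
    have hT0 : 0 ≤ T := ENNReal.toReal_nonneg
    have := key (T + 1) (by linarith) (by rw [← h0]; simp)
    nlinarith [pow_le_pow_right₀ (show (1 : ℝ) ≤ T + 1 by linarith) (show 1 ≤ 4 by norm_num)]
  refine ⟨hpos, ?_⟩
  have hsq : (√q)⁻¹ ^ 2 = q⁻¹ := by rw [inv_pow, Real.sq_sqrt hq0]
  have := key (√q)⁻¹ (by positivity) (by rw [hsq, inv_mul_cancel₀ hpos.ne'])
  rwa [show (√q)⁻¹ ^ 4 = ((√q)⁻¹ ^ 2) ^ 2 by ring, hsq] at this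

theorem measurable_invQuadBound [CompleteSpace H] [MeasurableSpace H] [BorelSpace H]
    [SecondCountableTopology H] (L : E →L[ℝ] H) (τ : ℝ) (m : ℕ) :
    Measurable (invQuadBound L τ m) := by
  have : Measurable fun p : (ℕ → H) × E =>
      ENNReal.ofReal ((1 + ‖p.2‖) ^ 4) * ∏ i ∈ range m, quadWeight L τ (p.1 i) p.2 := by
    unfold quadWeight
    fun_prop
  unfold invQuadBound
  exact this.lintegral_prod_right'.const_mul _

end Weight

/-! ### Expectation of the bound and inverse empirical eigenvalues -/

section Sample

variable {Ω : Type*} [MeasurableSpace Ω]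
  {H : Type*} [NormedAddCommGroup H] [InnerProductSpace ℝ H] [CompleteSpace H]
  [MeasurableSpace H] [BorelSpace H] [SecondCountableTopology H]
  {P : Measure Ω} [IsProbabilityMeasure P] {K : H →L[ℝ] H}
  {X : ℕ → Ω → H}

namespace IsGaussianSample

variable (h : IsGaussianSample P K X)
include h

section Weight

variable {E : Type*} [NormedAddCommGroup E] [InnerProductSpace ℝ E] [FiniteDimensional ℝ E]
  [MeasurableSpace E] [BorelSpace E] {L : E →L[ℝ] H}

/-- ⟨X_i, L v⟩ is normal with variance at least κ ‖v‖², which gives decay of order ‖v‖⁻¹. The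
trivial bound 1 takes care of ‖v‖ < 1. -/
theorem lintegral_exp_neg_inner_sq_le {κ : ℝ} (hκ : 0 < κ)
    (hK : ∀ v, κ * ‖v‖ ^ 2 ≤ inner ℝ (K (L v)) (L v)) (i : ℕ) (v : E) :
    ∫⁻ ω, ENNReal.ofReal (Real.exp (-2 * inner ℝ (X i ω) (L v) ^ 2)) ∂P
      ≤ ENNReal.ofReal ((2 + 2 * (√κ)⁻¹) / (1 + ‖v‖)) := by
  have hs : 0 < √κ := Real.sqrt_pos.2 hκ
  rcases lt_or_ge ‖v‖ 1 with hv | hv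
  · calc _ ≤ ∫⁻ _, 1 ∂P := lintegral_mono fun ω => by
            rw [← ENNReal.ofReal_one]
            refine ENNReal.ofReal_le_ofReal (Real.exp_le_one_iff.2 ?_)
            nlinarith [sq_nonneg (inner ℝ (X i ω) (L v))]
      _ = ENNReal.ofReal 1 := by simp
      _ ≤ _ := by
          refine ENNReal.ofReal_le_ofReal ((one_le_div (by positivity)).2 ?_)
          have : 0 < (√κ)⁻¹ := by positivity
          linarith
  · have hv0 : 0 < ‖v‖ := by linarith
    have ha : 0 < inner ℝ (K (L v)) (L v) := lt_of_lt_of_le (by positivity) (hK v)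
    refine ((h.inner_gaussian i (L v)).lintegral_exp_neg_sq_le (h.inner_centered i _) ha
      (h.inner_variance i _)).trans (ENNReal.ofReal_le_ofReal ?_)
    calc (√(inner ℝ (K (L v)) (L v)))⁻¹ ≤ (√(κ * ‖v‖ ^ 2))⁻¹ := by
          gcongr
          exact hK v
      _ = (√κ)⁻¹ / ‖v‖ := by
          rw [Real.sqrt_mul hκ.le, Real.sqrt_sq hv0.le, mul_inv, div_eq_mul_inv]
      _ ≤ 2 * (√κ)⁻¹ / (1 + ‖v‖) := by
          rw [div_le_div_iff₀ hv0 (by positivity)]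
          have : 0 < (√κ)⁻¹ := by positivity
          nlinarith
      _ ≤ _ := by gcongr; linarith

/-- Cauchy-Schwarz separates the growing factor exp(2 τ² ‖X‖²) from the decaying one. The former has
a finite second moment by Fernique's theorem once 4 τ² ≤ c; the separation halves the power of
decay, hence the square root. -/
theorem exists_lintegral_quadWeight_le {κ : ℝ} (hκ : 0 < κ)
    (hK : ∀ v, κ * ‖v‖ ^ 2 ≤ inner ℝ (K (L v)) (L v)) :
    ∃ τ : ℝ, 0 < τ ∧ τ ≤ 1 ∧ ∃ C > 0, ∀ (i : ℕ) (v : E),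
      ∫⁻ ω, quadWeight L τ (X i ω) v ∂P ≤ ENNReal.ofReal √(C / (1 + ‖v‖)) := by
  have hgauss : IsGaussian (P.map (X 0)) := (h.gaussian 0).isGaussian_map
  obtain ⟨c, hc, hint⟩ := IsGaussian.exists_integrable_exp_sq (P.map (X 0))
  set A := ∫ x, Real.exp (c * ‖x‖ ^ 2) ∂(P.map (X 0)) with hA
  have hA0 : 0 ≤ A := integral_nonneg fun x => (Real.exp_pos _).le
  have hs : 0 < √κ := Real.sqrt_pos.2 hκ
  have hτ2 : min 1 √(c / 4) ^ 2 ≤ c / 4 := by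
    calc min 1 √(c / 4) ^ 2 ≤ √(c / 4) ^ 2 := by gcongr; exact min_le_right _ _
      _ = c / 4 := Real.sq_sqrt (by positivity)
  refine ⟨min 1 √(c / 4), by positivity, min_le_left _ _, (A + 1) * (2 + 2 * (√κ)⁻¹),
    by positivity, fun i v => ?_⟩
  set τ := min 1 √(c / 4) with hτ
  set C₁ := 2 + 2 * (√κ)⁻¹ with hC₁
  have hC₁0 : 0 < C₁ := by positivity
  have e : ∀ ω, quadWeight L τ (X i ω) v = ENNReal.ofReal (Real.exp (2 * τ ^ 2 * ‖X i ω‖ ^ 2)) *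
      ENNReal.ofReal (Real.exp (-inner ℝ (X i ω) (L v) ^ 2)) := fun ω => by
    rw [← ENNReal.ofReal_mul (Real.exp_pos _).le, ← Real.exp_add, quadWeight, sub_eq_add_neg]
  simp only [e]
  have hXi := h.measurable i
  have key := lintegral_mul_le_of_sq_le (P := P)
    (f := fun ω => ENNReal.ofReal (Real.exp (2 * τ ^ 2 * ‖X i ω‖ ^ 2)))
    (g := fun ω => ENNReal.ofReal (Real.exp (-inner ℝ (X i ω) (L v) ^ 2)))
    (A := ENNReal.ofReal √(A + 1)) (B := ENNReal.ofReal √(C₁ / (1 + ‖v‖)))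
    (by fun_prop) (by fun_prop) ?_ ?_
  · refine key.trans (le_of_eq ?_)
    rw [← ENNReal.ofReal_mul (by positivity), ← Real.sqrt_mul (by positivity), mul_div_assoc]
  · rw [← ENNReal.ofReal_pow (by positivity), Real.sq_sqrt (by positivity)]
    calc _ ≤ ∫⁻ ω, ENNReal.ofReal (Real.exp (c * ‖X i ω‖ ^ 2)) ∂P := by
          refine lintegral_mono fun ω => ?_
          rw [← ENNReal.ofReal_pow (Real.exp_pos _).le, ← Real.exp_nat_mul]
          refine ENNReal.ofReal_le_ofReal (Real.exp_le_exp.2 ?_)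
          push_cast
          nlinarith [sq_nonneg ‖X i ω‖]
      _ = ∫⁻ x, ENNReal.ofReal (Real.exp (c * ‖x‖ ^ 2)) ∂(P.map (X i)) := by
          rw [lintegral_map (by fun_prop) hXi]
      _ = ENNReal.ofReal A := by
          rw [(h.ident i).map_eq, hA,
            ofReal_integral_eq_lintegral_ofReal hint (ae_of_all _ fun x => (Real.exp_pos _).le)]
      _ ≤ _ := ENNReal.ofReal_le_ofReal (by linarith)
  · rw [← ENNReal.ofReal_pow (by positivity), Real.sq_sqrt (by positivity)]
    refine (le_of_eq ?_).trans (h.lintegral_exp_neg_inner_sq_le hκ hK i v)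
    refine lintegral_congr fun ω => ?_
    rw [← ENNReal.ofReal_pow (Real.exp_pos _).le, ← Real.exp_nat_mul]
    congr 2
    push_cast; ring

set_option maxHeartbeats 1000000 in
-- By Tonelli and independence, the expectation is an integral of (1 + ‖v‖)⁴ times m factors of
-- order (1 + ‖v‖)^(-1/2). With m = 2 (d + 5) the integrand decays like (1 + ‖v‖)^(-(d + 1)), which
-- is integrable in dimension d. The injection `g` allows any block of the sample.
theorem exists_lintegral_invQuadBound_le {κ : ℝ} (hκ : 0 < κ)
    (hK : ∀ v, κ * ‖v‖ ^ 2 ≤ inner ℝ (K (L v)) (L v)) :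
    ∃ τ : ℝ, 0 < τ ∧ τ ≤ 1 ∧ ∃ m > 0, ∃ C > 0, ∀ g : ℕ → ℕ, g.Injective →
      ∫⁻ ω, invQuadBound L τ m (fun i => X (g i) ω) ∂P ≤ ENNReal.ofReal C := by
  obtain ⟨τ, hτ, hτ1, C₀, hC₀, hw⟩ := h.exists_lintegral_quadWeight_le hκ hK
  set d := Module.finrank ℝ E with hd
  set c := ENNReal.ofReal (Real.exp 2) * (volume (Metric.ball (0 : E) τ))⁻¹ with hc
  have hct : c ≠ ⊤ := ENNReal.mul_ne_top ENNReal.ofReal_ne_top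
    (ENNReal.inv_ne_top.2 (Metric.measure_ball_pos _ _ hτ).ne')
  have hfin := finite_integral_one_add_norm (E := E) (μ := volume) (r := (d : ℝ) + 1)
    (by rw [hd]; linarith)
  set J := ∫⁻ v : E, ENNReal.ofReal ((1 + ‖v‖) ^ (-((d : ℝ) + 1))) with hJ
  have hT : c * (ENNReal.ofReal (C₀ ^ (d + 5)) * J) ≠ ⊤ :=
    ENNReal.mul_ne_top hct (ENNReal.mul_ne_top ENNReal.ofReal_ne_top hfin.ne)
  refine ⟨τ, hτ, hτ1, 2 * (d + 5), by positivity,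
    (c * (ENNReal.ofReal (C₀ ^ (d + 5)) * J)).toReal + 1, by positivity, fun g hg => ?_⟩
  set m := 2 * (d + 5) with hm
  have hwm : Measurable fun p : H × E => quadWeight L τ p.1 p.2 := by
    unfold quadWeight; fun_prop
  have hmeas : Measurable fun p : Ω × E =>
      ENNReal.ofReal ((1 + ‖p.2‖) ^ 4) * ∏ i ∈ range m, quadWeight L τ (X (g i) p.1) p.2 := by
    have hi : ∀ i, Measurable fun p : Ω × E => quadWeight L τ (X (g i) p.1) p.2 := fun i => by
      have h1 : Measurable fun p : Ω × E => (X (g i) p.1, p.2) :=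
        ((h.measurable (g i)).comp measurable_fst).prodMk measurable_snd
      exact hwm.comp h1
    clear_value m
    fun_prop
  have hprod : ∀ v : E, ∫⁻ ω, ENNReal.ofReal ((1 + ‖v‖) ^ 4) *
      ∏ i ∈ range m, quadWeight L τ (X (g i) ω) v ∂P
        ≤ ENNReal.ofReal (C₀ ^ (d + 5)) * ENNReal.ofReal ((1 + ‖v‖) ^ (-((d : ℝ) + 1))) := by
    intro v
    have hv : 0 < 1 + ‖v‖ := by positivity
    have hwv : Measurable fun x : H => quadWeight L τ x v := by unfold quadWeight; fun_prop
    have hind : iIndepFun (fun i ω => quadWeight L τ (X (g i) ω) v) P :=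
      (h.indep.precomp hg).comp (fun _ x => quadWeight L τ x v) fun _ => hwv
    rw [lintegral_const_mul' _ _ ENNReal.ofReal_ne_top,
      lintegral_prod_eq_prod_lintegral_of_indepFun _ _ hind fun i => hwv.comp (h.measurable _)]
    calc _ ≤ ENNReal.ofReal ((1 + ‖v‖) ^ 4) *
          ∏ _i ∈ range m, ENNReal.ofReal √(C₀ / (1 + ‖v‖)) := by
          gcongr with i _
          exact hw (g i) v
      _ = ENNReal.ofReal ((1 + ‖v‖) ^ 4 * (C₀ / (1 + ‖v‖)) ^ (d + 5)) := by
          rw [prod_const, card_range, ← ENNReal.ofReal_pow (by positivity),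
            ← ENNReal.ofReal_mul (by positivity), hm, pow_mul, Real.sq_sqrt (by positivity)]
      _ = _ := by
          rw [← ENNReal.ofReal_mul (by positivity), Real.rpow_neg hv.le,
            show ((d : ℝ) + 1) = ((d + 1 : ℕ) : ℝ) by push_cast; rfl, Real.rpow_natCast]
          congr 1
          rw [div_pow, show d + 5 = 4 + (d + 1) by ring, pow_add (1 + ‖v‖)]
          field_simp
  calc ∫⁻ ω, invQuadBound L τ m (fun i => X (g i) ω) ∂P
      = c * ∫⁻ v : E, ∫⁻ ω, ENNReal.ofReal ((1 + ‖v‖) ^ 4) *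
          ∏ i ∈ range m, quadWeight L τ (X (g i) ω) v ∂P := by
        simp only [invQuadBound]
        rw [lintegral_const_mul' _ _ hct, lintegral_lintegral_swap]
        exact hmeas.aemeasurable
    _ ≤ c * (ENNReal.ofReal (C₀ ^ (d + 5)) * J) := by
        gcongr
        rw [hJ, ← lintegral_const_mul' _ _ ENNReal.ofReal_ne_top]
        exact lintegral_mono hprod
    _ ≤ _ := by
        rw [← ENNReal.ofReal_toReal hT]
        exact ENNReal.ofReal_le_ofReal (by rw [ENNReal.toReal_ofReal]; · linarith
                                           · exact ENNReal.toReal_nonneg)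

end Weight

set_option maxHeartbeats 1000000 in
/-- The inverses of the leading empirical eigenvalues have bounded second moments, through a bound
that depends on the design only. -/
theorem exists_inv_eigenvalue_bound {φ : HilbertBasis ℕ ℝ H} {lam : ℕ → ℝ} (hpos : ∀ j, 0 < lam j)
    (hanti : Antitone lam) (heig : ∀ j, K (φ j) = lam j • φ j) (r : ℕ) :
    ∃ C > 0, ∃ N, ∀ n ≥ N, ∃ ℓ : (ℕ → H) → ℝ, Measurable ℓ ∧ (∀ x, 0 ≤ ℓ x) ∧
      ∫⁻ ω, ENNReal.ofReal (ℓ fun i => X i ω) ^ 2 ∂P ≤ ENNReal.ofReal C ∧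
      ∀ᵐ ω ∂P, ∀ l f, IsEmpEigenSystem n (fun i => X i ω) l f →
        ∀ j < r, 0 < l j ∧ (l j)⁻¹ ≤ ℓ fun i => X i ω := by
  rcases r with _ | k
  · exact ⟨1, one_pos, 0, fun n _ => ⟨fun _ => 0, measurable_const, fun _ => le_rfl, by simp,
      ae_of_all _ fun ω l f _ j hj => absurd hj (Nat.not_lt_zero j)⟩⟩
  -- The isometry onto the span of the first k + 1 true eigenvectors, where the form of K is at
  -- least lam k.
  set L : EuclideanSpace ℝ (Fin (k + 1)) →L[ℝ] H :=
    ∑ i : Fin (k + 1), (EuclideanSpace.proj i).smulRight (φ i) with hLdef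
  have hLa : ∀ v, L v = ∑ i : Fin (k + 1), v i • φ i := fun v => by
    simp [hLdef]
  have hφ' : Orthonormal ℝ fun i : Fin (k + 1) => φ i :=
    φ.orthonormal.comp _ Fin.val_injective
  have hL : ∀ v, ‖L v‖ = ‖v‖ := fun v => by
    have : ‖L v‖ ^ 2 = ‖v‖ ^ 2 := by
      rw [← real_inner_self_eq_norm_sq, hLa, hφ'.inner_sum, EuclideanSpace.norm_sq_eq]
      simp [sq]
    exact (sq_eq_sq₀ (norm_nonneg _) (norm_nonneg _)).1 this
  have hKL : ∀ v, lam k * ‖v‖ ^ 2 ≤ inner ℝ (K (L v)) (L v) := fun v => by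
    have e : K (L v) = ∑ i : Fin (k + 1), (v i * lam i) • φ i := by
      simp only [hLa, map_sum, map_smul, heig, smul_smul]
    rw [e, hLa, hφ'.inner_sum, EuclideanSpace.norm_sq_eq, mul_sum]
    refine sum_le_sum fun i _ => ?_
    have := hanti (Nat.lt_succ_iff.1 i.2)
    simp only [Real.norm_eq_abs, sq_abs, conj_trivial]
    nlinarith [sq_nonneg (v i)]
  obtain ⟨τ, hτ, hτ1, m, hm, D, hD, hbd⟩ := h.exists_lintegral_invQuadBound_le (hpos k) hKL
  have hm' : (0 : ℝ) < m := by exact_mod_cast hm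
  refine ⟨(2 * m) ^ 2 * D, by positivity, m, fun n hn => ?_⟩
  -- The sample is cut into B disjoint blocks of length m. Fewer than m observations are left over,
  -- whence n ≤ 2 B m.
  set B := n / m with hB
  have hB0 : 0 < B := Nat.div_pos hn hm
  have hB' : (0 : ℝ) < B := by exact_mod_cast hB0
  have hBm : B * m ≤ n := Nat.div_mul_le_self n m
  have hBm2 : n ≤ 2 * (B * m) := by
    have h1 := Nat.lt_div_mul_add (a := n) hm
    rw [← hB] at h1
    have h2 : m ≤ B * m := Nat.le_mul_of_pos_left _ hB0
    omega
  set R : ℕ → (ℕ → H) → ℝ≥0∞ := fun b x => invQuadBound L τ m fun i => x (b * m + i) with hR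
  have hRm : ∀ b, Measurable (R b) := fun b =>
    (measurable_invQuadBound L τ m).comp (measurable_pi_lambda _ fun i => measurable_pi_apply _)
  have hRint : ∀ b, ∫⁻ ω, R b (fun i => X i ω) ∂P ≤ ENNReal.ofReal D := fun b =>
    hbd (fun i => b * m + i) (add_right_injective _)
  set ℓ : (ℕ → H) → ℝ := fun x => √((2 * m) ^ 2 * ((B : ℝ)⁻¹ * ∑ b ∈ range B, (R b x).toReal))
    with hℓ
  refine ⟨ℓ, ?_, fun x => Real.sqrt_nonneg _, ?_, ?_⟩
  · have : ∀ b, Measurable fun x => (R b x).toReal := fun b => (hRm b).ennreal_toReal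
    fun_prop
  · have hp : ∀ x, ENNReal.ofReal (ℓ x) ^ 2
        ≤ ENNReal.ofReal ((2 * m) ^ 2 * (B : ℝ)⁻¹) * ∑ b ∈ range B, R b x := fun x => by
      rw [hℓ, ← ENNReal.ofReal_pow (Real.sqrt_nonneg _), Real.sq_sqrt (by positivity),
        ← mul_assoc, ENNReal.ofReal_mul (by positivity),
        ENNReal.ofReal_sum_of_nonneg fun _ _ => ENNReal.toReal_nonneg]
      gcongr
      exact ENNReal.ofReal_toReal_le
    have hRX : ∀ b, Measurable fun ω => R b fun i => X i ω := fun b =>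
      (hRm b).comp h.measurable_data
    refine (lintegral_mono fun ω => hp fun i => X i ω).trans ?_
    rw [lintegral_const_mul' _ _ ENNReal.ofReal_ne_top,
      lintegral_finsetSum' _ fun b _ => (hRX b).aemeasurable]
    refine (mul_le_mul_right (Finset.sum_le_sum fun b _ => hRint b) _).trans (le_of_eq ?_)
    rw [sum_const, card_range, nsmul_eq_mul, ← ENNReal.ofReal_natCast,
      ← ENNReal.ofReal_mul (by positivity), ← ENNReal.ofReal_mul (by positivity)]
    congr 1
    field_simp
  · have hfin : ∀ᵐ ω ∂P, ∀ b, R b (fun i => X i ω) < ⊤ := ae_all_iff.2 fun b =>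
      ae_lt_top' ((hRm b).comp h.measurable_data).aemeasurable
        ((hRint b).trans_lt ENNReal.ofReal_lt_top).ne
    filter_upwards [hfin] with ω hω l f hlf j hj
    set x : ℕ → H := fun i => X i ω with hx
    have hq : ∀ u : EuclideanSpace ℝ (Fin (k + 1)), ‖u‖ = 1 → ∀ b < B,
        0 < ∑ i ∈ range m, inner ℝ (x (b * m + i)) (L u) ^ 2 ∧
        (∑ i ∈ range m, inner ℝ (x (b * m + i)) (L u) ^ 2)⁻¹ ^ 2 ≤ (R b x).toReal :=
      fun u hu b _ => inv_sq_le_invQuadBound (x := fun i => x (b * m + i)) (fun v => (hL v).le)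
        hτ hτ1 (hω b).ne hu
    have hℓ0 : 0 < ℓ x := by
      refine Real.sqrt_pos.2 (mul_pos (by positivity) (mul_pos (by positivity) ?_))
      have hu : ‖(EuclideanSpace.single (0 : Fin (k + 1)) (1 : ℝ))‖ = 1 := by simp
      refine sum_pos (fun b hb => ?_) ⟨0, mem_range.2 hB0⟩
      obtain ⟨h1, h2⟩ := hq _ hu b (mem_range.1 hb)
      exact lt_of_lt_of_le (by positivity) h2
    -- The bound ℓ does not involve the direction, so it bounds the empirical form from below on all
    -- unit vectors of the span at once, as the min-max argument requires.
    have hk : (ℓ x)⁻¹ ≤ l k := by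
      refine hlf.le_eigenvalue φ.orthonormal fun c hc => ?_
      set u : EuclideanSpace ℝ (Fin (k + 1)) := WithLp.toLp 2 c with hu
      have hun : ‖u‖ = 1 := by
        rw [EuclideanSpace.norm_eq, hu]
        simp [hc]
      have hLu : ∑ i : Fin (k + 1), c i • φ i = L u := by rw [hLa]
      rw [hLu, inner_empCov]
      simp only [← sq]
      exact inv_mean_le_of_blocks (a := fun i => inner ℝ (x i) (L u) ^ 2) hm hB0 hBm hBm2
        (fun i => sq_nonneg _) (fun b hb => (hq u hun b hb).1) fun b hb => (hq u hun b hb).2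
    have hlj : l k ≤ l j := hlf.antitone (Nat.lt_succ_iff.1 hj)
    have hlk : 0 < (ℓ x)⁻¹ := by positivity
    exact ⟨by linarith, inv_le_of_inv_le₀ hℓ0 (hk.trans hlj)⟩

end IsGaussianSample

end Sample

/-! ### Pathwise comparison of the estimators with their oracle versions -/

section Pathwise

variable {H : Type*} [NormedAddCommGroup H] [InnerProductSpace ℝ H] [CompleteSpace H]

theorem tikhonov_eq (n : ℕ) (ρ : ℝ) (x : ℕ → H) (y : ℕ → ℝ) :
    tikhonov n ρ x y = ridgeInv (empCov n x) ρ (empCrossCov n y x) := rfl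

theorem oracleTikhonov_eq (K : H →L[ℝ] H) (n : ℕ) (ρ : ℝ) (x : ℕ → H) (y : ℕ → ℝ) :
    oracleTikhonov K n ρ x y = ridgeInv K ρ (empCrossCov n y x) := rfl

variable {K : H →L[ℝ] H} (hK : K.IsPositive) {ρ : ℝ} (hρ : 0 < ρ) {n : ℕ} (hn : n ≠ 0)
  (a : ℝ) (β : H) (x : ℕ → H) (e : ℕ → ℝ)
include hK hρ hn

theorem norm_tikhonov_sub_oracleTikhonov_le :
    ‖tikhonov n ρ x (fun i => a + inner ℝ (x i) β + e i)
        - oracleTikhonov K n ρ x (fun i => a + inner ℝ (x i) β + e i)‖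
      ≤ tikErr K ρ n β x e := by
  rw [tikhonov_eq, oracleTikhonov_eq]
  refine norm_ridgeInv_sub_ridgeInv_le hK hρ (empCov_isPositive n x) ?_
  rw [empCrossCov_response_eq hn K, map_add]

/-- R K β = β - ρ R β splits the error into its stochastic part and the bias. -/
theorem oracleTikhonov_sub :
    oracleTikhonov K n ρ x (fun i => a + inner ℝ (x i) β + e i) - β
      = ridgeInv K ρ (crossCovError K n β x e) - ρ • ridgeInv K ρ β := by
  rw [oracleTikhonov_eq, empCrossCov_response_eq hn K, map_add, ridgeInv_apply hK hρ]
  abel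

theorem norm_oracleTikhonov_le :
    ‖oracleTikhonov K n ρ x (fun i => a + inner ℝ (x i) β + e i)‖
      ≤ 2 * ‖β‖ + tikErr K ρ n β x e := by
  have h1 := oracleTikhonov_sub hK hρ hn a β x e
  rw [sub_eq_iff_eq_add] at h1
  rw [h1]
  have h2 := norm_ridgeInv_crossCovError_le K hρ n β x e
  have h3 := norm_smul_ridgeInv_apply_le hK hρ β
  refine (norm_add_le _ _).trans ?_
  have h4 := norm_sub_le (ridgeInv K ρ (crossCovError K n β x e)) (ρ • ridgeInv K ρ β)
  linarith

theorem norm_tikhonov_le :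
    ‖tikhonov n ρ x (fun i => a + inner ℝ (x i) β + e i)‖
      ≤ 2 * ‖β‖ + 2 * tikErr K ρ n β x e := by
  have h1 := norm_tikhonov_sub_oracleTikhonov_le hK hρ hn a β x e
  have h2 := norm_oracleTikhonov_le hK hρ hn a β x e
  have h3 := norm_sub_norm_le (tikhonov n ρ x (fun i => a + inner ℝ (x i) β + e i))
    (oracleTikhonov K n ρ x (fun i => a + inner ℝ (x i) β + e i))
  linarith

omit hK in
/-- The contribution of the first empirical eigendirections, bounded without reference to the
true eigenvectors. -/
theorem norm_smul_diagOp_inv_tikhonov_le {l : ℕ → ℝ} {f : ℕ → H} (h : IsEmpEigenSystem n x l f)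
    {r : ℕ} {ℓ : ℝ} (hℓ : ∀ j < r, (l j)⁻¹ ≤ ℓ) :
    ‖ρ • diagOp r l⁻¹ f (tikhonov n ρ x fun i => a + inner ℝ (x i) β + e i)‖
      ≤ r * ‖β‖ + |inner ℝ (sampleMean n x) β| * (r * √ℓ)
        + r * √(ℓ * ((n : ℝ)⁻¹ * ∑ i ∈ range n, e i ^ 2)) := by
  -- The partial inverse commutes with the empirical covariance, hence with R̂, and ρ R̂ is a
  -- contraction. The inverse eigenvalues then act directly on the cross-covariance, each part of
  -- which cancels them wholly or by half.
  have hcomm : ∀ z, empCov n x (diagOp r l⁻¹ f z) = diagOp r l⁻¹ f (empCov n x z) := fun z => by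
    simp only [diagOp_apply, map_sum, map_smul, h.apply]
    refine sum_congr rfl fun j _ => ?_
    rw [← (empCov_isPositive n x).inner_left_eq_inner_right, h.apply, real_inner_smul_left,
      smul_smul]
    congr 1; ring
  rw [tikhonov_eq, ← ridgeInv_commute (empCov_isPositive n x) hρ hcomm]
  refine (norm_smul_ridgeInv_apply_le (empCov_isPositive n x) hρ _).trans ?_
  rw [empCrossCov_response hn, map_add, map_sub, map_smul]
  refine (norm_add_le _ _).trans (add_le_add ((norm_sub_le _ _).trans (add_le_add ?_ ?_)) ?_)
  · exact h.norm_diagOp_inv_empCov_le r β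
  · rw [norm_smul, Real.norm_eq_abs]
    gcongr
    exact h.norm_diagOp_inv_sampleMean_le hℓ
  · exact h.norm_diagOp_inv_noiseTerm_le hℓ e

end Pathwise

/-! ### Distance of the regularised estimators to their oracles and to the slope -/

section Regularised

variable {H : Type*} [NormedAddCommGroup H] [InnerProductSpace ℝ H] [CompleteSpace H]

/-- The bound for the distance of the hybrid estimator to its oracle version, where `ℓ` dominates
the inverses of the leading empirical eigenvalues. -/
def hybErr (K : H →L[ℝ] H) (ρ : ℝ) (n : ℕ) (β : H) (ℓ : ℝ) (x : ℕ → H) (e : ℕ → ℝ) : ℝ :=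
  tikErr K ρ n β x e + ‖K - empCov n x‖ + |inner ℝ (sampleMean n x) β| * √ℓ
    + ‖K - empCov n x‖ * √(ℓ * ((n : ℝ)⁻¹ * ∑ i ∈ range n, e i ^ 2))

/-- If ‖K - K̂‖ ≤ δ, the perturbation of the partial inverse is linear in ‖K - K̂‖. Otherwise the
two corrections are bounded separately and ‖K - K̂‖ / δ ≥ 1 is inserted in the terms that need not
be small on average; no estimate for the probability of this event is required. -/
theorem exists_norm_hybrid_sub_le {K : H →L[ℝ] H} (hK : K.IsPositive) (φ : HilbertBasis ℕ ℝ H)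
    {lam : ℕ → ℝ} (hlam : StrictAnti lam) (hpos : ∀ j, 0 < lam j)
    (heig : ∀ j, K (φ j) = lam j • φ j) (r : ℕ) (β : H) :
    ∃ C : ℝ, 0 < C ∧ ∀ (n : ℕ) (ρ a ℓ : ℝ) (x : ℕ → H) (e : ℕ → ℝ) (l : ℕ → ℝ) (f : ℕ → H),
      n ≠ 0 → 0 < ρ → ρ ≤ 1 → IsEmpEigenSystem n x l f → (∀ j < r, (l j)⁻¹ ≤ ℓ) →
      ‖(tikhonov n ρ x (fun i => a + inner ℝ (x i) β + e i)
          + ρ • diagOp r l⁻¹ f (tikhonov n ρ x fun i => a + inner ℝ (x i) β + e i))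
        - (oracleTikhonov K n ρ x (fun i => a + inner ℝ (x i) β + e i)
          + ρ • diagOp r lam⁻¹ φ (oracleTikhonov K n ρ x fun i => a + inner ℝ (x i) β + e i))‖
        ≤ C * hybErr K ρ n β ℓ x e := by
  obtain ⟨δ, C₁, hδ, hC₁, hG⟩ := exists_norm_diagOp_inv_sub_le hK φ hlam hpos heig r
  set Γ := ∑ j ∈ range r, |(lam⁻¹) j| with hΓ
  have hΓ0 : 0 ≤ Γ := sum_nonneg fun _ _ => abs_nonneg _
  have hGn : ∀ z, ‖diagOp r lam⁻¹ φ z‖ ≤ Γ * ‖z‖ := fun z =>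
    ((diagOp r lam⁻¹ φ).le_opNorm z).trans (by gcongr; exact norm_diagOp_le φ.orthonormal r _)
  refine ⟨1 + 3 * Γ + 2 * C₁ * δ + 2 * C₁ * ‖β‖ + (2 * Γ + r) * ‖β‖ / δ + r + r / δ,
    by positivity, fun n ρ a ℓ x e l f hn hρ hρ1 h hℓ => ?_⟩
  set y : ℕ → ℝ := fun i => a + inner ℝ (x i) β + e i with hy
  have h1 := norm_tikhonov_sub_oracleTikhonov_le hK hρ hn a β x e
  have h2 := norm_tikhonov_le hK hρ hn a β x e
  have h3 := norm_smul_diagOp_inv_tikhonov_le hρ hn a β x e h hℓ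
  rw [← hy] at h1 h2 h3
  set b := tikhonov n ρ x y with hb
  set b' := oracleTikhonov K n ρ x y with hb'
  have hE0 := tikErr_nonneg K hρ n β x e
  set E := tikErr K ρ n β x e with hE
  have hD0 : 0 ≤ ‖K - empCov n x‖ := norm_nonneg _
  have hGx := hG n x l f h
  rw [hybErr, ← hE]
  set D := ‖K - empCov n x‖ with hD
  set A := |inner ℝ (sampleMean n x) β| * √ℓ with hA
  have hA0 : 0 ≤ A := by positivity
  set F := √(ℓ * ((n : ℝ)⁻¹ * ∑ i ∈ range n, e i ^ 2)) with hF
  have hF0 : 0 ≤ F := Real.sqrt_nonneg _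
  have e1 : (b + ρ • diagOp r l⁻¹ f b) - (b' + ρ • diagOp r lam⁻¹ φ b')
      = (b - b') + ρ • diagOp r lam⁻¹ φ (b - b')
        + (ρ • diagOp r l⁻¹ f b - ρ • diagOp r lam⁻¹ φ b) := by
    rw [map_sub, smul_sub]; abel
  have hρn : ∀ z : H, ‖ρ • z‖ ≤ ‖z‖ := fun z => by
    rw [norm_smul, Real.norm_of_nonneg hρ.le]
    exact mul_le_of_le_one_left (norm_nonneg _) hρ1
  have hmain : ‖(b - b') + ρ • diagOp r lam⁻¹ φ (b - b')‖ ≤ (1 + Γ) * E := by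
    refine (norm_add_le _ _).trans ?_
    have := ((hρn _).trans (hGn (b - b'))).trans (mul_le_mul_of_nonneg_left h1 hΓ0)
    linarith
  have hrest : ‖ρ • diagOp r l⁻¹ f b - ρ • diagOp r lam⁻¹ φ b‖
      ≤ (2 * Γ + 2 * C₁ * δ) * E + (2 * C₁ * ‖β‖ + (2 * Γ + r) * ‖β‖ / δ) * D + r * A
        + r / δ * (D * F) := by
    rcases le_or_gt D δ with hDδ | hDδ
    · have h4 : ‖ρ • diagOp r l⁻¹ f b - ρ • diagOp r lam⁻¹ φ b‖ ≤ C₁ * D * ‖b‖ := by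
        rw [← smul_sub, ← sub_apply]
        refine (hρn _).trans (((diagOp r l⁻¹ f - diagOp r lam⁻¹ φ).le_opNorm b).trans ?_)
        gcongr
        exact hGx hDδ
      have h5 : C₁ * D * ‖b‖ ≤ 2 * C₁ * ‖β‖ * D + 2 * C₁ * δ * E := by
        calc C₁ * D * ‖b‖ ≤ C₁ * D * (2 * ‖β‖ + 2 * E) := by gcongr
          _ = 2 * C₁ * ‖β‖ * D + 2 * C₁ * E * D := by ring
          _ ≤ 2 * C₁ * ‖β‖ * D + 2 * C₁ * E * δ := by gcongr
          _ = _ := by ring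
      have p1 : 0 ≤ 2 * Γ * E := by positivity
      have p2 : 0 ≤ (2 * Γ + r) * ‖β‖ / δ * D := by positivity
      have p3 : 0 ≤ r * A := by positivity
      have p4 : 0 ≤ r / δ * (D * F) := by positivity
      linarith
    · have hDδ1 : 1 ≤ D / δ := (one_le_div hδ).2 hDδ.le
      have h4 : ‖ρ • diagOp r lam⁻¹ φ b‖ ≤ Γ * (2 * ‖β‖ + 2 * E) :=
        ((hρn _).trans (hGn b)).trans (by gcongr)
      have h5 := norm_sub_le (ρ • diagOp r l⁻¹ f b) (ρ • diagOp r lam⁻¹ φ b)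
      have h6 : (2 * Γ + r) * ‖β‖ ≤ (2 * Γ + r) * ‖β‖ / δ * D := by
        rw [div_mul_eq_mul_div, mul_div_assoc]
        exact le_mul_of_one_le_right (by positivity) hDδ1
      have h7 : r * F ≤ r / δ * (D * F) := by
        calc r * F ≤ r * F * (D / δ) := le_mul_of_one_le_right (by positivity) hDδ1
          _ = _ := by ring
      have p1 : 0 ≤ 2 * C₁ * δ * E := by positivity
      have p2 : 0 ≤ 2 * C₁ * ‖β‖ * D := by positivity
      have h8 : |inner ℝ (sampleMean n x) β| * (r * √ℓ) = r * A := by rw [hA]; ring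
      rw [h8] at h3
      linarith
  rw [e1]
  refine (norm_add_le _ _).trans ((add_le_add hmain hrest).trans ?_)
  set q := (2 * Γ + r) * ‖β‖ / δ with hq
  have hq0 : 0 ≤ q := by positivity
  set w := (r : ℝ) / δ with hw
  have hw0 : 0 ≤ w := by positivity
  have hDF : 0 ≤ D * F := by positivity
  have c1 : (0 : ℝ) ≤ r := by positivity
  have c2 : 0 ≤ 2 * C₁ * δ := by positivity
  have c3 : 0 ≤ 2 * C₁ * ‖β‖ := by positivity
  set c := 1 + 3 * Γ + 2 * C₁ * δ + 2 * C₁ * ‖β‖ + q + r + w with hc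
  have k1 : (1 + Γ) * E + (2 * Γ + 2 * C₁ * δ) * E ≤ c * E := by
    rw [← add_mul]; gcongr; linarith
  have k2 : (2 * C₁ * ‖β‖ + q) * D ≤ c * D := by gcongr; linarith
  have k3 : r * A ≤ c * A := by gcongr; linarith
  have k4 : w * (D * F) ≤ c * (D * F) := by gcongr; linarith
  linarith

/-- The mean squared error bound of the oracle version. -/
theorem norm_oracle_sub_le {K : H →L[ℝ] H} (hK : K.IsPositive) (φ : HilbertBasis ℕ ℝ H)
    {lam : ℕ → ℝ} (hpos : ∀ j, 0 < lam j) (heig : ∀ j, K (φ j) = lam j • φ j) (r : ℕ)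
    {n : ℕ} (hn : n ≠ 0) {ρ : ℝ} (hρ : 0 < ρ) (hρ1 : ρ ≤ 1) (a : ℝ) (β : H) (x : ℕ → H)
    (e : ℕ → ℝ) :
    ‖oracleTikhonov K n ρ x (fun i => a + inner ℝ (x i) β + e i)
        + ρ • diagOp r lam⁻¹ φ (oracleTikhonov K n ρ x fun i => a + inner ℝ (x i) β + e i) - β‖
      ≤ (1 + ∑ j ∈ range r, |(lam⁻¹) j|) * tikErr K ρ n β x e + ‖ρ • ridgeInv K ρ β‖ := by
  set Γ := ∑ j ∈ range r, |(lam⁻¹) j| with hΓ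
  have hΓ0 : 0 ≤ Γ := sum_nonneg fun _ _ => abs_nonneg _
  have h1 := oracleTikhonov_sub hK hρ hn a β x e
  set b := oracleTikhonov K n ρ x fun i => a + inner ℝ (x i) β + e i with hb
  set w := ridgeInv K ρ (crossCovError K n β x e) with hw
  have hwn : ‖w‖ ≤ tikErr K ρ n β x e := norm_ridgeInv_crossCovError_le K hρ n β x e
  set T := ridgeInv K ρ β with hT
  have hbe : b = w + (β - ρ • T) := by rw [eq_add_of_sub_eq h1]; abel
  -- Here β - ρ T = K T, on which the partial inverse acts as the leading projection. The correction
  -- thus cancels the first r coordinates of the bias, leaving ρ (T - P₁ T).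
  have hproj : diagOp r lam⁻¹ φ (β - ρ • T) = projFirst r φ T := by
    rw [← apply_ridgeInv hK hρ, ← hT, diagOp_apply, projFirst_apply]
    refine sum_congr rfl fun j _ => ?_
    rw [← hK.inner_left_eq_inner_right, heig, real_inner_smul_left, Pi.inv_apply,
      inv_mul_cancel_left₀ (hpos j).ne']
  have e1 : b + ρ • diagOp r lam⁻¹ φ b - β
      = w + ρ • diagOp r lam⁻¹ φ w - ρ • (T - projFirst r φ T) := by
    rw [hbe, map_add, hproj, smul_add, smul_sub]; abel
  have hp : ‖T - projFirst r φ T‖ ≤ ‖T‖ := by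
    have := norm_sub_projFirst_sq φ.orthonormal r T
    refine (sq_le_sq₀ (norm_nonneg _) (norm_nonneg _)).1 ?_
    rw [this]
    exact sub_le_self _ (sum_nonneg fun _ _ => sq_nonneg _)
  rw [e1]
  refine (norm_sub_le _ _).trans (add_le_add ?_ ?_)
  · refine (norm_add_le _ _).trans ?_
    have h4 : ‖ρ • diagOp r lam⁻¹ φ w‖ ≤ Γ * ‖w‖ := by
      rw [norm_smul, Real.norm_of_nonneg hρ.le]
      refine (mul_le_of_le_one_left (norm_nonneg _) hρ1).trans ?_
      refine ((diagOp r lam⁻¹ φ).le_opNorm w).trans ?_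
      gcongr
      exact norm_diagOp_le φ.orthonormal r _
    nlinarith
  · rw [norm_smul, norm_smul]
    gcongr

end Regularised

/-! ### Mean squares of the error bounds -/

section Sample

variable {Ω : Type*} [MeasurableSpace Ω]
  {H : Type*} [NormedAddCommGroup H] [InnerProductSpace ℝ H] [CompleteSpace H]
  [MeasurableSpace H] [BorelSpace H] [SecondCountableTopology H]
  {P : Measure Ω} [IsProbabilityMeasure P] {K : H →L[ℝ] H}
  {X : ℕ → Ω → H} {ε : ℕ → Ω → ℝ} {s : ℝ}

theorem IsModelNoise.lintegral_mean_sq (hε : IsModelNoise P X ε s) {n : ℕ} (hn : n ≠ 0) :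
    ∫⁻ ω, ENNReal.ofReal ((n : ℝ)⁻¹ * ∑ i ∈ range n, ε i ω ^ 2) ∂P = ENNReal.ofReal s := by
  have hn' : (n : ℝ) ≠ 0 := by exact_mod_cast hn
  have hI : ∀ i, Integrable (fun ω => ε i ω ^ 2) P := fun i => (hε.memLp i).integrable_sq
  rw [← ofReal_integral_eq_lintegral_ofReal
    ((integrable_finsetSum _ fun i _ => hI i).const_mul _)
    (ae_of_all _ fun ω => by simp only [Pi.zero_apply]; positivity),
    integral_const_mul, integral_finsetSum _ fun i _ => hI i]
  simp only [hε.variance, sum_const, card_range, nsmul_eq_mul]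
  rw [inv_mul_cancel_left₀ hn']

/-- The mean square of the error bound for the hybrid estimator. -/
theorem IsGaussianSample.exists_lintegral_hybErr_sq_le (h : IsGaussianSample P K X)
    {φ : HilbertBasis ℕ ℝ H} {lam : ℕ → ℝ} (h0 : ∀ j, 0 ≤ lam j)
    (heig : ∀ j, K (φ j) = lam j • φ j) (hs : Summable lam) (hε : IsModelNoise P X ε s) (β : H)
    {Λ : ℝ} (hΛ : 0 < Λ) :
    ∃ C > 0, ∀ (n : ℕ) (ρ : ℝ) (ℓ : (ℕ → H) → ℝ), n ≠ 0 → 0 < ρ → 1 ≤ n * ρ ^ 2 →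
      Measurable ℓ → (∀ x, 0 ≤ ℓ x) →
      ∫⁻ ω, ENNReal.ofReal (ℓ fun i => X i ω) ^ 2 ∂P ≤ ENNReal.ofReal Λ →
      ∫⁻ ω, ENNReal.ofReal (hybErr K ρ n β (ℓ fun i => X i ω) (fun i => X i ω)
          fun i => ε i ω) ^ 2 ∂P
        ≤ ENNReal.ofReal (C * (varSum lam ρ / n + 1 / n)) := by
  have hκ := one_le_gaussConst
  have hs0 := hε.nonneg
  obtain ⟨C₁, hC₁, htik⟩ := h.exists_lintegral_tikErr_sq_le h0 heig hs hε β
  set t := 7 * gaussConst * (∑' j, lam j) ^ 2 with ht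
  have ht0 : 0 ≤ t := by positivity
  have hβ := h.inner_nonneg β
  set p := inner ℝ (K β) β with hp
  refine ⟨4 * (C₁ + t + gaussConst * p * √Λ + t * √Λ * s), by positivity,
    fun n ρ ℓ hn hρ hnρ hℓm hℓ0 hℓ => ?_⟩
  have hn' : (0 : ℝ) < n := by exact_mod_cast Nat.pos_of_ne_zero hn
  have hemp := continuous_empCov (H := H) n
  have hsm := continuous_sampleMean (E := H) n
  have hDm : Measurable fun x : ℕ → H => ‖K - empCov n x‖ₑ ^ 2 := by
    have : Continuous fun x : ℕ → H => ‖K - empCov n x‖ₑ := by fun_prop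
    exact this.measurable.pow_const 2
  have hSm : Measurable fun x : ℕ → H => ‖inner ℝ (sampleMean n x) β‖ₑ ^ 2 := by
    have : Continuous fun x : ℕ → H => ‖inner ℝ (sampleMean n x) β‖ₑ := by fun_prop
    exact this.measurable.pow_const 2
  have hX := h.measurable_data
  have hDX : Measurable fun ω => ‖K - empCov n fun i => X i ω‖ₑ ^ 2 := hDm.comp hX
  have hSX : Measurable fun ω => ‖inner ℝ (sampleMean n fun i => X i ω) β‖ₑ ^ 2 := hSm.comp hX
  have hℓX : Measurable fun ω => ENNReal.ofReal (ℓ fun i => X i ω) := (hℓm.comp hX).ennreal_ofReal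
  have hℓ' : ∫⁻ ω, ENNReal.ofReal (ℓ fun i => X i ω) ^ 2 ∂P ≤ ENNReal.ofReal √Λ ^ 2 := by
    rwa [← ENNReal.ofReal_pow (Real.sqrt_nonneg _), Real.sq_sqrt hΛ.le]
  have i1 := htik n ρ hn hρ hnρ
  have i2 : ∫⁻ ω, ‖K - empCov n fun i => X i ω‖ₑ ^ 2 ∂P ≤ ENNReal.ofReal (t / n) := by
    have := lintegral_mul_le_of_sq_le (P := P) (g := fun _ => 1) (B := 1) hDX.aemeasurable
      measurable_const.aemeasurable (h.lintegral_opNorm_le h0 heig hs hn) (by simp)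
    simpa only [mul_one] using this
  have i3 : ∫⁻ ω, ‖inner ℝ (sampleMean n fun i => X i ω) β‖ₑ ^ 2 *
      ENNReal.ofReal (ℓ fun i => X i ω) ∂P ≤ ENNReal.ofReal (gaussConst * p * √Λ / n) := by
    refine (lintegral_mul_le_of_sq_le hSX.aemeasurable hℓX.aemeasurable
      ((h.inner_sampleMean_gaussian n β).lintegral_pow_four_le (h.inner_sampleMean_centered n β)
        (h.inner_sampleMean_variance hn β)) hℓ').trans (le_of_eq ?_)
    rw [← ENNReal.ofReal_mul (by positivity)]
    congr 1; ring
  -- ℓ and K̂ are functions of the design, so this factor is independent of the errors, and their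
  -- second moments suffice.
  have i4 : ∫⁻ ω, (‖K - empCov n fun i => X i ω‖ₑ ^ 2 * ENNReal.ofReal (ℓ fun i => X i ω)) *
      ENNReal.ofReal ((n : ℝ)⁻¹ * ∑ i ∈ range n, ε i ω ^ 2) ∂P
        ≤ ENNReal.ofReal (t * √Λ * s / n) := by
    have hind : IndepFun
        (fun ω => ‖K - empCov n fun i => X i ω‖ₑ ^ 2 * ENNReal.ofReal (ℓ fun i => X i ω))
        (fun ω => ENNReal.ofReal ((n : ℝ)⁻¹ * ∑ i ∈ range n, ε i ω ^ 2)) P :=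
      hε.indep_design.comp
        (φ := fun x : ℕ → H => ‖K - empCov n x‖ₑ ^ 2 * ENNReal.ofReal (ℓ x))
        (ψ := fun e : ℕ → ℝ => ENNReal.ofReal ((n : ℝ)⁻¹ * ∑ i ∈ range n, e i ^ 2))
        (hDm.mul hℓm.ennreal_ofReal) (by fun_prop)
    have hεm := hε.measurable
    rw [lintegral_mul_eq_lintegral_mul_lintegral_of_indepFun'' (hDX.fun_mul hℓX).aemeasurable
      (by fun_prop) hind, hε.lintegral_mean_sq hn]
    refine (mul_le_mul_left (lintegral_mul_le_of_sq_le hDX.aemeasurable hℓX.aemeasurable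
      (h.lintegral_opNorm_le h0 heig hs hn) hℓ') _).trans (le_of_eq ?_)
    rw [← ENNReal.ofReal_mul (by positivity), ← ENNReal.ofReal_mul (by positivity)]
    congr 1; ring
  have hpt : ∀ (x : ℕ → H) (e : ℕ → ℝ), ENNReal.ofReal (hybErr K ρ n β (ℓ x) x e) ^ 2
      ≤ ENNReal.ofReal 4 * (‖K - empCov n x‖ₑ ^ 2
        + ‖inner ℝ (sampleMean n x) β‖ₑ ^ 2 * ENNReal.ofReal (ℓ x)
        + ENNReal.ofReal (tikErr K ρ n β x e) ^ 2
        + (‖K - empCov n x‖ₑ ^ 2 * ENNReal.ofReal (ℓ x)) *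
          ENNReal.ofReal ((n : ℝ)⁻¹ * ∑ i ∈ range n, e i ^ 2)) := by
    intro x e
    have hE0 := tikErr_nonneg K hρ n β x e
    have hl0 := hℓ0 x
    have hN0 : 0 ≤ (n : ℝ)⁻¹ * ∑ i ∈ range n, e i ^ 2 := by positivity
    have hpos : 0 ≤ hybErr K ρ n β (ℓ x) x e := by unfold hybErr; positivity
    have e3 : ‖inner ℝ (sampleMean n x) β‖ₑ ^ 2
        = ENNReal.ofReal (inner ℝ (sampleMean n x) β ^ 2) := by
      rw [← ofReal_norm, ← ENNReal.ofReal_pow (norm_nonneg _), Real.norm_eq_abs, sq_abs]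
    rw [e3, ← ofReal_norm, ← ENNReal.ofReal_pow (norm_nonneg _), ← ENNReal.ofReal_pow hE0,
      ← ENNReal.ofReal_pow hpos]
    rw [← ENNReal.ofReal_mul (by positivity), ← ENNReal.ofReal_mul (by positivity),
      ← ENNReal.ofReal_mul (by positivity), ← ENNReal.ofReal_add (by positivity) (by positivity),
      ← ENNReal.ofReal_add (by positivity) (by positivity),
      ← ENNReal.ofReal_add (by positivity) (by positivity), ← ENNReal.ofReal_mul (by norm_num)]
    refine ENNReal.ofReal_le_ofReal ?_
    have e1 : (|inner ℝ (sampleMean n x) β| * √(ℓ x)) ^ 2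
        = inner ℝ (sampleMean n x) β ^ 2 * ℓ x := by
      rw [mul_pow, sq_abs, Real.sq_sqrt hl0]
    have e2 : (‖K - empCov n x‖ * √(ℓ x * ((n : ℝ)⁻¹ * ∑ i ∈ range n, e i ^ 2))) ^ 2
        = ‖K - empCov n x‖ ^ 2 * ℓ x * ((n : ℝ)⁻¹ * ∑ i ∈ range n, e i ^ 2) := by
      rw [mul_pow, Real.sq_sqrt (by positivity), mul_assoc]
    rw [hybErr, ← e1, ← e2]
    generalize tikErr K ρ n β x e = a1
    generalize |inner ℝ (sampleMean n x) β| * √(ℓ x) = a2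
    generalize ‖K - empCov n x‖ * √(ℓ x * ((n : ℝ)⁻¹ * ∑ i ∈ range n, e i ^ 2)) = a3
    generalize ‖K - empCov n x‖ = a4
    nlinarith [sq_nonneg (a1 - a2), sq_nonneg (a1 - a3), sq_nonneg (a1 - a4),
      sq_nonneg (a2 - a3), sq_nonneg (a2 - a4), sq_nonneg (a3 - a4)]
  refine (lintegral_mono fun ω => hpt _ _).trans ?_
  have hεm := hε.measurable
  have hlast : Measurable fun ω =>
      (‖K - empCov n fun i => X i ω‖ₑ ^ 2 * ENNReal.ofReal (ℓ fun i => X i ω)) *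
        ENNReal.ofReal ((n : ℝ)⁻¹ * ∑ i ∈ range n, ε i ω ^ 2) :=
    (hDX.mul hℓX).mul (by fun_prop)
  rw [lintegral_const_mul' _ _ ENNReal.ofReal_ne_top, lintegral_add_right _ hlast,
    lintegral_add_left (hDX.fun_add (hSX.fun_mul hℓX)), lintegral_add_left hDX]
  refine (mul_le_mul_right (add_le_add (add_le_add (add_le_add i2 i3) i1) i4) _).trans ?_
  have hS := varSum_nonneg h0 ρ
  rw [← ENNReal.ofReal_add (by positivity) (by positivity),
    ← ENNReal.ofReal_add (by positivity) (by positivity),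
    ← ENNReal.ofReal_add (by positivity) (by positivity), ← ENNReal.ofReal_mul (by norm_num)]
  refine ENNReal.ofReal_le_ofReal ?_
  have hSn : 0 ≤ varSum lam ρ / n := by positivity
  have h1n : 0 ≤ 1 / (n : ℝ) := by positivity
  have hq : 0 ≤ t + gaussConst * p * √Λ + t * √Λ * s := by positivity
  calc _ = 4 * (C₁ * (varSum lam ρ / n) + (t + gaussConst * p * √Λ + t * √Λ * s) * (1 / n)) := by
        ring
    _ ≤ 4 * ((C₁ + (t + gaussConst * p * √Λ + t * √Λ * s)) * (varSum lam ρ / n)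
        + (C₁ + (t + gaussConst * p * √Λ + t * √Λ * s)) * (1 / n)) := by
        refine mul_le_mul_of_nonneg_left (add_le_add ?_ ?_) (by norm_num)
        · exact mul_le_mul_of_nonneg_right (by linarith) hSn
        · exact mul_le_mul_of_nonneg_right (by linarith) h1n
    _ = _ := by ring

end Sample

/-! ### Orders of the variance and of the bias -/

section Rates

variable {H : Type*} [NormedAddCommGroup H] [InnerProductSpace ℝ H] [CompleteSpace H]

theorem CondA2.exists_varSum_le {α : ℝ} {lam : ℕ → ℝ} (h : CondA2 α lam) :
    ∃ C, 0 < C ∧ ∀ ρ : ℝ, 0 < ρ → ρ ≤ 1 → varSum lam ρ ≤ C * (1 / ρ ^ (1 + 1 / α)) := by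
  obtain ⟨C, hC, hb⟩ := h.exists_sum_variance_le
  exact ⟨C, hC, fun ρ hρ hρ1 => Real.tsum_le_of_sum_range_le
    (fun j => div_nonneg (h.pos j).le (sq_nonneg _)) (hb ρ hρ hρ1)⟩

theorem exists_norm_bias_sq_le {K : H →L[ℝ] H} (hK : K.IsPositive) {φ : HilbertBasis ℕ ℝ H}
    {α η m : ℝ} {lam : ℕ → ℝ} {β : H} (heig : ∀ j, K (φ j) = lam j • φ j) (h : CondA2 α lam)
    (hβ : CondA3 η β φ)
    (hm : (η - 1 / 2 < α ∧ m = (2 * η - 1) / α) ∨ (α < η - 1 / 2 ∧ m = 2)) :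
    ∃ C, 0 < C ∧ ∀ ρ : ℝ, 0 < ρ → ρ ≤ 1 → ‖ρ • ridgeInv K ρ β‖ ^ 2 ≤ C * ρ ^ m := by
  obtain ⟨C, hC, hb⟩ := exists_sum_bias_le (b := fun j => inner ℝ β (φ j)) h hβ.half_lt hβ.decay hm
  refine ⟨C, hC, fun ρ hρ hρ1 => ?_⟩
  have e : ‖ρ • ridgeInv K ρ β‖ ^ 2
      = ∑' j, (ρ * inner ℝ β (φ j) / (lam j + ρ)) ^ 2 := by
    rw [← real_inner_self_eq_norm_sq, ← φ.tsum_inner_mul_inner]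
    refine tsum_congr fun j => ?_
    rw [real_inner_comm, ← sq, real_inner_smul_right,
      inner_eigenvector_ridgeInv hK hρ (h.pos j).le (heig j), real_inner_comm β]
    congr 1
    ring
  rw [e]
  exact Real.tsum_le_of_sum_range_le (fun j => sq_nonneg _) (hb ρ hρ hρ1)

end Rates

/-! ### Mean squared errors as squared L² norms -/

section MSE

variable {Ω : Type*} [MeasurableSpace Ω] {P : Measure Ω}
  {H : Type*} [NormedAddCommGroup H] [InnerProductSpace ℝ H] [CompleteSpace H]

theorem eLpNorm_two_sq_eq (f : Ω → H) : eLpNorm f 2 P ^ 2 = ∫⁻ ω, ‖f ω‖ₑ ^ 2 ∂P := by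
  have := eLpNorm_nnreal_pow_eq_lintegral (f := f) (μ := P) (p := 2) (by norm_num)
  simpa using this

theorem integral_norm_sq_eq {f : Ω → H} (hf : AEStronglyMeasurable f P) :
    ∫ ω, ‖f ω‖ ^ 2 ∂P = (eLpNorm f 2 P).toReal ^ 2 := by
  rw [← ENNReal.toReal_pow, eLpNorm_two_sq_eq,
    integral_eq_lintegral_of_nonneg_ae (ae_of_all _ fun ω => sq_nonneg _) (hf.norm.pow 2)]
  congr 1
  refine lintegral_congr fun ω => ?_
  rw [ENNReal.ofReal_pow (norm_nonneg _), ofReal_norm]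

theorem eLpNorm_two_le {f : Ω → H} {g : Ω → ℝ} (hfg : ∀ᵐ ω ∂P, ‖f ω‖ ≤ g ω) {A : ℝ}
    (hA : 0 ≤ A) (hg : ∫⁻ ω, ENNReal.ofReal (g ω) ^ 2 ∂P ≤ ENNReal.ofReal A) :
    eLpNorm f 2 P ≤ ENNReal.ofReal √A := by
  have h1 : eLpNorm f 2 P ^ 2 ≤ ENNReal.ofReal √A ^ 2 := by
    rw [eLpNorm_two_sq_eq, ← ENNReal.ofReal_pow (Real.sqrt_nonneg _), Real.sq_sqrt hA]
    refine (lintegral_mono_ae ?_).trans hg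
    filter_upwards [hfg] with ω hω
    rw [← ofReal_norm]
    gcongr
  exact (ENNReal.pow_le_pow_left_iff two_ne_zero).1 h1

/-- Comparison of two mean squared errors. -/
theorem mse_comparison {b b' : Ω → H} {β : H} (hb : AEStronglyMeasurable b P)
    (hb' : AEStronglyMeasurable b' P) [IsFiniteMeasure P] {A B : ℝ} (hA : 0 ≤ A) (hB : 0 ≤ B)
    (h1 : eLpNorm (fun ω => b ω - b' ω) 2 P ≤ ENNReal.ofReal A)
    (h2 : eLpNorm (fun ω => b' ω - β) 2 P ≤ ENNReal.ofReal B) :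
    MemLp (fun ω => b ω - β) 2 P ∧ MemLp (fun ω => b' ω - β) 2 P ∧
      |MSE P b β - MSE P b' β| ≤ A * (2 * B + A) ∧ MSE P b β ≤ (A + B) ^ 2 := by
  have m1 : MemLp (fun ω => b ω - b' ω) 2 P := ⟨hb.sub hb', h1.trans_lt ENNReal.ofReal_lt_top⟩
  have m2 : MemLp (fun ω => b' ω - β) 2 P :=
    ⟨hb'.sub aestronglyMeasurable_const, h2.trans_lt ENNReal.ofReal_lt_top⟩
  have m3 : MemLp (fun ω => b ω - β) 2 P := by
    have := m1.add m2
    refine this.congr_norm (hb.sub aestronglyMeasurable_const) (ae_of_all _ fun ω => ?_)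
    simp
  refine ⟨m3, m2, ?_⟩
  rw [MSE, MSE, integral_norm_sq_eq m3.1, integral_norm_sq_eq m2.1]
  have t1 : eLpNorm (fun ω => b ω - β) 2 P
      ≤ eLpNorm (fun ω => b ω - b' ω) 2 P + eLpNorm (fun ω => b' ω - β) 2 P := by
    have := eLpNorm_add_le m1.1 m2.1 (p := 2) (by norm_num)
    refine le_trans (le_of_eq (congrArg (fun f => eLpNorm f 2 P) ?_)) this
    ext ω; simp
  have t2 : eLpNorm (fun ω => b' ω - β) 2 P
      ≤ eLpNorm (fun ω => b ω - β) 2 P + eLpNorm (fun ω => b ω - b' ω) 2 P := by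
    have := eLpNorm_sub_le m3.1 m1.1 (p := 2) (by norm_num)
    refine le_trans (le_of_eq (congrArg (fun f => eLpNorm f 2 P) ?_)) this
    ext ω; simp
  have r1 := ENNReal.toReal_mono (ENNReal.add_ne_top.2 ⟨m1.2.ne, m2.2.ne⟩) t1
  have r2 := ENNReal.toReal_mono (ENNReal.add_ne_top.2 ⟨m3.2.ne, m1.2.ne⟩) t2
  rw [ENNReal.toReal_add m1.2.ne m2.2.ne] at r1
  rw [ENNReal.toReal_add m3.2.ne m1.2.ne] at r2
  have q1 := ENNReal.toReal_le_of_le_ofReal hA h1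
  have q2 := ENNReal.toReal_le_of_le_ofReal hB h2
  have p1 : 0 ≤ (eLpNorm (fun ω => b ω - b' ω) 2 P).toReal := ENNReal.toReal_nonneg
  have p2 : 0 ≤ (eLpNorm (fun ω => b' ω - β) 2 P).toReal := ENNReal.toReal_nonneg
  have p3 : 0 ≤ (eLpNorm (fun ω => b ω - β) 2 P).toReal := ENNReal.toReal_nonneg
  generalize (eLpNorm (fun ω => b ω - b' ω) 2 P).toReal = u at *
  generalize (eLpNorm (fun ω => b' ω - β) 2 P).toReal = v at *
  generalize (eLpNorm (fun ω => b ω - β) 2 P).toReal = w at *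
  constructor
  · have h3 : |w - v| ≤ A := abs_le.2 ⟨by linarith, by linarith⟩
    rw [sq_sub_sq, abs_mul, abs_of_nonneg (by linarith), mul_comm]
    exact mul_le_mul h3 (by linarith) (by linarith) hA
  · exact pow_le_pow_left₀ p3 (by linarith) 2

end MSE

/-! ### The model sample -/

section Model

variable {Ω : Type*} [MeasurableSpace Ω] {P : Measure Ω} [IsProbabilityMeasure P]
  {H : Type*} [NormedAddCommGroup H] [InnerProductSpace ℝ H] [CompleteSpace H]
  [SecondCountableTopology H] [MeasurableSpace H] [BorelSpace H]
  {X : ℕ → Ω → H} {ε : ℕ → Ω → ℝ}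

theorem covOp_isPositive (W : Ω → H) : (covOp P W).IsPositive :=
  (ContinuousLinearMap.isPositive_toLinearMap_iff _).1 isPositive_covarianceOperator

theorem covOp_inner {W : Ω → H} (hW : MemLp W 2 P) (h0 : ∫ ω, W ω ∂P = 0) (u v : H) :
    inner ℝ (covOp P W u) v = ∫ ω, inner ℝ (W ω) u * inner ℝ (W ω) v ∂P := by
  have hm := hW.1.aemeasurable
  simp only [covOp, h0, sub_zero]
  rw [covarianceOperator_inner, integral_map hm]
  · simp only [real_inner_comm]
  · exact (by fun_prop : Measurable fun z : H => inner ℝ u z * inner ℝ v z).aestronglyMeasurable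
  · exact (memLp_map_measure_iff aestronglyMeasurable_id hm).2 hW

theorem covOp_comp {W : Ω → H} (hW : MemLp W 2 P) (h0 : ∫ ω, W ω ∂P = 0) {p : H →L[ℝ] H}
    (hp : star p = p) : covOp P (fun ω => p (W ω)) = p * covOp P W * p := by
  have hs : ∀ u v, inner ℝ (p u) v = inner ℝ u (p v) := fun u v => by
    rw [← ContinuousLinearMap.adjoint_inner_right, ← ContinuousLinearMap.star_eq_adjoint, hp]
  have hI : Integrable W P := hW.integrable (by norm_num)
  ext u
  refine ext_inner_right ℝ fun v => ?_
  have hpW : MemLp (fun ω => p (W ω)) 2 P := p.comp_memLp' hW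
  rw [covOp_inner hpW (by rw [p.integral_comp_comm hI, h0, map_zero])]
  simp only [mul_apply_eq_comp, hs]
  rw [covOp_inner hW h0]

theorem IsModelSample.isGaussianSample (hs : IsModelSample P X ε) (h : CondA1 P (X 0)) :
    IsGaussianSample P (covOp P (X 0)) X := by
  have hid : ∀ i, IdentDistrib (X i) (X 0) P P := fun i =>
    (hs.identDistrib i).comp measurable_fst
  refine ⟨hs.measurable_X, hs.iIndep.comp (fun _ p => p.1) fun _ => measurable_fst, hid,
    fun i => ⟨by rw [(hid i).map_eq]; exact h.gaussian.isGaussian_map⟩,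
    fun i => by rw [(hid i).integral_eq, h.centered], fun i u v => ?_, covOp_isPositive _⟩
  rw [covOp_inner (h.gaussian.memLp (by simp)) h.centered]
  exact ((hid i).comp (u := fun x => inner ℝ x u * inner ℝ x v) (by fun_prop)).integral_eq

theorem IsModelSample.isModelNoise (hs : IsModelSample P X ε) :
    IsModelNoise P X ε (∫ ω, ε 0 ω ^ 2 ∂P) := by
  have hid : ∀ i, IdentDistrib (ε i) (ε 0) P P := fun i =>
    (hs.identDistrib i).comp measurable_snd
  have hidX : ∀ i, IdentDistrib (X i) (X 0) P P := fun i =>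
    (hs.identDistrib i).comp measurable_fst
  refine ⟨hs.measurable_ε, hs.iIndep.comp (fun _ p => p.2) fun _ => measurable_snd,
    fun i => (hid i).memLp_iff.2 hs.memLp_noise, fun i => by rw [(hid i).integral_eq, hs.mean_noise],
    fun i => ((hid i).comp (u := fun x : ℝ => x ^ 2) (by fun_prop)).integral_eq,
    indepFun_components hs.measurable_X hs.measurable_ε hs.iIndep fun i => ?_⟩
  have h0 := (indepFun_iff_map_prod_eq_prod_map_map (hs.measurable_X 0).aemeasurable
    (hs.measurable_ε 0).aemeasurable).1 hs.indep_noise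
  rw [indepFun_iff_map_prod_eq_prod_map_map (hs.measurable_X i).aemeasurable
    (hs.measurable_ε i).aemeasurable, (hs.identDistrib i).map_eq, h0, (hid i).map_eq,
    (hidX i).map_eq]

end Model

/-! ### Measurability of the estimators -/

section Measurability

variable {H : Type*} [NormedAddCommGroup H] [InnerProductSpace ℝ H] [CompleteSpace H]

theorem continuous_empCrossCov (n : ℕ) :
    Continuous fun p : (ℕ → H) × (ℕ → ℝ) => empCrossCov n p.2 p.1 := by
  have h1 := continuous_sampleMean (E := H) n
  have h2 := continuous_sampleMean (E := ℝ) n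
  unfold empCrossCov
  fun_prop

/-- Inversion is continuous at units, and K̂ + ρ is a unit for every sample. -/
theorem continuous_tikhonov (n : ℕ) {ρ : ℝ} (hρ : 0 < ρ) :
    Continuous fun p : (ℕ → H) × (ℕ → ℝ) => tikhonov n ρ p.1 p.2 := by
  refine Continuous.clm_apply ?_ (continuous_empCrossCov n)
  refine continuous_iff_continuousAt.2 fun p => ?_
  obtain ⟨u, hu⟩ := isUnit_add_smul_one (empCov_isPositive n p.1) hρ
  have h1 := NormedRing.inverse_continuousAt u
  rw [hu] at h1
  have h2 : Continuous fun p : (ℕ → H) × (ℕ → ℝ) => empCov n p.1 + ρ • (1 : H →L[ℝ] H) := by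
    have := continuous_empCov (H := H) n
    fun_prop
  exact ContinuousAt.comp (f := fun p : (ℕ → H) × (ℕ → ℝ) => empCov n p.1 + ρ • (1 : H →L[ℝ] H))
    h1 h2.continuousAt

theorem continuous_oracleTikhonov (K : H →L[ℝ] H) (n : ℕ) (ρ : ℝ) :
    Continuous fun p : (ℕ → H) × (ℕ → ℝ) => oracleTikhonov K n ρ p.1 p.2 := by
  have := continuous_empCrossCov (H := H) n
  unfold oracleTikhonov
  fun_prop

end Measurability

/-! ### Rates of convergence -/

section Rates

variable {Ω : Type*} [MeasurableSpace Ω] {P : Measure Ω} [IsProbabilityMeasure P]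
  {H : Type*} [NormedAddCommGroup H] [InnerProductSpace ℝ H] [CompleteSpace H]
  [SecondCountableTopology H] [MeasurableSpace H] [BorelSpace H]

theorem varRate_nonneg {α : ℝ} {ρ : ℕ → ℝ} {n : ℕ} (hρ : 0 < ρ n) : 0 ≤ varRate α ρ n := by
  unfold varRate; positivity

/-- Absorbs into the variance rate the terms of order n⁻¹ that come from the perturbation of the
eigenvectors and from the inverse eigenvalues. -/
theorem one_div_le_varRate {α : ℝ} (hα : 0 < α) {ρ : ℕ → ℝ} {n : ℕ} (hn : n ≠ 0) (hρ : 0 < ρ n)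
    (hρ1 : ρ n ≤ 1) : 1 / (n : ℝ) ≤ varRate α ρ n := by
  have hn' : (0 : ℝ) < n := by exact_mod_cast Nat.pos_of_ne_zero hn
  unfold varRate
  have h1 : ρ n ^ (1 + 1 / α) ≤ 1 := Real.rpow_le_one hρ.le hρ1 (by positivity)
  have h2 : 0 < ρ n ^ (1 + 1 / α) := Real.rpow_pos_of_pos hρ _
  gcongr
  exact mul_le_of_le_one_right hn'.le h1

set_option maxHeartbeats 400000 in
/-- The rates of convergence for an estimator with `r` unpenalised components. -/
theorem regularised_rates {a : ℝ} {β : H} {X : ℕ → Ω → H} {ε : ℕ → Ω → ℝ} {K : H →L[ℝ] H} {s : ℝ}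
    (hX : IsGaussianSample P K X) (hε : IsModelNoise P X ε s)
    {lam : ℕ → ℝ} {φ : HilbertBasis ℕ ℝ H} (heig : ∀ j, K (φ j) = lam j • φ j)
    {α η m : ℝ} (hA2 : CondA2 α lam) (hA3 : CondA3 η β φ)
    (hm : (η - 1 / 2 < α ∧ m = (2 * η - 1) / α) ∨ (α < η - 1 / 2 ∧ m = 2))
    {ρ : ℕ → ℝ} (hρ_pos : ∀ᶠ n in atTop, 0 < ρ n) (hρ : Tendsto ρ atTop (𝓝 0))
    (hnρ : Tendsto (fun n : ℕ => (n : ℝ) * ρ n ^ 2) atTop atTop)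
    (r : ℕ) {l : ℕ → Ω → ℕ → ℝ} {f : ℕ → Ω → ℕ → H}
    (hf_meas : ∀ n j, AEMeasurable (fun ω => f n ω j) P)
    (hf : ∀ n, ∀ᵐ ω ∂P, IsEmpEigenSystem n (fun i => X i ω) (l n ω) (f n ω))
    {b b' : ℕ → Ω → H}
    (hb : ∀ n, 0 < ρ n → ∀ᵐ ω ∂P, (∀ j < r, 0 < l n ω j) → b n ω =
      tikhonov n (ρ n) (fun i => X i ω) (fun i => a + inner ℝ (X i ω) β + ε i ω)
        + ρ n • diagOp r (l n ω)⁻¹ (f n ω) (tikhonov n (ρ n) (fun i => X i ω)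
          fun i => a + inner ℝ (X i ω) β + ε i ω))
    (hb' : ∀ n, 0 < ρ n → ∀ ω, b' n ω =
      oracleTikhonov K n (ρ n) (fun i => X i ω) (fun i => a + inner ℝ (X i ω) β + ε i ω)
        + ρ n • diagOp r lam⁻¹ φ (oracleTikhonov K n (ρ n) (fun i => X i ω)
          fun i => a + inner ℝ (X i ω) β + ε i ω)) :
    (∀ᶠ n in atTop, MemLp (fun ω => b n ω - β) 2 P ∧ MemLp (fun ω => b' n ω - β) 2 P) ∧
    ((fun n => |MSE P (b n) β - MSE P (b' n) β|) =O[atTop] (fun n =>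
        mseRate α m ρ n ^ (1 / 2 : ℝ) * varRate α ρ n ^ (1 / 2 : ℝ) + varRate α ρ n)) ∧
    ((fun n => MSE P (b n) β) =O[atTop] mseRate α m ρ) := by
  have hα : 0 < α := by linarith [hA2.one_lt]
  have h0 : ∀ j, 0 ≤ lam j := fun j => (hA2.pos j).le
  have hsum := hA2.summable
  obtain ⟨Λ, hΛ, N, hN⟩ :=
    hX.exists_inv_eigenvalue_bound hA2.pos hA2.strictAnti.antitone heig r
  obtain ⟨C₁, hC₁, hpath⟩ :=
    exists_norm_hybrid_sub_le hX.pos φ hA2.strictAnti hA2.pos heig r β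
  obtain ⟨C₂, hC₂, hhyb⟩ := hX.exists_lintegral_hybErr_sq_le h0 heig hsum hε β hΛ
  obtain ⟨C₃, hC₃, htik⟩ := hX.exists_lintegral_tikErr_sq_le h0 heig hsum hε β
  obtain ⟨C₄, hC₄, hvar⟩ := hA2.exists_varSum_le
  obtain ⟨C₅, hC₅, hbias⟩ := exists_norm_bias_sq_le hX.pos heig hA2 hA3 hm
  set Γ := 1 + ∑ j ∈ range r, |(lam⁻¹) j| with hΓ
  have hΓ0 : 0 ≤ Γ := add_nonneg zero_le_one (sum_nonneg fun _ _ => abs_nonneg _)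
  set CA := C₁ ^ 2 * (C₂ * (C₄ + 1)) with hCA
  have hCA0 : 0 ≤ CA := by positivity
  set CB := 2 * Γ ^ 2 * (C₃ * C₄) + 2 * C₅ with hCB
  have hCB0 : 0 ≤ CB := by positivity
  have key : ∀ᶠ n in atTop, (0 ≤ varRate α ρ n ∧ varRate α ρ n ≤ mseRate α m ρ n) ∧
      MemLp (fun ω => b n ω - β) 2 P ∧ MemLp (fun ω => b' n ω - β) 2 P ∧
      |MSE P (b n) β - MSE P (b' n) β| ≤ √(CA * varRate α ρ n) *
        (2 * √(CB * mseRate α m ρ n) + √(CA * varRate α ρ n)) ∧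
      MSE P (b n) β ≤ (√(CA * varRate α ρ n) + √(CB * mseRate α m ρ n)) ^ 2 := by
    filter_upwards [hρ_pos, hρ.eventually_le_const one_pos, hnρ.eventually_ge_atTop 1,
      eventually_ge_atTop N, eventually_ne_atTop 0] with n hρn hρ1 hnρ1 hnN hn
    have hn' : (0 : ℝ) < n := by exact_mod_cast Nat.pos_of_ne_zero hn
    have hV0 := varRate_nonneg (α := α) hρn
    have hVM : varRate α ρ n ≤ mseRate α m ρ n := by
      unfold mseRate
      have : 0 ≤ ρ n ^ m := Real.rpow_nonneg hρn.le _
      linarith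
    have hM0 : 0 ≤ mseRate α m ρ n := hV0.trans hVM
    have hVn := one_div_le_varRate hα hn hρn hρ1
    have hSn : varSum lam (ρ n) / n ≤ C₄ * varRate α ρ n := by
      calc varSum lam (ρ n) / n ≤ C₄ * (1 / ρ n ^ (1 + 1 / α)) / n := by
            gcongr
            exact hvar _ hρn hρ1
        _ = C₄ * varRate α ρ n := by unfold varRate; field_simp
    obtain ⟨ℓ, hℓm, hℓ0, hℓ2, hℓ⟩ := hN n hnN
    have hXm := hX.measurable_data
    have hεm := hε.measurable
    have hdata : Measurable fun ω => ((fun i => X i ω, fun i => a + inner ℝ (X i ω) β + ε i ω) :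
        (ℕ → H) × (ℕ → ℝ)) := by
      refine hXm.prodMk (measurable_pi_lambda _ fun i => ?_)
      have := hX.measurable i
      fun_prop
    have hTm := (continuous_tikhonov (H := H) n hρn).measurable.comp hdata
    have hOm := (continuous_oracleTikhonov K n (ρ n)).measurable.comp hdata
    simp only [Function.comp_def] at hTm hOm
    -- Measurability in ω is given for the empirical eigenvectors only. The eigenvalues are
    -- recovered from them as ⟨K̂ f_j, f_j⟩, which yields an a.e. equal measurable expression for
    -- the estimator.
    have hbm : AEStronglyMeasurable (b n) P := by
      have h1 : ∀ j, AEMeasurable (fun ω => empCov n (fun i => X i ω) (f n ω j)) P := fun j => by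
        have hc : Continuous fun p : (ℕ → H) × H => empCov n p.1 p.2 := by
          have := continuous_empCov (H := H) n
          fun_prop
        have hp : AEMeasurable (fun ω => ((fun i => X i ω, f n ω j) : (ℕ → H) × H)) P :=
          hXm.aemeasurable.prodMk (hf_meas n j)
        have := hc.measurable.comp_aemeasurable hp
        exact this
      have h2 : AEMeasurable (fun ω =>
          tikhonov n (ρ n) (fun i => X i ω) (fun i => a + inner ℝ (X i ω) β + ε i ω)
          + ρ n • ∑ j ∈ range r, ((inner ℝ (empCov n (fun i => X i ω) (f n ω j)) (f n ω j))⁻¹ *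
            inner ℝ (f n ω j) (tikhonov n (ρ n) (fun i => X i ω)
              fun i => a + inner ℝ (X i ω) β + ε i ω)) • f n ω j) P := by
        refine hTm.aemeasurable.add (AEMeasurable.const_smul ?_ _)
        refine Finset.aemeasurable_fun_sum _ fun j _ => ?_
        exact ((((h1 j).inner (hf_meas n j)).inv).mul
          ((hf_meas n j).inner hTm.aemeasurable)).smul (hf_meas n j)
      refine h2.aestronglyMeasurable.congr ?_
      filter_upwards [hf n, hb n hρn, hℓ] with ω h3 h4 h5
      rw [h4 fun j hj => (h5 _ _ h3 j hj).1, diagOp_apply]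
      congr 2
      refine sum_congr rfl fun j _ => ?_
      rw [h3.apply, real_inner_smul_left, real_inner_self_eq_norm_sq,
        h3.orthonormal.norm_eq_one, one_pow, mul_one, Pi.inv_apply]
    have hbm' : AEStronglyMeasurable (b' n) P := by
      have h2 := hOm.add (((diagOp r lam⁻¹ φ).measurable.comp hOm).const_smul (ρ n))
      refine h2.aestronglyMeasurable.congr (ae_of_all _ fun ω => ?_)
      rw [hb' n hρn ω]
      rfl
    have hA : eLpNorm (fun ω => b n ω - b' n ω) 2 P
        ≤ ENNReal.ofReal √(CA * varRate α ρ n) := by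
      refine eLpNorm_two_le (g := fun ω => C₁ * hybErr K (ρ n) n β (ℓ fun i => X i ω)
        (fun i => X i ω) fun i => ε i ω) ?_ (by positivity) ?_
      · filter_upwards [hf n, hb n hρn, hℓ] with ω h3 h4 h5
        rw [h4 fun j hj => (h5 _ _ h3 j hj).1, hb' n hρn ω]
        exact hpath n (ρ n) a _ _ _ _ _ hn hρn hρ1 h3 fun j hj => (h5 _ _ h3 j hj).2
      · simp only [ENNReal.ofReal_mul hC₁.le, mul_pow]
        rw [← ENNReal.ofReal_pow hC₁.le, lintegral_const_mul' _ _ ENNReal.ofReal_ne_top]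
        refine (mul_le_mul_right (hhyb n (ρ n) ℓ hn hρn hnρ1 hℓm hℓ0 hℓ2) _).trans ?_
        rw [← ENNReal.ofReal_mul (by positivity)]
        refine ENNReal.ofReal_le_ofReal ?_
        calc C₁ ^ 2 * (C₂ * (varSum lam (ρ n) / n + 1 / n))
            ≤ C₁ ^ 2 * (C₂ * (C₄ * varRate α ρ n + varRate α ρ n)) := by gcongr
          _ = _ := by rw [hCA]; ring
    have hB : eLpNorm (fun ω => b' n ω - β) 2 P ≤ ENNReal.ofReal √(CB * mseRate α m ρ n) := by
      refine eLpNorm_two_le (g := fun ω => Γ * tikErr K (ρ n) n β (fun i => X i ω)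
        (fun i => ε i ω) + ‖ρ n • ridgeInv K (ρ n) β‖) (ae_of_all _ fun ω => ?_)
        (by positivity) ?_
      · rw [hb' n hρn ω]
        exact norm_oracle_sub_le hX.pos φ hA2.pos heig r hn hρn hρ1 a β _ _
      · have hp : ∀ ω, ENNReal.ofReal (Γ * tikErr K (ρ n) n β (fun i => X i ω)
            (fun i => ε i ω) + ‖ρ n • ridgeInv K (ρ n) β‖) ^ 2
            ≤ ENNReal.ofReal (2 * Γ ^ 2) * ENNReal.ofReal (tikErr K (ρ n) n β (fun i => X i ω)
              fun i => ε i ω) ^ 2 + ENNReal.ofReal (2 * ‖ρ n • ridgeInv K (ρ n) β‖ ^ 2) := by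
          intro ω
          have hE0 := tikErr_nonneg K hρn n β (fun i => X i ω) fun i => ε i ω
          rw [← ENNReal.ofReal_pow (by positivity), ← ENNReal.ofReal_pow hE0,
            ← ENNReal.ofReal_mul (by positivity), ← ENNReal.ofReal_add (by positivity)
            (by positivity)]
          refine ENNReal.ofReal_le_ofReal ?_
          generalize tikErr K (ρ n) n β (fun i => X i ω) (fun i => ε i ω) = u
          generalize ‖ρ n • ridgeInv K (ρ n) β‖ = v
          nlinarith [sq_nonneg (Γ * u - v)]
        refine (lintegral_mono hp).trans ?_
        rw [lintegral_add_right _ measurable_const, lintegral_const, measure_univ, mul_one,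
          lintegral_const_mul' _ _ ENNReal.ofReal_ne_top]
        refine (add_le_add_left (mul_le_mul_right (htik n (ρ n) hn hρn hnρ1) _) _).trans ?_
        have hS0 := varSum_nonneg h0 (ρ n)
        rw [← ENNReal.ofReal_mul (by positivity), ← ENNReal.ofReal_add (by positivity)
          (by positivity)]
        refine ENNReal.ofReal_le_ofReal ?_
        have hρm : 0 ≤ ρ n ^ m := Real.rpow_nonneg hρn.le _
        calc 2 * Γ ^ 2 * (C₃ * (varSum lam (ρ n) / n)) + 2 * ‖ρ n • ridgeInv K (ρ n) β‖ ^ 2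
            ≤ 2 * Γ ^ 2 * (C₃ * (C₄ * varRate α ρ n)) + 2 * (C₅ * ρ n ^ m) := by
              gcongr
              exact hbias _ hρn hρ1
          _ = (2 * Γ ^ 2 * (C₃ * C₄)) * varRate α ρ n + 2 * C₅ * ρ n ^ m := by ring
          _ ≤ CB * varRate α ρ n + CB * ρ n ^ m := by
              have : 0 ≤ 2 * Γ ^ 2 * (C₃ * C₄) := by positivity
              exact add_le_add (mul_le_mul_of_nonneg_right (by linarith) hV0)
                (mul_le_mul_of_nonneg_right (by linarith) hρm)
          _ = _ := by unfold mseRate; ring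
    exact ⟨⟨hV0, hVM⟩,
      mse_comparison hbm hbm' (Real.sqrt_nonneg _) (Real.sqrt_nonneg _) hA hB⟩
  refine ⟨key.mono fun n hn => ⟨hn.2.1, hn.2.2.1⟩, ?_, ?_⟩
  · refine Asymptotics.IsBigO.of_bound (2 * (√CA * √CB) + CA) ?_
    filter_upwards [key] with n hn
    obtain ⟨⟨hV0, hVM⟩, -, -, h1, -⟩ := hn
    have hM0 := hV0.trans hVM
    rw [← Real.sqrt_eq_rpow, ← Real.sqrt_eq_rpow, Real.norm_of_nonneg (abs_nonneg _),
      Real.norm_of_nonneg (by positivity)]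
    refine h1.trans ?_
    rw [Real.sqrt_mul hCA0, Real.sqrt_mul hCB0]
    have e1 := Real.mul_self_sqrt hCA0
    have e2 := Real.mul_self_sqrt hV0
    have p1 : 0 ≤ √(mseRate α m ρ n) * √(varRate α ρ n) := by positivity
    calc √CA * √(varRate α ρ n) * (2 * (√CB * √(mseRate α m ρ n)) + √CA * √(varRate α ρ n))
        = 2 * (√CA * √CB) * (√(mseRate α m ρ n) * √(varRate α ρ n))
          + (√CA * √CA) * (√(varRate α ρ n) * √(varRate α ρ n)) := by ring
      _ = 2 * (√CA * √CB) * (√(mseRate α m ρ n) * √(varRate α ρ n)) + CA * varRate α ρ n := by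
          rw [e1, e2]
      _ ≤ (2 * (√CA * √CB) + CA) * (√(mseRate α m ρ n) * √(varRate α ρ n))
          + (2 * (√CA * √CB) + CA) * varRate α ρ n := by
          have : 0 ≤ 2 * (√CA * √CB) := by positivity
          exact add_le_add (mul_le_mul_of_nonneg_right (by linarith) p1)
            (mul_le_mul_of_nonneg_right (by linarith) hV0)
      _ = _ := by ring
  · refine Asymptotics.IsBigO.of_bound (2 * CA + 2 * CB) ?_
    filter_upwards [key] with n hn
    obtain ⟨⟨hV0, hVM⟩, -, -, -, h2⟩ := hn
    have hM0 := hV0.trans hVM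
    have hMSE : 0 ≤ MSE P (b n) β := integral_nonneg fun ω => sq_nonneg _
    rw [Real.norm_of_nonneg hM0, Real.norm_of_nonneg hMSE]
    refine h2.trans ?_
    have e1 := Real.sq_sqrt (mul_nonneg hCA0 hV0)
    have e2 := Real.sq_sqrt (mul_nonneg hCB0 hM0)
    have e3 := mul_le_mul_of_nonneg_left hVM hCA0
    nlinarith [sq_nonneg (√(CA * varRate α ρ n) - √(CB * mseRate α m ρ n))]

end Rates

end HybridReg

end

/-! ### The hybrid and Tikhonov estimators -/

open HybridReg in
theorem theorem2
    {Ω : Type*} [MeasurableSpace Ω] (P : Measure Ω) [IsProbabilityMeasure P]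
    {H : Type*} [NormedAddCommGroup H] [InnerProductSpace ℝ H] [CompleteSpace H]
    [SecondCountableTopology H] [MeasurableSpace H] [BorelSpace H]
    -- the model and the sample
    (a : ℝ) (β : H) (X : ℕ → Ω → H) (ε : ℕ → Ω → ℝ) (hsample : IsModelSample P X ε)
    (y : ℕ → Ω → ℝ) (hy : y = response a β X ε)
    -- the spectral decomposition of the covariance operator of the covariate
    (lam : ℕ → ℝ) (φ : HilbertBasis ℕ ℝ H)
    (heig : ∀ j, covOp P (X 0) (φ j) = lam j • φ j)
    -- the conditions (A1), (A2), (A3)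
    (α η : ℝ) (hA1 : CondA1 P (X 0)) (hA2 : CondA2 α lam) (hA3 : CondA3 η β φ)
    (hαη : α < 2 * η)
    -- the ridge parameters
    (ρ : ℕ → ℝ) (hρ_pos : ∀ᶠ n in atTop, 0 < ρ n) (hρ : Tendsto ρ atTop (𝓝 0))
    (hnρ : Tendsto (fun n : ℕ => (n : ℝ) * ρ n ^ 2) atTop atTop)
    -- the number of unpenalised components and the empirical eigensystems
    (r : ℕ) (lamHat : ℕ → Ω → ℕ → ℝ) (φHat : ℕ → Ω → ℕ → H)
    (hφHat_meas : ∀ n j, AEMeasurable (fun ω => φHat n ω j) P)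
    (hφHat : ∀ n, ∀ᵐ ω ∂P, IsEmpEigenSystem n (fun i => X i ω) (lamHat n ω) (φHat n ω))
    -- the exponent of the bias
    (m : ℝ)
    (hm : (η - 1 / 2 < α ∧ m = (2 * η - 1) / α) ∨ (α < η - 1 / 2 ∧ m = 2)) :
    -- for all large sample sizes the four mean squared errors are finite
    (∀ᶠ n in atTop,
      MemLp (fun ω => betaHatHR r ρ φHat X y n ω - β) 2 P ∧
      MemLp (fun ω => betaTildeHR P r ρ φ X y n ω - β) 2 P ∧
      MemLp (fun ω => betaHatTR ρ X y n ω - β) 2 P ∧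
      MemLp (fun ω => betaTildeTR P ρ X y n ω - β) 2 P) ∧
    -- the hybrid estimator
    ((fun n => |MSE P (betaHatHR r ρ φHat X y n) β - MSE P (betaTildeHR P r ρ φ X y n) β|)
      =O[atTop] (fun n =>
        mseRate α m ρ n ^ (1 / 2 : ℝ) * varRate α ρ n ^ (1 / 2 : ℝ) + varRate α ρ n)) ∧
    ((fun n => MSE P (betaHatHR r ρ φHat X y n) β) =O[atTop] mseRate α m ρ) ∧
    -- the Tikhonov estimator
    ((fun n => |MSE P (betaHatTR ρ X y n) β - MSE P (betaTildeTR P ρ X y n) β|)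
      =O[atTop] (fun n =>
        mseRate α m ρ n ^ (1 / 2 : ℝ) * varRate α ρ n ^ (1 / 2 : ℝ) + varRate α ρ n)) ∧
    ((fun n => MSE P (betaHatTR ρ X y n) β) =O[atTop] mseRate α m ρ) := by
  subst hy
  have hX := hsample.isGaussianSample hA1
  have hε := hsample.isModelNoise
  have hW : MemLp (X 0) 2 P := hA1.gaussian.memLp (by simp)
  have hHR := regularised_rates (a := a) hX hε heig hA2 hA3 hm hρ_pos hρ hnρ r hφHat_meas hφHat
    (b := betaHatHR r ρ φHat X (response a β X ε))
    (b' := betaTildeHR P r ρ φ X (response a β X ε))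
    (fun n hρn => by
      filter_upwards [hφHat n] with ω h1 h2
      exact hybrid_eq h1 h2 hρn _)
    (fun n hρn ω => by
      have hs : star (projFirst r φ) = projFirst r φ := by rw [projFirst_eq_diagOp, star_diagOp]
      have hs' : star (1 - projFirst r φ) = 1 - projFirst r φ := by rw [star_sub, hs, star_one]
      have h2 := covOp_comp hW hA1.centered hs'
      simp only [sub_apply, one_apply_eq_self] at h2
      rw [betaTildeHR, oracleHybrid]
      simp only [covOp_comp hW hA1.centered hs, h2, empCrossCov_map]
      exact pinv_add_pinv hX.pos hρn φ.orthonormal (fun j _ => hA2.pos j) (fun j _ => heig j) _)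
  -- With no unpenalised components the correction is an empty sum, and the Tikhonov estimators
  -- themselves remain.
  have hTR := regularised_rates (a := a) hX hε heig hA2 hA3 hm hρ_pos hρ hnρ 0 hφHat_meas hφHat
    (b := betaHatTR ρ X (response a β X ε)) (b' := betaTildeTR P ρ X (response a β X ε))
    (fun n _ => ae_of_all _ fun ω _ => by simp [betaHatTR, response, diagOp])
    (fun n _ ω => by simp [betaTildeTR, response, diagOp])
  refine ⟨?_, hHR.2.1, hHR.2.2, hTR.2.1, hTR.2.2⟩
  filter_upwards [hHR.1, hTR.1] with n h1 h2
  exact ⟨h1.1, h1.2, h2.1, h2.2⟩
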